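/- Let $d\in\{1,2,3\}$, $n\in\mathbb N\cup\{0\}$, let $y_1,\dots,y_n\in\mathbb R^d$ be pairwise distinct and $\alpha_1,\dots,\alpha_n\in\mathbb C$; if $d=1$, assume in addition that $\alpha_j\neq 0$ for all $j$. For $\kappa>0$ let $G^+(x,\kappa)$ be the outgoing Green function of $\Delta+\kappa^2$ in $\mathbb R^d$: $$G^+(x,\kappa)=\frac{e^{i\kappa|x|}}{2i\kappa}\ (d=1),\qquad G^+(x,\kappa)=-\frac i4H_0^{(1)}(\kappa|x|)\ (d=2),\qquad G^+(x,\kappa)=-\frac{e^{i\kappa|x|}}{4\pi|x|}\ (d=3),$$ where $H_0^{(1)}$ is the Hankel function of the first kind of order zero. For $k\in\mathbb R^d\setminus\{0\}$ put $\kappa=|k|$, $\theta=k/\kappa$, and let $\psi^+$ be the scattering solutions of the Schrödinger equation with the multipoint (Bethe–Peierls–Thomas–Fermi) potential $v=\sum_{j=1}^n\delta_{\alpha_j}(x-y_j)$, that is, $$\psi^+(x,k)=e^{ik\cdot x}+\psi^{sc}(x,k),\qquad \psi^{sc}(x,k)=\sum_{j=1}^n q_j(k)\,G^+(x-y_j,\kappa),\qquad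 x\ne y_1,\dots,y_n,$$ where $q(k)=(q_1(k),\dots,q_n(k))^t$ solves $A(\kappa)q(k)=-(e^{ik\cdot y_1},\dots,e^{ik\cdot y_n})^t$ with $A_{j,j'}(\kappa)=G^+(y_j-y_{j'},\kappa)$ for $j\ne j'$ and $$A_{j,j}(\kappa)=\alpha_j+(2i\kappa)^{-1}\ (d=1),\qquad \alpha_j-(4\pi)^{-1}(\pi i-2\ln\kappa)\ (d=2),\qquad \alpha_j-i(4\pi)^{-1}\kappa\ (d=3).$$ For all sufficiently large $\kappa$ this system has exactly one solution, so $\psi^+$ is then well defined. For $\omega\in\mathbb R^d$ with $|\omega|=1$, let $\mathcal Dv(x,\omega)=\int_0^\infty v(x+t\omega)\,dt$ be the divergent beam transform; for a finite complex combination $v$ of delta functions it is understood in the sense of distributions, that is, $\int_{\mathbb R^d}\mathcal D\delta(\cdot-y)(x,-\theta)\,\phi(x)\,dx=\int_0^\infty\phi(y+t\theta)\,dt$. Let $$v_{1,1}=\sum_{j=1}^n\frac{-1}{\alpha_j}\,\delta(x-y_j)\ (d=1),\qquad v_{2,1}=-2\pi\sum_{j=1}^n\delta(x-y_j),\quad v_{2,2}=4\pi^2\sum_{j=1}^n\Bigl(\alpha_j-\frac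 i4\Bigr)\delta(x-y_j)\ (d=2),$$ $$v_{3,1}=-4\pi i\sum_{j=1}^n\delta(x-y_j)\ (d=3).$$ Then for every compactly supported smooth function $\phi:\mathbb R^d\to\mathbb C$ the function $x\mapsto e^{-ik\cdot x}\psi^{sc}(x,k)\phi(x)$ is integrable for all sufficiently large $\kappa$, and, as $\kappa\to+\infty$, uniformly in $\theta$: if $d=1$, $$\int_{\mathbb R}e^{-ik\cdot x}\psi^{sc}(x,k)\phi(x)\,dx=(2i\kappa)^{-1}\int_{\mathbb R}\mathcal Dv_{1,1}(x,-\theta)\phi(x)\,dx+\mathcal O(\kappa^{-2});$$ if $d=2$, $$\int_{\mathbb R^2}e^{-ik\cdot x}\psi^{sc}(x,k)\phi(x)\,dx=(2i\kappa)^{-1}(\ln\kappa)^{-1}\int_{\mathbb R^2}\mathcal Dv_{2,1}(x,-\theta)\phi(x)\,dx+(2i\kappa)^{-1}(\ln\kappa)^{-2}\int_{\mathbb R^2}\mathcal Dv_{2,2}(x,-\theta)\phi(x)\,dx+\mathcal O\bigl(\kappa^{-1}(\ln\kappa)^{-3}\bigr);$$ if $d=3$, $$\int_{\mathbb R^3}e^{-ik\cdot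 x}\psi^{sc}(x,k)\phi(x)\,dx=(2i)^{-1}\kappa^{-2}\int_{\mathbb R^3}\mathcal Dv_{3,1}(x,-\theta)\phi(x)\,dx+\mathcal O(\kappa^{-3}).$$ -/

import Mathlib

open MeasureTheory Filter Asymptotics Bornology
open scoped SchwartzMap ContDiff

noncomputable section

namespace PointScatterers

/-- The Euclidean space `ℝ^d`. -/
abbrev Space (d : ℕ) := EuclideanSpace ℝ (Fin d)

/-- The Hankel function of the first kind of order zero, `H₀⁽¹⁾(r)` for `r > 0`, by Hankel's
integral
`H₀⁽¹⁾(r) = (√2 / π) e^{i (r - π/4)} ∫₀^∞ e^{-r s} s^{-1/2} (1 + i s / 2)^{-1/2} ds`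
(principal branch). -/
def hankelH10 (r : ℝ) : ℂ :=
  ((√2 / Real.pi : ℝ) : ℂ) * Complex.exp (Complex.I * ((r - Real.pi / 4 : ℝ) : ℂ)) *
    ∫ s in Set.Ioi (0 : ℝ),
      ((Real.exp (-(r * s)) / √s : ℝ) : ℂ) *
        (1 + Complex.I * (s : ℂ) / 2) ^ (-(1 / 2) : ℂ)

/-- The outgoing Green function of `Δ + κ²` in `ℝ^d`, `d = 1, 2, 3`, as a function of the
wave number `κ > 0` and the radius `r = |x|`. (The value in other dimensions is not used.) -/
def greenRadial : ℕ → ℝ → ℝ → ℂ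
  | 1, κ, r => Complex.exp (Complex.I * (κ : ℂ) * (r : ℂ)) / (2 * Complex.I * (κ : ℂ))
  | 2, κ, r => -(Complex.I / 4) * hankelH10 (r * κ)
  | 3, κ, r =>
      -(Complex.exp (Complex.I * (κ : ℂ) * (r : ℂ)) / (4 * (Real.pi : ℂ) * (r : ℂ)))
  | _, _, _ => 0

/-- The outgoing Green function `G⁺(x, κ)` of `Δ + κ²` in `ℝ^d`, `d = 1, 2, 3`. -/
def green {d : ℕ} (x : Space d) (κ : ℝ) : ℂ := greenRadial d κ ‖x‖

/-- The diagonal entry of the matrix `A(κ)` belonging to a scatterer of parameter `α`, in dimension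
`d = 1, 2, 3`. (The value in other dimensions is not used.) -/
def diagEntry : ℕ → ℝ → ℂ → ℂ
  | 1, κ, α => α + (2 * Complex.I * (κ : ℂ))⁻¹
  | 2, κ, α =>
      α - (4 * (Real.pi : ℂ))⁻¹ * ((Real.pi : ℂ) * Complex.I - 2 * ((Real.log κ : ℝ) : ℂ))
  | 3, κ, α => α - Complex.I * (4 * (Real.pi : ℂ))⁻¹ * (κ : ℂ)
  | _, _, _ => 0

/-- The plane wave `e^{i k · x}`. -/
def planeWave {d : ℕ} (k x : Space d) : ℂ := Complex.exp (Complex.I * ((inner ℝ k x : ℝ) : ℂ))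

/-- The matrix `A(κ)` of the multipoint potential with points `y j` and parameters `α j`. -/
def matA {d n : ℕ} (α : Fin n → ℂ) (y : Fin n → Space d) (κ : ℝ) : Matrix (Fin n) (Fin n) ℂ :=
  Matrix.of fun j j' => if j = j' then diagEntry d κ (α j) else green (y j - y j') κ

/-- The right-hand side `b(k) = -(e^{i k · y₁}, …, e^{i k · yₙ})`. -/
def vecB {d n : ℕ} (y : Fin n → Space d) (k : Space d) : Fin n → ℂ :=
  fun j => -planeWave k (y j)

/-- `q = q(k)` solves the linear system `A(κ) q(k) = b(k)`, where `κ = |k|`. -/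
def IsCoeff {d n : ℕ} (α : Fin n → ℂ) (y : Fin n → Space d) (k : Space d) (q : Fin n → ℂ) : Prop :=
  (matA α y ‖k‖).mulVec q = vecB y k

/-- `ψ k x = ψ⁺(x, k)` are the scattering solutions of the multipoint potential with points `y j`
and parameters `α j` at all sufficiently high energies: for `|k|` large enough,
`ψ⁺(x, k) = e^{i k · x} + ∑ j, q_j(k) G⁺(x - y_j, |k|)` off the points `y_j`, where
`A(|k|) q(k) = b(k)`. -/
def IsScatteringSolution {d n : ℕ} (α : Fin n → ℂ) (y : Fin n → Space d)
    (ψ : Space d → Space d → ℂ) : Prop :=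
  ∀ᶠ k in cobounded (Space d), ∃ q : Fin n → ℂ, IsCoeff α y k q ∧
    ∀ x : Space d, (∀ j, x ≠ y j) →
      ψ k x = planeWave k x + ∑ j, q j * green (x - y j) ‖k‖

/-- The scattered wave `ψ^{sc}(x, k) = ψ⁺(x, k) - e^{i k · x}`. -/
def scatteredWave {d : ℕ} (ψ : Space d → Space d → ℂ) (k x : Space d) : ℂ :=
  ψ k x - planeWave k x

/-- The integrand `e^{-i k · x} ψ^{sc}(x, k) φ(x)`. -/
def testedWave {d : ℕ} (ψ : Space d → Space d → ℂ) (φ : Space d → ℂ) (k x : Space d) : ℂ :=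
  Complex.exp (-(Complex.I * ((inner ℝ k x : ℝ) : ℂ))) * scatteredWave ψ k x * φ x

/-- The combination `∑ j, c_j δ(x - y_j)` of Dirac delta functions. -/
def deltaComb {d n : ℕ} (c : Fin n → ℂ) (y : Fin n → Space d) : 𝓢'(Space d, ℂ) :=
  ∑ j, c j • TemperedDistribution.delta (y j)

/-- `v_{1,1} = ∑ j, (-1 / α_j) δ(x - y_j)` on `ℝ`. -/
def v11 {n : ℕ} (α : Fin n → ℂ) (y : Fin n → Space 1) : 𝓢'(Space 1, ℂ) :=
  deltaComb (fun j => -1 / α j) y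

/-- `v_{2,1} = -2π ∑ j, δ(x - y_j)` on `ℝ²`. -/
def v21 {n : ℕ} (y : Fin n → Space 2) : 𝓢'(Space 2, ℂ) :=
  deltaComb (fun _ => -2 * (Real.pi : ℂ)) y

/-- `v_{2,2} = 4π² ∑ j, (α_j - i/4) δ(x - y_j)` on `ℝ²`. -/
def v22 {n : ℕ} (α : Fin n → ℂ) (y : Fin n → Space 2) : 𝓢'(Space 2, ℂ) :=
  deltaComb (fun j => 4 * (Real.pi : ℂ) ^ 2 * (α j - Complex.I / 4)) y

/-- `v_{3,1} = -4π i ∑ j, δ(x - y_j)` on `ℝ³`. -/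
def v31 {n : ℕ} (y : Fin n → Space 3) : 𝓢'(Space 3, ℂ) :=
  deltaComb (fun _ => -4 * (Real.pi : ℂ) * Complex.I) y

/-- The divergent beam transform `𝒟v(·, θ) = ∫₀^∞ v(· + t θ) dt` of a distribution `v`, tested
against `φ`; the integral over `t` is understood weakly, and the translate `v(· + t θ)` is the
distribution `φ ↦ ⟨v, φ(· - t θ)⟩`. So `beamPairing v θ φ` is `∫ 𝒟v(x, θ) φ(x) dx`. It is used for
compactly supported `v`, unit vectors `θ` and compactly supported `φ`; then the integrand vanishes
for large `t`. -/
def beamPairing {d : ℕ} (v : 𝓢'(Space d, ℂ)) (θ : Space d) (φ : 𝓢(Space d, ℂ)) : ℂ :=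
  ∫ t in Set.Ioi (0 : ℝ), v (φ.compSubConstCLM ℂ (t • θ))

/-- The direction `θ = k / |k|`. -/
def direction {d : ℕ} (k : Space d) : Space d := ‖k‖⁻¹ • k

end PointScatterers

end

open PointScatterers

/-! Translating each scatterer to the origin turns the tested scattered wave into a finite sum over
j of c_j(k) times I_j(k). Here c_j = q_j e^{-ik·y_j}, and I_j is the integral of e^{-ik·z} G⁺(z, κ)
f(z) with f = φ(· + y_j). The two factors are expanded separately and multiplied in
`testedWave_asymptotics`.

Coefficients: at high energy A(κ) is diagonally dominant, because its off-diagonal entries are small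
compared with the diagonal ones. Hence c_j is -1/A_jj up to a controlled error
(`mulVec_eq_of_diagonally_dominant`, `coeff_estimate`). Expanding -1/A_jj in κ, or in ln κ when d =
2, produces the weights of v_{1,1}, v_{2,1}, v_{2,2}, v_{3,1}.

Green function: I_j is (2iκ)⁻¹ times the integral of f along the ray in direction θ, up to O(κ⁻²)
for d = 1, 3 and O(κ^{-3/2}) for d = 2. With z = sθ + w, w ⊥ θ, the phase κ(|z| - s) splits as κ(|s|
- s) + κ(|z| - |s|). For fixed s ≠ 0 the second part is stationary only at w = 0, so the transversal
integral (present if d > 1) localises to a constant times f(sθ). For d = 3 this is an exact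
integration by parts in polar coordinates (`EvenSlice.norm_integral_osc_le`). For d = 2 the Hankel
function is replaced by its leading term, and a Fresnel substitution applies
(`EvenSlice.norm_integral_osc_sqrt_sub_le`). The first part vanishes for s > 0 and oscillates for s
< 0, so only the forward ray survives (`norm_integral_beam_sub_le`).

Uniformity in θ holds because every constant depends on f only through the bounds M and R of
`SliceControl`, which serve all lines in all directions at once. -/

noncomputable section

namespace PointScatterers

/-! ### The Fresnel integral -/

/-- The primitive eighth root of unity `e^{iπ/4}`. -/
def rootI : ℂ := Complex.exp (Complex.I * ((Real.pi / 4 : ℝ) : ℂ))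

theorem rootI_eq : rootI = ((√2 / 2 : ℝ) : ℂ) + ((√2 / 2 : ℝ) : ℂ) * Complex.I := by
  rw [rootI, mul_comm, Complex.exp_mul_I, ← Complex.ofReal_cos, ← Complex.ofReal_sin,
    Real.cos_pi_div_four, Real.sin_pi_div_four]

theorem norm_rootI : ‖rootI‖ = 1 := by
  rw [rootI, mul_comm, Complex.norm_exp_ofReal_mul_I]

theorem rootI_mul_self : rootI * rootI = Complex.I := by
  rw [rootI, ← Complex.exp_add]
  refine Eq.trans ?_ Complex.exp_pi_div_two_mul_I
  congr 1
  push_cast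
  ring

theorem norm_exp_I_mul (x : ℝ) : ‖Complex.exp (Complex.I * (x : ℂ))‖ = 1 := by
  rw [mul_comm, Complex.norm_exp_ofReal_mul_I]

/-- The integrand of `fresnelTail`, the oscillatory integrand on a rotated contour. -/
def fresnelKernel (τ x : ℝ) : ℂ :=
  Complex.exp (-1 * (x : ℂ) ^ 2 + 2 * Complex.I * rootI * τ * x + 0)

/-- On the contour t = τ + `rootI` x one has it² = iτ² + 2iτ `rootI` x - x², since `rootI` squares
to i. The oscillation thus becomes Gaussian decay, and the real part of 2i `rootI` is -√2. -/
theorem norm_fresnelKernel (τ x : ℝ) :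
    ‖fresnelKernel τ x‖ = Real.exp (-x ^ 2 - √2 * τ * x) := by
  rw [fresnelKernel, Complex.norm_exp]
  congr 1
  rw [rootI_eq]
  simp [← Complex.ofReal_pow]
  ring

/-- The summand `+ 0` in `fresnelKernel` gives the exponent the shape b x² + c x + d expected by
`integrable_cexp_quadratic'`. -/
theorem integrable_fresnelKernel (τ : ℝ) : Integrable (fresnelKernel τ) :=
  integrable_cexp_quadratic' (by simp) _ _

theorem integrable_exp_quadratic (c : ℝ) : Integrable fun x : ℝ => Real.exp (-x ^ 2 + c * x) := by
  have h := (integrable_cexp_quadratic' (b := -1) (by simp) (c : ℂ) 0).norm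
  refine h.congr (ae_of_all _ fun x => ?_)
  simp [Complex.norm_exp, ← Complex.ofReal_pow]

/-- Minus the tail `∫_τ^∞ e^{i t²} dt` of the Fresnel integral. -/
def fresnelTail (τ : ℝ) : ℂ :=
  -rootI * Complex.exp (Complex.I * ((τ ^ 2 : ℝ) : ℂ)) * ∫ x in Set.Ioi (0 : ℝ), fresnelKernel τ x

theorem fresnelTail_zero : fresnelTail 0 = -rootI * ((√Real.pi / 2 : ℝ) : ℂ) := by
  have h : ∫ x in Set.Ioi (0 : ℝ), fresnelKernel 0 x = ((√Real.pi / 2 : ℝ) : ℂ) := by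
    have := integral_gaussian_Ioi 1
    rw [div_one] at this
    rw [← this, ← integral_complex_ofReal]
    simp [fresnelKernel]
  rw [fresnelTail, h]
  simp

/-- The Gaussian factor is dropped and √2 lowered to 1, which leaves the integral of e^{-τx}. -/
theorem norm_fresnelTail_le {τ : ℝ} (hτ : 0 < τ) : ‖fresnelTail τ‖ ≤ τ⁻¹ := by
  have h2 : (1 : ℝ) ≤ √2 := Real.one_le_sqrt.2 (by norm_num)
  rw [fresnelTail, norm_mul, norm_mul, norm_neg, norm_rootI, norm_exp_I_mul, one_mul, one_mul]
  have hi : IntegrableOn (fun x : ℝ => Real.exp (-τ * x)) (Set.Ioi 0) :=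
    integrableOn_exp_mul_Ioi (neg_lt_zero.2 hτ) 0
  refine (norm_integral_le_of_norm_le hi ?_).trans_eq ?_
  · refine (ae_restrict_iff' measurableSet_Ioi).2 (ae_of_all _ fun x hx => ?_)
    have hx : 0 < x := hx
    rw [norm_fresnelKernel]
    refine Real.exp_le_exp.2 ?_
    have : τ * x ≤ √2 * τ * x := by
      have := mul_le_mul_of_nonneg_right h2 (mul_pos hτ hx).le
      linarith
    nlinarith [sq_nonneg x]
  · rw [integral_exp_mul_Ioi (neg_lt_zero.2 hτ)]
    simp

theorem hasDerivAt_fresnelKernel (τ x : ℝ) :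
    HasDerivAt (fun t => fresnelKernel t x) (2 * Complex.I * rootI * x * fresnelKernel τ x) τ := by
  unfold fresnelKernel
  have h : HasDerivAt (fun t : ℝ => (-1 * (x : ℂ) ^ 2 + 2 * Complex.I * rootI * t * x + 0))
      (2 * Complex.I * rootI * x) τ := by
    have h1 : HasDerivAt (fun t : ℝ => (t : ℂ)) 1 τ := Complex.ofRealCLM.hasDerivAt
    have h2 := (((h1.const_mul (2 * Complex.I * rootI)).mul_const (x : ℂ)).const_add
      (-1 * (x : ℂ) ^ 2)).add_const 0
    simpa using h2
  exact h.cexp.congr_deriv (mul_comm _ _)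

theorem hasDerivAt_fresnelKernel_right (τ x : ℝ) :
    HasDerivAt (fresnelKernel τ) ((-2 * x + 2 * Complex.I * rootI * τ) * fresnelKernel τ x) x := by
  unfold fresnelKernel
  have h : HasDerivAt (fun x : ℝ => (-1 * (x : ℂ) ^ 2 + 2 * Complex.I * rootI * τ * x + 0))
      (-2 * x + 2 * Complex.I * rootI * τ) x := by
    have h1 : HasDerivAt (fun t : ℝ => (t : ℂ)) 1 x := Complex.ofRealCLM.hasDerivAt
    have h2 := (((h1.pow 2).const_mul (-1)).add (h1.const_mul (2 * Complex.I * rootI * τ))).add_const 0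
    refine h2.congr_deriv ?_
    simp
  exact h.cexp.congr_deriv (mul_comm _ _)

/-- The dominating function for differentiation under the integral, locally uniform in τ. The factor
x is absorbed by x ≤ e^x. -/
theorem norm_mul_fresnelKernel_le {τ x T : ℝ} (hx : 0 < x) (hT : |τ| ≤ T) :
    ‖2 * Complex.I * rootI * x * fresnelKernel τ x‖
      ≤ 2 * Real.exp (-x ^ 2 + (2 * T + 1) * x) := by
  have h2 : √2 ≤ 2 := by
    rw [Real.sqrt_le_left (by norm_num)]; norm_num
  rw [norm_mul, norm_mul, norm_mul, norm_mul, norm_rootI, norm_fresnelKernel, Complex.norm_I,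
    Complex.norm_real, Real.norm_of_nonneg hx.le, Complex.norm_two, mul_one, mul_one, mul_assoc]
  refine mul_le_mul_of_nonneg_left ?_ (by norm_num)
  have hx' : x ≤ Real.exp x := by linarith [Real.add_one_le_exp x]
  calc x * Real.exp (-x ^ 2 - √2 * τ * x) ≤ Real.exp x * Real.exp (-x ^ 2 + 2 * T * x) := by
        gcongr
        have h3 : -(√2 * τ) ≤ 2 * T := by
          have h4 : √2 * (-τ) ≤ √2 * |τ| :=
            mul_le_mul_of_nonneg_left (neg_le_abs τ) (Real.sqrt_nonneg _)
          have h5 : √2 * |τ| ≤ 2 * T := mul_le_mul h2 hT (abs_nonneg _) (by norm_num)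
          linarith
        nlinarith
    _ = _ := by rw [← Real.exp_add]; congr 1; ring

/-- This replaces a contour shift. Since `rootI` squares to i, the kernel satisfies ∂_x = `rootI`
∂_τ + 2i `rootI` τ. Integrating ∂_x over the half-line gives -1, and this identity is exactly what
the product rule for `fresnelTail` needs. -/
theorem hasDerivAt_fresnelTail (τ : ℝ) :
    HasDerivAt fresnelTail (Complex.exp (Complex.I * ((τ ^ 2 : ℝ) : ℂ))) τ := by
  have hcont : ∀ t, Continuous (fresnelKernel t) := fun t => by unfold fresnelKernel; fun_prop
  obtain ⟨hint, hder⟩ := hasDerivAt_integral_of_dominated_loc_of_deriv_le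
    (μ := volume.restrict (Set.Ioi (0 : ℝ))) (F := fresnelKernel)
    (F' := fun t x => 2 * Complex.I * rootI * x * fresnelKernel t x) (x₀ := τ)
    (s := Metric.ball τ 1)
    (bound := fun x => 2 * Real.exp (-x ^ 2 + (2 * (|τ| + 1) + 1) * x))
    (Metric.ball_mem_nhds τ one_pos)
    (Eventually.of_forall fun t => (hcont t).aestronglyMeasurable)
    (integrable_fresnelKernel τ).integrableOn
    (by
      have := hcont τ
      exact Continuous.aestronglyMeasurable (by fun_prop))
    ((ae_restrict_iff' measurableSet_Ioi).2 (ae_of_all _ fun x hx t ht =>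
      norm_mul_fresnelKernel_le hx (by
        rw [Metric.mem_ball, Real.dist_eq] at ht
        have := abs_sub_abs_le_abs_sub t τ
        linarith)))
    ((integrable_exp_quadratic _).const_mul 2).integrableOn
    (ae_of_all _ fun x t _ => hasDerivAt_fresnelKernel t x)
  have hftc : ∫ x in Set.Ioi (0 : ℝ),
      (-2 * (x : ℂ) + 2 * Complex.I * rootI * τ) * fresnelKernel τ x = -1 := by
    have hdecomp : ∀ x : ℝ, (-2 * (x : ℂ) + 2 * Complex.I * rootI * τ) * fresnelKernel τ x
        = rootI * (2 * Complex.I * rootI * x * fresnelKernel τ x)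
          + 2 * Complex.I * rootI * τ * fresnelKernel τ x := fun x => by
      linear_combination (-2 * x * fresnelKernel τ x * Complex.I) * rootI_mul_self
        - 2 * x * fresnelKernel τ x * Complex.I_mul_I
    have hi : IntegrableOn (fun x : ℝ =>
        (-2 * (x : ℂ) + 2 * Complex.I * rootI * τ) * fresnelKernel τ x) (Set.Ioi 0) := by
      simp only [hdecomp]
      exact (hint.const_mul _).add ((integrable_fresnelKernel τ).integrableOn.const_mul _)
    have htend : Tendsto (fresnelKernel τ) atTop (nhds 0) := by
      refine tendsto_zero_of_hasDerivAt_of_integrableOn_Ioi (a := 0)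
        (fun x _ => hasDerivAt_fresnelKernel_right τ x) hi
        (integrable_fresnelKernel τ).integrableOn
    rw [integral_Ioi_of_hasDerivAt_of_tendsto (hcont τ).continuousWithinAt
      (fun x _ => hasDerivAt_fresnelKernel_right τ x) hi htend]
    simp [fresnelKernel]
  have hsplit : ∫ x in Set.Ioi (0 : ℝ),
      (-2 * (x : ℂ) + 2 * Complex.I * rootI * τ) * fresnelKernel τ x
      = rootI * (∫ x in Set.Ioi (0 : ℝ), 2 * Complex.I * rootI * x * fresnelKernel τ x)
        + 2 * Complex.I * rootI * τ * ∫ x in Set.Ioi (0 : ℝ), fresnelKernel τ x := by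
    rw [← integral_const_mul, ← integral_const_mul, ← integral_add (hint.const_mul _)
      ((integrable_fresnelKernel τ).integrableOn.const_mul _)]
    refine integral_congr_ae (ae_of_all _ fun x => ?_)
    linear_combination (-2 * x * fresnelKernel τ x * Complex.I) * rootI_mul_self
        - 2 * x * fresnelKernel τ x * Complex.I_mul_I
  have hexp : HasDerivAt (fun t : ℝ => Complex.exp (Complex.I * ((t ^ 2 : ℝ) : ℂ)))
      (Complex.exp (Complex.I * ((τ ^ 2 : ℝ) : ℂ)) * (Complex.I * ((2 * τ : ℝ) : ℂ))) τ := by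
    have h1 : HasDerivAt (fun t : ℝ => ((t ^ 2 : ℝ) : ℂ)) ((2 * τ : ℝ) : ℂ) τ := by
      have := (hasDerivAt_pow 2 τ).ofReal_comp
      simpa using this
    exact (h1.const_mul _).cexp
  have := (hexp.const_mul (-rootI)).mul hder
  refine this.congr_deriv ?_
  rw [hftc] at hsplit
  push_cast at hsplit ⊢
  linear_combination (Complex.exp (Complex.I * (τ : ℂ) ^ 2)) * hsplit

/-! ### One-dimensional oscillatory integrals -/

/-- The distance `√(a² + ρ²)`. -/
def radius (a ρ : ℝ) : ℝ := √(a ^ 2 + ρ ^ 2)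

theorem radius_pos {a : ℝ} (ha : 0 < a) (ρ : ℝ) : 0 < radius a ρ := by
  unfold radius; positivity

theorem sq_radius (a ρ : ℝ) : radius a ρ ^ 2 = a ^ 2 + ρ ^ 2 := by
  unfold radius
  rw [Real.sq_sqrt (by positivity)]

theorem radius_zero {a : ℝ} (ha : 0 < a) : radius a 0 = a := by
  simp [radius, Real.sqrt_sq ha.le]

theorem le_radius (a ρ : ℝ) : a ≤ radius a ρ :=
  Real.le_sqrt_of_sq_le (by nlinarith [sq_nonneg ρ])

theorem le_radius_right (a ρ : ℝ) : ρ ≤ radius a ρ :=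
  Real.le_sqrt_of_sq_le (by nlinarith [sq_nonneg a])

theorem radius_le_add {a ρ : ℝ} (ha : 0 ≤ a) (hρ : 0 ≤ ρ) : radius a ρ ≤ a + ρ :=
  Real.sqrt_le_iff.2 ⟨by positivity, by nlinarith⟩

@[fun_prop]
theorem continuous_radius (a : ℝ) : Continuous (radius a) := by
  unfold radius; fun_prop

theorem hasDerivAt_radius {a : ℝ} (ha : 0 < a) (ρ : ℝ) :
    HasDerivAt (radius a) (ρ / radius a ρ) ρ := by
  unfold radius
  have h : HasDerivAt (fun ρ : ℝ => a ^ 2 + ρ ^ 2) (2 * ρ) ρ := by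
    simpa using (hasDerivAt_pow 2 ρ).const_add (a ^ 2)
  refine (h.sqrt (by positivity)).congr_deriv ?_
  field_simp

/-- The phase factor `e^{iκ(√(a² + ρ²) - a)}`. -/
def osc (a κ ρ : ℝ) : ℂ := Complex.exp (Complex.I * ((κ * (radius a ρ - a) : ℝ) : ℂ))

theorem norm_osc (a κ ρ : ℝ) : ‖osc a κ ρ‖ = 1 := norm_exp_I_mul _

theorem osc_zero {a : ℝ} (ha : 0 < a) (κ : ℝ) : osc a κ 0 = 1 := by
  simp [osc, radius_zero ha]

@[fun_prop]
theorem continuous_osc (a κ : ℝ) : Continuous (osc a κ) := by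
  unfold osc; fun_prop

theorem hasDerivAt_osc {a : ℝ} (ha : 0 < a) (κ ρ : ℝ) :
    HasDerivAt (osc a κ) (Complex.I * κ * (osc a κ ρ * ((ρ / radius a ρ : ℝ) : ℂ))) ρ := by
  unfold osc
  have h := ((((hasDerivAt_radius ha ρ).sub_const a).const_mul κ).ofReal_comp.const_mul
    Complex.I).cexp
  refine h.congr_deriv ?_
  push_cast
  ring

/-- A function `g₀` on the line with `g₀' = g₁`, `g₁' = g₂`, `g₂' = g₃`, all bounded by `M`,
with `g₀'(0) = 0` and `g₀ = 0` on `[R, ∞)`. -/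
structure EvenSlice (M R : ℝ) (g₀ g₁ g₂ g₃ : ℝ → ℂ) : Prop where
  deriv₀ : ∀ ρ, HasDerivAt g₀ (g₁ ρ) ρ
  deriv₁ : ∀ ρ, HasDerivAt g₁ (g₂ ρ) ρ
  deriv₂ : ∀ ρ, HasDerivAt g₂ (g₃ ρ) ρ
  bound₀ : ∀ ρ, ‖g₀ ρ‖ ≤ M
  bound₁ : ∀ ρ, ‖g₁ ρ‖ ≤ M
  bound₂ : ∀ ρ, ‖g₂ ρ‖ ≤ M
  bound₃ : ∀ ρ, ‖g₃ ρ‖ ≤ M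
  zero₁ : g₁ 0 = 0
  supp₀ : g₀ R = 0
  supp₁ : g₁ R = 0

namespace EvenSlice

variable {M R : ℝ} {g₀ g₁ g₂ g₃ : ℝ → ℂ}

theorem nonneg (h : EvenSlice M R g₀ g₁ g₂ g₃) : 0 ≤ M := (norm_nonneg _).trans (h.bound₀ 0)

theorem continuous₀ (h : EvenSlice M R g₀ g₁ g₂ g₃) : Continuous g₀ :=
  continuous_iff_continuousAt.2 fun ρ => (h.deriv₀ ρ).continuousAt

theorem continuous₁ (h : EvenSlice M R g₀ g₁ g₂ g₃) : Continuous g₁ :=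
  continuous_iff_continuousAt.2 fun ρ => (h.deriv₁ ρ).continuousAt

theorem continuous₂ (h : EvenSlice M R g₀ g₁ g₂ g₃) : Continuous g₂ :=
  continuous_iff_continuousAt.2 fun ρ => (h.deriv₂ ρ).continuousAt

theorem norm_first_le (h : EvenSlice M R g₀ g₁ g₂ g₃) {ρ : ℝ} (hρ : 0 ≤ ρ) : ‖g₁ ρ‖ ≤ M * ρ := by
  have := norm_image_sub_le_of_norm_deriv_le_segment' (f := g₁) (f' := g₂) (a := 0) (b := ρ)
    (C := M) (fun x _ => (h.deriv₁ x).hasDerivWithinAt) (fun x _ => h.bound₂ x) ρ ⟨hρ, le_rfl⟩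
  simpa [h.zero₁] using this

/-- The left side is the numerator of the derivative of g₁/ρ. It vanishes at 0 and has derivative ρ
g₃, hence is quadratically small. -/
theorem norm_second_le (h : EvenSlice M R g₀ g₁ g₂ g₃) {ρ : ℝ} (hρ : 0 ≤ ρ) :
    ‖(ρ : ℂ) * g₂ ρ - g₁ ρ‖ ≤ M * ρ ^ 2 := by
  have hd : ∀ x : ℝ, HasDerivAt (fun x : ℝ => (x : ℂ) * g₂ x - g₁ x) ((x : ℂ) * g₃ x) x := by
    intro x
    have h1 : HasDerivAt (fun t : ℝ => (t : ℂ)) 1 x := Complex.ofRealCLM.hasDerivAt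
    refine ((h1.mul (h.deriv₂ x)).sub (h.deriv₁ x)).congr_deriv ?_
    ring
  have := norm_image_sub_le_of_norm_deriv_le_segment' (a := 0) (b := ρ)
    (C := M * ρ) (fun x _ => (hd x).hasDerivWithinAt) (fun x hx => by
      rw [norm_mul, Complex.norm_real, Real.norm_of_nonneg hx.1, mul_comm]
      exact mul_le_mul (h.bound₃ x) hx.2.le hx.1 h.nonneg) ρ ⟨hρ, le_rfl⟩
  simpa [h.zero₁, mul_assoc, sq] using this

/-- First-order non-stationary phase estimate for a slice whose derivative vanishes at `0`. -/
theorem norm_integral_osc_deriv_le (h : EvenSlice M R g₀ g₁ g₂ g₃) {a κ : ℝ} (ha : 0 < a)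
    (haR : a ≤ R) (hR : 1 ≤ R) (hκ : 1 ≤ κ) :
    ‖∫ ρ in (0 : ℝ)..R, g₁ ρ * osc a κ ρ‖ ≤ M * (1 + 3 * R + 2 * R ^ 2) * κ⁻¹ := by
  have hκ0 : 0 < κ := by linarith
  have hM := h.nonneg
  have hε : 0 < κ⁻¹ := inv_pos.2 hκ0
  have hεR : κ⁻¹ ≤ R := (inv_le_one_of_one_le₀ hκ).trans hR
  have hcont : Continuous fun ρ => g₁ ρ * osc a κ ρ := h.continuous₁.mul (continuous_osc a κ)
  -- Division by the phase derivative κρ/r is singular at ρ = 0. The piece [0, κ⁻¹] is bounded by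
  -- its length, and integration by parts is used only beyond it.
  rw [← intervalIntegral.integral_add_adjacent_intervals (hcont.intervalIntegrable 0 κ⁻¹)
    (hcont.intervalIntegrable κ⁻¹ R)]
  have h1 : ‖∫ ρ in (0 : ℝ)..κ⁻¹, g₁ ρ * osc a κ ρ‖ ≤ M * κ⁻¹ := by
    have := intervalIntegral.norm_integral_le_of_norm_le_const (a := 0) (b := κ⁻¹) (C := M)
      (f := fun ρ => g₁ ρ * osc a κ ρ) (fun ρ _ => by
        rw [norm_mul, norm_osc, mul_one]; exact h.bound₁ ρ)
    rwa [sub_zero, abs_of_pos hε] at this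
  -- The amplitude divided by the phase derivative, apart from iκ. Its derivative `u'` is grouped so
  -- that `norm_first_le` and `norm_second_le` cancel all negative powers of ρ.
  set u : ℝ → ℂ := fun ρ => ((radius a ρ / ρ : ℝ) : ℂ) * g₁ ρ with hu
  set u' : ℝ → ℂ := fun ρ => ((1 / radius a ρ : ℝ) : ℂ) * g₁ ρ +
    ((radius a ρ / ρ ^ 2 : ℝ) : ℂ) * ((ρ : ℂ) * g₂ ρ - g₁ ρ) with hu'
  have hpos : ∀ ρ ∈ Set.uIcc κ⁻¹ R, 0 < ρ ∧ ρ ≤ R := fun ρ hρ => by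
    rw [Set.uIcc_of_le hεR] at hρ
    exact ⟨hε.trans_le hρ.1, hρ.2⟩
  have hr : ∀ ρ, 0 < radius a ρ := radius_pos ha
  have hrR : ∀ ρ, 0 < ρ → ρ ≤ R → radius a ρ ≤ 2 * R := fun ρ h0 h1 =>
    (radius_le_add ha.le h0.le).trans (by linarith)
  have hderiv : ∀ ρ ∈ Set.uIcc κ⁻¹ R, HasDerivAt u (u' ρ) ρ := fun ρ hρ => by
    have hρ0 := (hpos ρ hρ).1
    have h2 : HasDerivAt (fun ρ => radius a ρ / ρ)
        ((ρ / radius a ρ * ρ - radius a ρ * 1) / ρ ^ 2) ρ :=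
      (hasDerivAt_radius ha ρ).div (hasDerivAt_id ρ) hρ0.ne'
    refine (h2.ofReal_comp.mul (h.deriv₁ ρ)).congr_deriv ?_
    have e1 : ((radius a ρ : ℝ) : ℂ) ≠ 0 := by exact_mod_cast (hr ρ).ne'
    have e2 : (ρ : ℂ) ≠ 0 := by exact_mod_cast hρ0.ne'
    simp only [hu']
    push_cast
    field_simp
    ring
  have hu'cont : ContinuousOn u' (Set.uIcc κ⁻¹ R) := by
    have c1 := h.continuous₁
    have c2 := h.continuous₂
    have d1 : ContinuousOn (fun ρ => 1 / radius a ρ) (Set.uIcc κ⁻¹ R) :=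
      ContinuousOn.div (by fun_prop) (by fun_prop) fun ρ _ => (hr ρ).ne'
    have d2 : ContinuousOn (fun ρ => radius a ρ / ρ ^ 2) (Set.uIcc κ⁻¹ R) :=
      ContinuousOn.div (by fun_prop) (by fun_prop) fun ρ hρ => by
        have := (hpos ρ hρ).1; positivity
    exact ((Complex.continuous_ofReal.comp_continuousOn d1).mul c1.continuousOn).add
      ((Complex.continuous_ofReal.comp_continuousOn d2).mul (by fun_prop))
  have hbound : ∀ ρ ∈ Set.uIcc κ⁻¹ R, ‖u' ρ‖ ≤ M + 2 * R * M := fun ρ hρ => by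
    obtain ⟨hρ0, hρR⟩ := hpos ρ hρ
    refine (norm_add_le _ _).trans (add_le_add ?_ ?_)
    · rw [norm_mul, Complex.norm_real, Real.norm_of_nonneg (by have := hr ρ; positivity)]
      calc 1 / radius a ρ * ‖g₁ ρ‖ ≤ 1 / radius a ρ * (M * radius a ρ) := by
            gcongr
            · exact one_div_nonneg.2 (hr ρ).le
            · exact (h.norm_first_le hρ0.le).trans
                (mul_le_mul_of_nonneg_left (le_radius_right a ρ) hM)
        _ = M := by have := (hr ρ).ne'; field_simp
    · rw [norm_mul, Complex.norm_real, Real.norm_of_nonneg (by have := hr ρ; positivity)]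
      calc radius a ρ / ρ ^ 2 * ‖(ρ : ℂ) * g₂ ρ - g₁ ρ‖ ≤ (2 * R) / ρ ^ 2 * (M * ρ ^ 2) := by
            gcongr
            · exact hrR ρ hρ0 hρR
            · exact h.norm_second_le hρ0.le
        _ = 2 * R * M := by field_simp
  have hibp := intervalIntegral.integral_mul_deriv_eq_deriv_mul hderiv
    (fun ρ _ => hasDerivAt_osc ha κ ρ) hu'cont.intervalIntegrable
    (ContinuousOn.intervalIntegrable (by
      have d1 : Continuous (fun ρ => ρ / radius a ρ) :=
        Continuous.div (by fun_prop) (by fun_prop) fun ρ => (hr ρ).ne'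
      exact Continuous.continuousOn (by fun_prop)))
  have hκC : (κ : ℂ) ≠ 0 := by exact_mod_cast hκ0.ne'
  have hleft : ∫ ρ in κ⁻¹..R, u ρ * (Complex.I * κ * (osc a κ ρ * ((ρ / radius a ρ : ℝ) : ℂ)))
      = Complex.I * κ * ∫ ρ in κ⁻¹..R, g₁ ρ * osc a κ ρ := by
    rw [← intervalIntegral.integral_const_mul]
    refine intervalIntegral.integral_congr fun ρ hρ => ?_
    have e1 : ((radius a ρ : ℝ) : ℂ) ≠ 0 := by exact_mod_cast (hr ρ).ne'
    have e2 : (ρ : ℂ) ≠ 0 := by exact_mod_cast (hpos ρ hρ).1.ne'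
    simp only [hu]
    push_cast
    field_simp
  rw [hleft] at hibp
  have h3 : ‖∫ ρ in κ⁻¹..R, u' ρ * osc a κ ρ‖ ≤ (M + 2 * R * M) * R := by
    refine (intervalIntegral.norm_integral_le_of_norm_le_const (C := M + 2 * R * M)
      fun ρ hρ => ?_).trans ?_
    · rw [norm_mul, norm_osc, mul_one]
      exact hbound ρ (Set.uIoc_subset_uIcc hρ)
    · rw [abs_of_nonneg (by linarith)]
      have : 0 ≤ M + 2 * R * M := by positivity
      nlinarith
  have h4 : ‖u κ⁻¹‖ ≤ 2 * R * M := by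
    simp only [hu]
    rw [norm_mul, Complex.norm_real, Real.norm_of_nonneg (by have := hr κ⁻¹; positivity)]
    calc radius a κ⁻¹ / κ⁻¹ * ‖g₁ κ⁻¹‖ ≤ (2 * R) / κ⁻¹ * (M * κ⁻¹) := by
          gcongr
          · exact hrR _ hε hεR
          · exact h.norm_first_le hε.le
      _ = 2 * R * M := by field_simp
  have h5 : ‖Complex.I * κ * ∫ ρ in κ⁻¹..R, g₁ ρ * osc a κ ρ‖
      ≤ 2 * R * M + (M + 2 * R * M) * R := by
    rw [hibp]
    refine (norm_sub_le _ _).trans (add_le_add ?_ h3)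
    simp only [hu, h.supp₁, mul_zero, zero_mul, zero_sub, norm_neg]
    rw [norm_mul, norm_osc, mul_one]
    exact h4
  rw [norm_mul, norm_mul, Complex.norm_I, Complex.norm_real, Real.norm_of_nonneg hκ0.le, one_mul,
    ← le_div_iff₀' hκ0] at h5
  refine (norm_add_le _ _).trans ((add_le_add h1 h5).trans_eq ?_)
  rw [div_eq_mul_inv]
  ring

/-- Radial oscillatory integral in dimension three. -/
theorem norm_integral_osc_le (h : EvenSlice M R g₀ g₁ g₂ g₃) {a κ : ℝ} (ha : 0 < a)
    (haR : a ≤ R) (hR : 1 ≤ R) (hκ : 1 ≤ κ) :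
    ‖(∫ ρ in (0 : ℝ)..R, osc a κ ρ * ((ρ / radius a ρ : ℝ) : ℂ) * g₀ ρ) +
      (Complex.I * κ)⁻¹ * g₀ 0‖ ≤ M * (1 + 3 * R + 2 * R ^ 2) * (κ ^ 2)⁻¹ := by
  have hκ0 : 0 < κ := by linarith
  have hκC : (κ : ℂ) ≠ 0 := by exact_mod_cast hκ0.ne'
  have hr : ∀ ρ, 0 < radius a ρ := radius_pos ha
  have d1 : Continuous (fun ρ => ρ / radius a ρ) :=
    Continuous.div (by fun_prop) (by fun_prop) fun ρ => (hr ρ).ne'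
  -- The weight ρ/r is exactly the derivative of the radius, so the integrand is (iκ)⁻¹ g₀ times the
  -- derivative of `osc`. The boundary term at 0 is the main term, and the remaining integral of g₁
  -- `osc` gains a second factor κ⁻¹.
  have hibp := intervalIntegral.integral_mul_deriv_eq_deriv_mul (a := 0) (b := R)
    (fun ρ _ => h.deriv₀ ρ) (fun ρ _ => hasDerivAt_osc ha κ ρ)
    (h.continuous₁.intervalIntegrable _ _)
    (Continuous.intervalIntegrable (by fun_prop) _ _)
  have hleft : ∫ ρ in (0 : ℝ)..R,
      g₀ ρ * (Complex.I * κ * (osc a κ ρ * ((ρ / radius a ρ : ℝ) : ℂ)))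
      = Complex.I * κ * ∫ ρ in (0 : ℝ)..R, osc a κ ρ * ((ρ / radius a ρ : ℝ) : ℂ) * g₀ ρ := by
    rw [← intervalIntegral.integral_const_mul]
    refine intervalIntegral.integral_congr fun ρ hρ => ?_
    ring
  rw [hleft, h.supp₀, osc_zero ha] at hibp
  have hkey : (∫ ρ in (0 : ℝ)..R, osc a κ ρ * ((ρ / radius a ρ : ℝ) : ℂ) * g₀ ρ) +
      (Complex.I * κ)⁻¹ * g₀ 0 = -(Complex.I * κ)⁻¹ * ∫ ρ in (0 : ℝ)..R, g₁ ρ * osc a κ ρ := by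
    have hI : Complex.I * κ ≠ 0 := mul_ne_zero Complex.I_ne_zero hκC
    field_simp
    linear_combination hibp
  rw [hkey, norm_mul, norm_neg, norm_inv, norm_mul, Complex.norm_I, Complex.norm_real,
    Real.norm_of_nonneg hκ0.le, one_mul]
  refine (mul_le_mul_of_nonneg_left (h.norm_integral_osc_deriv_le ha haR hR hκ)
    (inv_nonneg.2 hκ0.le)).trans_eq ?_
  ring

end EvenSlice

/-- The one-dimensional oscillatory integral along the beam: the backward half-line does not
contribute to first order. -/
theorem norm_integral_beam_sub_le {F F' : ℝ → ℂ} {M R κ : ℝ} (hF : ∀ s, HasDerivAt F (F' s) s)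
    (hF' : Continuous F') (hM : ∀ s, ‖F s‖ ≤ M) (hM' : ∀ s, ‖F' s‖ ≤ M) (hR : 0 ≤ R)
    (hsupp : ∀ s, R ≤ |s| → F s = 0) (hκ : 0 < κ) :
    ‖(∫ s : ℝ, Complex.exp (Complex.I * ((κ * (|s| - s) : ℝ) : ℂ)) * F s) -
      ∫ s in Set.Ioi (0 : ℝ), F s‖ ≤ M * (1 + R) * κ⁻¹ := by
  have hFc : Continuous F := continuous_iff_continuousAt.2 fun s => (hF s).continuousAt
  have hM0 : 0 ≤ M := (norm_nonneg _).trans (hM 0)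
  have hFcs : HasCompactSupport F := by
    refine HasCompactSupport.intro (isCompact_Icc (a := -R) (b := R)) fun s hs => hsupp s ?_
    by_contra! hlt
    exact hs ⟨(abs_lt.1 hlt).1.le, (abs_lt.1 hlt).2.le⟩
  set G : ℝ → ℂ := fun s => Complex.exp (Complex.I * ((κ * (|s| - s) : ℝ) : ℂ)) * F s with hG
  have hGi : Integrable G := by
    refine Continuous.integrable_of_hasCompactSupport (by fun_prop) ?_
    exact hFcs.mul_left
  have hsplit : ∫ s, G s = (∫ s in Set.Iic (0 : ℝ), G s) + ∫ s in Set.Ioi (0 : ℝ), G s :=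
    (intervalIntegral.integral_Iic_add_Ioi hGi.integrableOn hGi.integrableOn).symm
  have hpos : ∫ s in Set.Ioi (0 : ℝ), G s = ∫ s in Set.Ioi (0 : ℝ), F s := by
    refine setIntegral_congr_fun measurableSet_Ioi fun s hs => ?_
    have hs : 0 < s := hs
    simp [hG, abs_of_pos hs]
  -- For s ≤ 0 the phase is -2κs, which has no stationary point, so one integration by parts gives
  -- κ⁻¹. The endpoint term at 0 does not vanish and is of the same order.
  have hneg : ∫ s in Set.Iic (0 : ℝ), G s
      = ∫ s in (-R)..0, F s * Complex.exp (Complex.I * ((κ * (-2 * s) : ℝ) : ℂ)) := by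
    rw [intervalIntegral.integral_of_le (by linarith)]
    rw [setIntegral_eq_of_subset_of_forall_sdiff_eq_zero measurableSet_Iic
      (Set.Ioc_subset_Iic_self (a := -R) (b := 0))]
    · refine setIntegral_congr_fun measurableSet_Ioc fun s hs => ?_
      simp only [hG, abs_of_nonpos hs.2]
      rw [mul_comm]
      congr 5
      ring
    · intro s hs
      have hs1 : s ≤ 0 := hs.1
      have hs2 : s ≤ -R := by
        by_contra! hlt
        exact hs.2 ⟨hlt, hs1⟩
      have : F s = 0 := hsupp s (by rw [abs_of_nonpos hs1]; linarith)
      simp [hG, this]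
  have hE : ∀ s : ℝ, HasDerivAt (fun s : ℝ => Complex.exp (Complex.I * ((κ * (-2 * s) : ℝ) : ℂ)))
      (-2 * Complex.I * κ * Complex.exp (Complex.I * ((κ * (-2 * s) : ℝ) : ℂ))) s := fun s => by
    have h1 : HasDerivAt (fun s : ℝ => κ * (-2 * s)) (κ * (-2 * 1)) s :=
      ((hasDerivAt_id s).const_mul (-2)).const_mul κ
    refine (h1.ofReal_comp.const_mul Complex.I).cexp.congr_deriv ?_
    push_cast
    ring
  have hibp := intervalIntegral.integral_mul_deriv_eq_deriv_mul (a := -R) (b := 0)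
    (fun s _ => hF s) (fun s _ => hE s) (hF'.intervalIntegrable _ _)
    (Continuous.intervalIntegrable (by fun_prop) _ _)
  have hleft : ∫ s in (-R)..0,
      F s * (-2 * Complex.I * κ * Complex.exp (Complex.I * ((κ * (-2 * s) : ℝ) : ℂ)))
      = -2 * Complex.I * κ *
        ∫ s in (-R)..0, F s * Complex.exp (Complex.I * ((κ * (-2 * s) : ℝ) : ℂ)) := by
    rw [← intervalIntegral.integral_const_mul]
    refine intervalIntegral.integral_congr fun ρ hρ => ?_
    ring
  rw [hleft] at hibp
  have hb : ‖∫ s in (-R)..0, F' s * Complex.exp (Complex.I * ((κ * (-2 * s) : ℝ) : ℂ))‖ ≤ M * R := by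
    refine (intervalIntegral.norm_integral_le_of_norm_le_const (C := M) fun s _ => ?_).trans_eq ?_
    · rw [norm_mul, norm_exp_I_mul, mul_one]
      exact hM' s
    · rw [sub_neg_eq_add, zero_add, abs_of_nonneg hR]
  have h5 : ‖-2 * Complex.I * κ *
      ∫ s in (-R)..0, F s * Complex.exp (Complex.I * ((κ * (-2 * s) : ℝ) : ℂ))‖ ≤ M + M * R := by
    rw [hibp]
    refine (norm_sub_le _ _).trans (add_le_add ?_ hb)
    rw [hsupp (-R) (by rw [abs_neg]; exact le_abs_self R), zero_mul, sub_zero, norm_mul,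
      norm_exp_I_mul, mul_one]
    exact hM 0
  rw [hsplit, hpos, add_sub_cancel_right, hneg]
  rw [norm_mul, norm_mul, norm_mul, Complex.norm_I, Complex.norm_real, Real.norm_of_nonneg hκ.le,
    norm_neg, Complex.norm_two, mul_one] at h5
  rw [← div_eq_mul_inv, le_div_iff₀ hκ]
  have := norm_nonneg (∫ s in (-R)..0, F s * Complex.exp (Complex.I * ((κ * (-2 * s) : ℝ) : ℂ)))
  nlinarith [mul_nonneg hκ.le this]

/-! ### The radial oscillatory integral in dimension two -/

/-- The variable `√κ ρ / √(r + a)`, whose square is the phase `κ (r - a)`. -/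
def fresnelVar (a κ ρ : ℝ) : ℝ := √κ * (ρ / √(radius a ρ + a))

theorem sq_fresnelVar {a κ : ℝ} (ha : 0 < a) (hκ : 0 ≤ κ) (ρ : ℝ) :
    fresnelVar a κ ρ ^ 2 = κ * (radius a ρ - a) := by
  have hr := radius_pos ha ρ
  rw [fresnelVar, mul_pow, div_pow, Real.sq_sqrt hκ, Real.sq_sqrt (by positivity)]
  have := sq_radius a ρ
  have h0 : radius a ρ + a ≠ 0 := by positivity
  field_simp
  linear_combination (-κ) * this

theorem hasDerivAt_sqrt_radius_add {a : ℝ} (ha : 0 < a) (ρ : ℝ) :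
    HasDerivAt (fun ρ => √(radius a ρ + a))
      (ρ / radius a ρ / (2 * √(radius a ρ + a))) ρ :=
  ((hasDerivAt_radius ha ρ).add_const a).sqrt (by have := radius_pos ha ρ; positivity)

theorem hasDerivAt_fresnelVar {a : ℝ} (ha : 0 < a) (κ ρ : ℝ) :
    HasDerivAt (fresnelVar a κ) (√κ * (√(radius a ρ + a) / (2 * radius a ρ))) ρ := by
  have hr := radius_pos ha ρ
  have hs : 0 < √(radius a ρ + a) := by positivity
  refine (((hasDerivAt_id ρ).div (hasDerivAt_sqrt_radius_add ha ρ) hs.ne').const_mul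
    √κ).congr_deriv ?_
  have h1 := sq_radius a ρ
  have h2 : √(radius a ρ + a) ^ 2 = radius a ρ + a := Real.sq_sqrt (by positivity)
  congr 1
  simp only [id]
  field_simp
  have h3 : √(radius a ρ + a) ^ 4 = (radius a ρ + a) ^ 2 := by
    calc √(radius a ρ + a) ^ 4 = (√(radius a ρ + a) ^ 2) ^ 2 := by ring
      _ = _ := by rw [h2]
  have h4 : ρ ^ 2 = radius a ρ ^ 2 - a ^ 2 := by linarith
  rw [h3, h2, h4]
  ring

/-- The amplitude `2 √r / √(r + a)`. -/
def amplitude (a ρ : ℝ) : ℝ := 2 * (√(radius a ρ) / √(radius a ρ + a))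

theorem hasDerivAt_amplitude {a : ℝ} (ha : 0 < a) (ρ : ℝ) :
    HasDerivAt (amplitude a) (a * ρ / (radius a ρ * √(radius a ρ) *
      ((radius a ρ + a) * √(radius a ρ + a)))) ρ := by
  have hr := radius_pos ha ρ
  have hs : 0 < √(radius a ρ + a) := by positivity
  have hs' : 0 < √(radius a ρ) := by positivity
  refine ((((hasDerivAt_radius ha ρ).sqrt hr.ne').div (hasDerivAt_sqrt_radius_add ha ρ)
    hs.ne').const_mul 2).congr_deriv ?_
  have h2 : √(radius a ρ + a) ^ 2 = radius a ρ + a := Real.sq_sqrt (by positivity)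
  have h3 : √(radius a ρ) ^ 2 = radius a ρ := Real.sq_sqrt hr.le
  field_simp
  rw [h2, h3]
  ring

/-- The power r^{-3/2} is shared equally between a and ρ. Each exponent 3/4 is below 1, so the bound
is integrable in ρ here and later in a = |s| along the beam. -/
theorem rpow_bound {a ρ r : ℝ} (ha : 0 < a) (hρ : 0 < ρ) (har : a ≤ r) (hρr : ρ ≤ r) :
    (r * √r)⁻¹ ≤ a ^ (-(3 / 4) : ℝ) * ρ ^ (-(3 / 4) : ℝ) := by
  have hr : 0 < r := ha.trans_le har
  have h1 : (r * √r)⁻¹ = r ^ (-(3 / 4) : ℝ) * r ^ (-(3 / 4) : ℝ) := by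
    rw [← Real.rpow_add hr, Real.sqrt_eq_rpow, ← Real.rpow_one_add' hr.le (by norm_num),
      ← Real.rpow_neg hr.le]
    norm_num
  rw [h1]
  have h2 := Real.rpow_le_rpow_of_nonpos ha har (z := -(3 / 4)) (by norm_num)
  have h3 := Real.rpow_le_rpow_of_nonpos hρ hρr (z := -(3 / 4)) (by norm_num)
  exact mul_le_mul h2 h3 (by positivity) (by positivity)

/-- The leading constant `√(π/2) e^{iπ/4}`. -/
def fresnelConst : ℂ := rootI * ((√Real.pi / √2 : ℝ) : ℂ)

theorem EvenSlice.norm_integral_osc_sqrt_sub_le {M R : ℝ} {g₀ g₁ g₂ g₃ : ℝ → ℂ}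
    (h : EvenSlice M R g₀ g₁ g₂ g₃) {a κ : ℝ} (ha : 0 < a)
    (haR : a ≤ R) (hR : 1 ≤ R) (hκ : 1 ≤ κ) :
    ‖(∫ ρ in (0 : ℝ)..R, osc a κ ρ * (((√(radius a ρ))⁻¹ : ℝ) : ℂ) * g₀ ρ) -
      fresnelConst * (((√κ)⁻¹ : ℝ) : ℂ) * g₀ 0‖
      ≤ M * (4 * R ^ 2 + 4 * R * a ^ (-(3 / 4) : ℝ)) * κ⁻¹ := by
  have hκ0 : 0 < κ := by linarith
  have hsκ : 0 < √κ := Real.sqrt_pos.2 hκ0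
  have hM := h.nonneg
  have hr : ∀ ρ, 0 < radius a ρ := radius_pos ha
  have hra : ∀ ρ, 0 < radius a ρ + a := fun ρ => add_pos (hr ρ) ha
  have hsr : ∀ ρ, 0 < √(radius a ρ) := fun ρ => Real.sqrt_pos.2 (hr ρ)
  have hsra : ∀ ρ, 0 < √(radius a ρ + a) := fun ρ => Real.sqrt_pos.2 (hra ρ)
  set b' : ℝ → ℝ := fun ρ => a * ρ / (radius a ρ * √(radius a ρ) *
      ((radius a ρ + a) * √(radius a ρ + a))) with hb'
  -- With τ = `fresnelVar a κ ρ` the phase is τ², and `amplitude` is the Jacobian factor chosen so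
  -- that u v' = √κ times the integrand. The endpoint ρ = 0, where `amplitude` is √2 and
  -- `fresnelTail` is -`rootI` √π/2, yields `fresnelConst`.
  set u : ℝ → ℂ := fun ρ => ((amplitude a ρ : ℝ) : ℂ) * g₀ ρ with hu
  set u' : ℝ → ℂ := fun ρ => ((b' ρ : ℝ) : ℂ) * g₀ ρ + ((amplitude a ρ : ℝ) : ℂ) * g₁ ρ with hu'
  set v : ℝ → ℂ := fun ρ => fresnelTail (fresnelVar a κ ρ) with hv
  set v' : ℝ → ℂ := fun ρ =>
    ((√κ * (√(radius a ρ + a) / (2 * radius a ρ)) : ℝ) : ℂ) * osc a κ ρ with hv'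
  have hud : ∀ ρ, HasDerivAt u (u' ρ) ρ := fun ρ =>
    (hasDerivAt_amplitude ha ρ).ofReal_comp.mul (h.deriv₀ ρ)
  have hvd : ∀ ρ, HasDerivAt v (v' ρ) ρ := fun ρ => by
    have := (hasDerivAt_fresnelTail (fresnelVar a κ ρ)).scomp ρ (hasDerivAt_fresnelVar ha κ ρ)
    refine this.congr_deriv ?_
    rw [sq_fresnelVar ha hκ0.le, Complex.real_smul]
    rfl
  have cb' : Continuous b' := Continuous.div (by fun_prop) (by fun_prop) fun ρ => by
    have := hr ρ; have := hra ρ; have := hsr ρ; have := hsra ρ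
    positivity
  have camp : Continuous (amplitude a) := continuous_iff_continuousAt.2 fun ρ =>
    (hasDerivAt_amplitude ha ρ).continuousAt
  have cv : Continuous v := continuous_iff_continuousAt.2 fun ρ => (hvd ρ).continuousAt
  have cg₀ := h.continuous₀
  have cg₁ := h.continuous₁
  have cu' : Continuous u' := by fun_prop
  have cv' : Continuous v' := by
    have : Continuous fun ρ => √(radius a ρ + a) / (2 * radius a ρ) :=
      Continuous.div (by fun_prop) (by fun_prop) fun ρ => by have := hr ρ; positivity
    fun_prop
  have hibp := intervalIntegral.integral_mul_deriv_eq_deriv_mul (a := 0) (b := R)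
    (fun ρ _ => hud ρ) (fun ρ _ => hvd ρ)
    (cu'.intervalIntegrable _ _) (cv'.intervalIntegrable _ _)
  have hleft : ∫ ρ in (0 : ℝ)..R, u ρ * v' ρ
      = ((√κ : ℝ) : ℂ) * ∫ ρ in (0 : ℝ)..R, osc a κ ρ * (((√(radius a ρ))⁻¹ : ℝ) : ℂ) * g₀ ρ := by
    rw [← intervalIntegral.integral_const_mul]
    refine intervalIntegral.integral_congr fun ρ _ => ?_
    have hamp : amplitude a ρ * (√(radius a ρ + a) / (2 * radius a ρ)) = (√(radius a ρ))⁻¹ := by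
      have h1 := (hr ρ).ne'
      have h2 := (hsr ρ).ne'
      have h3 := (hsra ρ).ne'
      have h4 : √(radius a ρ) ^ 2 = radius a ρ := Real.sq_sqrt (hr ρ).le
      rw [amplitude]
      field_simp
      linarith
    simp only [hu, hv', ← hamp]
    push_cast
    ring
  have hu0 : u 0 * v 0 = -(fresnelConst * g₀ 0) := by
    have h1 : amplitude a 0 = √2 := by
      rw [amplitude, radius_zero ha, ← two_mul, Real.sqrt_mul (by norm_num)]
      have : √a ≠ 0 := (Real.sqrt_pos.2 ha).ne'
      have h2 : √2 * √2 = 2 := Real.mul_self_sqrt (by norm_num)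
      field_simp
      linarith
    have h2 : √2 * (√Real.pi / 2) = √Real.pi / √2 := by
      have h2 : √2 * √2 = 2 := Real.mul_self_sqrt (by norm_num)
      field_simp
      nlinarith
    have h3 : fresnelVar a κ 0 = 0 := by simp [fresnelVar]
    simp only [hu, hv, h1, h3, fresnelTail_zero, fresnelConst, ← h2]
    push_cast
    ring
  have huR : u R = 0 := by simp only [hu, h.supp₀, mul_zero]
  rw [hleft, huR, hu0, zero_mul, zero_sub, neg_neg] at hibp
  have hbound : ‖∫ ρ in (0 : ℝ)..R, u' ρ * v ρ‖
      ≤ (√κ)⁻¹ * (M * (4 * R ^ 2 + 4 * R * a ^ (-(3 / 4) : ℝ))) := by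
    -- The bound 1/τ on the Fresnel tail costs a factor 1/ρ. Both terms of u' pay for it: the
    -- derivative of `amplitude` contains a factor ρ, and |g₁| ≤ Mρ.
    have hpt : ∀ ρ ∈ Set.Ioc 0 R, ‖u' ρ * v ρ‖
        ≤ (√κ)⁻¹ * (M * (4 * R + a ^ (-(3 / 4) : ℝ) * ρ ^ (-(3 / 4) : ℝ))) := fun ρ hρ => by
      have hρ0 : 0 < ρ := hρ.1
      have h1 := hr ρ
      have h2 := hsr ρ
      have h3 := hsra ρ
      have h4 := hra ρ
      have hτ : 0 < fresnelVar a κ ρ := by unfold fresnelVar; positivity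
      have hv1 : ‖v ρ‖ ≤ (√κ)⁻¹ * (√(radius a ρ + a) / ρ) := by
        refine (norm_fresnelTail_le hτ).trans_eq ?_
        rw [fresnelVar]
        field_simp
      have hb0 : 0 ≤ b' ρ := by simp only [hb']; positivity
      have ha0 : 0 ≤ amplitude a ρ := by unfold amplitude; positivity
      have hu1 : ‖u' ρ‖ ≤ b' ρ * M + amplitude a ρ * (M * ρ) := by
        refine (norm_add_le _ _).trans (add_le_add ?_ ?_)
        · rw [norm_mul, Complex.norm_real, Real.norm_of_nonneg hb0]
          exact mul_le_mul_of_nonneg_left (h.bound₀ ρ) hb0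
        · rw [norm_mul, Complex.norm_real, Real.norm_of_nonneg ha0]
          exact mul_le_mul_of_nonneg_left (h.norm_first_le hρ0.le) ha0
      have e1 : b' ρ * (√(radius a ρ + a) / ρ) ≤ a ^ (-(3 / 4) : ℝ) * ρ ^ (-(3 / 4) : ℝ) := by
        refine le_trans ?_ (rpow_bound ha hρ0 (le_radius a ρ) (le_radius_right a ρ))
        have : b' ρ * (√(radius a ρ + a) / ρ)
            = (radius a ρ * √(radius a ρ))⁻¹ * (a / (radius a ρ + a)) := by
          simp only [hb']
          field_simp
        rw [this]
        refine mul_le_of_le_one_right (by positivity) ?_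
        rw [div_le_one h4]
        linarith
      have e2 : amplitude a ρ * ρ * (√(radius a ρ + a) / ρ) ≤ 4 * R := by
        have : amplitude a ρ * ρ * (√(radius a ρ + a) / ρ) = 2 * √(radius a ρ) := by
          rw [amplitude]
          field_simp
        rw [this]
        have : √(radius a ρ) ≤ 2 * R := by
          refine Real.sqrt_le_iff.2 ⟨by linarith, ?_⟩
          have := radius_le_add ha.le hρ0.le
          nlinarith [hρ.2]
        linarith
      rw [norm_mul]
      calc ‖u' ρ‖ * ‖v ρ‖ ≤ (b' ρ * M + amplitude a ρ * (M * ρ)) *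
            ((√κ)⁻¹ * (√(radius a ρ + a) / ρ)) := by gcongr
        _ = (√κ)⁻¹ * (M * (amplitude a ρ * ρ * (√(radius a ρ + a) / ρ) +
            b' ρ * (√(radius a ρ + a) / ρ))) := by ring
        _ ≤ _ := by gcongr
    have hR0 : 0 ≤ R := by linarith
    have hi0 : IntervalIntegrable (fun ρ : ℝ => ρ ^ (-(3 / 4) : ℝ)) volume 0 R :=
      intervalIntegral.intervalIntegrable_rpow' (by norm_num)
    have hi1 : IntervalIntegrable (fun ρ : ℝ => M * (4 * R +
        a ^ (-(3 / 4) : ℝ) * ρ ^ (-(3 / 4) : ℝ))) volume 0 R :=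
      ((intervalIntegrable_const).add (hi0.const_mul _)).const_mul _
    refine (intervalIntegral.norm_integral_le_of_norm_le hR0
      (ae_of_all _ hpt) (hi1.const_mul _)).trans ?_
    rw [intervalIntegral.integral_const_mul, intervalIntegral.integral_const_mul,
      intervalIntegral.integral_add intervalIntegrable_const (hi0.const_mul _),
      intervalIntegral.integral_const, intervalIntegral.integral_const_mul,
      integral_rpow (Or.inl (by norm_num)), Real.zero_rpow (by norm_num)]
    have hR4 : R ^ (-(3 / 4) + 1 : ℝ) ≤ R := by
      calc R ^ (-(3 / 4) + 1 : ℝ) ≤ R ^ (1 : ℝ) :=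
            Real.rpow_le_rpow_of_exponent_le hR (by norm_num)
        _ = R := Real.rpow_one R
    have ha4 : 0 ≤ a ^ (-(3 / 4) : ℝ) := by positivity
    gcongr ?_ * (M * ?_)
    have h9 := mul_le_mul_of_nonneg_left hR4 ha4
    have e : a ^ (-(3 / 4) : ℝ) * ((R ^ (-(3 / 4) + 1 : ℝ) - 0) / (-(3 / 4) + 1))
        = 4 * (a ^ (-(3 / 4) : ℝ) * R ^ (-(3 / 4) + 1 : ℝ)) := by
      rw [sub_zero]
      norm_num
      ring
    rw [e, smul_eq_mul]
    nlinarith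
  have hsκC : ((√κ : ℝ) : ℂ) ≠ 0 := by exact_mod_cast hsκ.ne'
  have hkey : (∫ ρ in (0 : ℝ)..R, osc a κ ρ * (((√(radius a ρ))⁻¹ : ℝ) : ℂ) * g₀ ρ) -
      fresnelConst * (((√κ)⁻¹ : ℝ) : ℂ) * g₀ 0
      = -(((√κ)⁻¹ : ℝ) : ℂ) * ∫ ρ in (0 : ℝ)..R, u' ρ * v ρ := by
    rw [Complex.ofReal_inv]
    generalize (∫ ρ in (0 : ℝ)..R, osc a κ ρ * (((√(radius a ρ))⁻¹ : ℝ) : ℂ) * g₀ ρ) = J at *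
    field_simp
    linear_combination hibp
  rw [hkey, norm_mul, norm_neg, Complex.norm_real, Real.norm_of_nonneg (inv_nonneg.2 hsκ.le)]
  refine (mul_le_mul_of_nonneg_left hbound (inv_nonneg.2 hsκ.le)).trans_eq ?_
  have : κ⁻¹ = (√κ)⁻¹ * (√κ)⁻¹ := by rw [← mul_inv, Real.mul_self_sqrt hκ0.le]
  rw [this]
  ring

/-! ### The Hankel function for large arguments -/

theorem one_le_norm_one_add (s : ℝ) : 1 ≤ ‖1 + Complex.I * (s : ℂ) / 2‖ := by
  have := Complex.abs_re_le_norm (1 + Complex.I * (s : ℂ) / 2)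
  simpa using this

/-- The base has modulus at least 1, so the derivative in s has norm at most 1/2 · 1/2, and the mean
value inequality applies. -/
theorem norm_cpow_sub_one_le {s : ℝ} (hs : 0 ≤ s) :
    ‖(1 + Complex.I * (s : ℂ) / 2) ^ (-(1 / 2) : ℂ) - 1‖ ≤ s / 4 := by
  have hslit : ∀ t : ℝ, 1 + Complex.I * (t : ℂ) / 2 ∈ Complex.slitPlane := fun t => by
    left; simp
  have hd : ∀ t : ℝ, HasDerivAt (fun t : ℝ => (1 + Complex.I * (t : ℂ) / 2) ^ (-(1 / 2) : ℂ))
      (-(1 / 2) * (1 + Complex.I * (t : ℂ) / 2) ^ (-(1 / 2) - 1 : ℂ) * (Complex.I / 2)) t :=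
      fun t => by
    have h1 : HasDerivAt (fun z : ℂ => 1 + Complex.I * z / 2) (Complex.I / 2) (t : ℂ) := by
      simpa using (((hasDerivAt_id (t : ℂ)).const_mul Complex.I).div_const 2).const_add 1
    exact (h1.cpow_const (hslit t)).comp_ofReal
  have := norm_image_sub_le_of_norm_deriv_le_segment' (a := 0) (b := s) (C := 1 / 4)
    (fun t _ => (hd t).hasDerivWithinAt) (fun t _ => by
      have h1 : (-(1 / 2) - 1 : ℂ) = ((-(1 / 2) - 1 : ℝ) : ℂ) := by push_cast; ring
      have h2 : ‖1 + Complex.I * (t : ℂ) / 2‖ ^ (-(1 / 2) - 1 : ℝ) ≤ 1 :=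
        Real.rpow_le_one_of_one_le_of_nonpos (one_le_norm_one_add t) (by norm_num)
      rw [norm_mul, norm_mul, h1, Complex.norm_cpow_real]
      have h3 : ‖(-(1 / 2) : ℂ)‖ = 1 / 2 := by simp
      have h4 : ‖Complex.I / 2‖ = 1 / 2 := by simp
      rw [h3, h4]
      linarith) s ⟨hs, le_rfl⟩
  simp only [Complex.ofReal_zero, mul_zero, zero_div, add_zero, Complex.one_cpow, sub_zero] at this
  linarith

theorem integral_exp_div_sqrt {r : ℝ} (hr : 0 < r) :
    ∫ s in Set.Ioi (0 : ℝ), Real.exp (-(r * s)) / √s = √Real.pi / √r := by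
  have h := Real.integral_rpow_mul_exp_neg_mul_Ioi (a := 1 / 2) (r := r) (by norm_num) hr
  rw [Real.Gamma_one_half_eq, ← Real.sqrt_eq_rpow, one_div r, Real.sqrt_inv] at h
  rw [div_eq_inv_mul, ← h]
  refine setIntegral_congr_fun measurableSet_Ioi fun s hs => ?_
  have hs : 0 < s := hs
  rw [show (1 / 2 - 1 : ℝ) = -(1 / 2) by norm_num, Real.rpow_neg hs.le, ← Real.sqrt_eq_rpow]
  ring

theorem integral_exp_mul_sqrt {r : ℝ} (hr : 0 < r) :
    ∫ s in Set.Ioi (0 : ℝ), √s * Real.exp (-(r * s)) = (r * √r)⁻¹ * (√Real.pi / 2) := by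
  have h := Real.integral_rpow_mul_exp_neg_mul_Ioi (a := 1 / 2 + 1) (r := r) (by norm_num) hr
  rw [Real.Gamma_add_one (by norm_num), Real.Gamma_one_half_eq, one_div r,
    Real.rpow_add (inv_pos.2 hr), Real.rpow_one] at h
  have e : r⁻¹ ^ (1 / 2 : ℝ) = (√r)⁻¹ := by rw [← Real.sqrt_eq_rpow, Real.sqrt_inv]
  rw [e] at h
  calc _ = _ := by
        refine setIntegral_congr_fun measurableSet_Ioi fun s hs => ?_
        simp only [Real.sqrt_eq_rpow]
        rw [show (1 / 2 + 1 - 1 : ℝ) = 1 / 2 by norm_num]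
    _ = _ := h
    _ = _ := by rw [mul_inv]; ring

/-- A non-integrable function has integral 0 by convention, whereas the value computed from the
Gamma function is positive. -/
theorem integrableOn_exp_div_sqrt {r : ℝ} (hr : 0 < r) :
    IntegrableOn (fun s : ℝ => Real.exp (-(r * s)) / √s) (Set.Ioi 0) := by
  by_contra h
  have h1 := integral_exp_div_sqrt hr
  rw [integral_undef h] at h1
  have : 0 < √Real.pi / √r := by have := Real.pi_pos; positivity
  linarith

theorem integrableOn_exp_mul_sqrt {r : ℝ} (hr : 0 < r) :
    IntegrableOn (fun s : ℝ => √s * Real.exp (-(r * s))) (Set.Ioi 0) := by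
  by_contra h
  have h1 := integral_exp_mul_sqrt hr
  rw [integral_undef h] at h1
  have : 0 < (r * √r)⁻¹ * (√Real.pi / 2) := by have := Real.pi_pos; positivity
  linarith

/-- The leading term of `H₀⁽¹⁾(r)` for large `r`. -/
def hankelLead (r : ℝ) : ℂ :=
  ((√2 / √Real.pi : ℝ) : ℂ) * Complex.exp (Complex.I * ((r - Real.pi / 4 : ℝ) : ℂ)) *
    (((√r)⁻¹ : ℝ) : ℂ)

theorem sqrt_two_div_pi_le_one : √2 / Real.pi ≤ 1 := by
  rw [div_le_one Real.pi_pos]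
  have : √2 ≤ 2 := Real.sqrt_le_iff.2 ⟨by norm_num, by norm_num⟩
  linarith [Real.pi_gt_three]

/-- Replacing (1 + is/2)^{-1/2} by 1 in Hankel's integral leaves Γ(1/2), with an error governed by
Γ(3/2). The bound holds for all r > 0, and its singularity r^{-3/2} at the origin is integrable in
the plane, so no separate treatment of small arguments is needed. -/
theorem norm_hankelH10_sub_lead_le {r : ℝ} (hr : 0 < r) :
    ‖hankelH10 r - hankelLead r‖ ≤ (r * √r)⁻¹ := by
  set K : ℝ → ℂ := fun s => ((Real.exp (-(r * s)) / √s : ℝ) : ℂ) *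
        (1 + Complex.I * (s : ℂ) / 2) ^ (-(1 / 2) : ℂ) with hK
  set K₀ : ℝ → ℂ := fun s => ((Real.exp (-(r * s)) / √s : ℝ) : ℂ) with hK₀
  have hpi : √Real.pi ≤ 2 := Real.sqrt_le_iff.2 ⟨by norm_num, by linarith [Real.pi_lt_four]⟩
  have hi₀ : IntegrableOn K₀ (Set.Ioi 0) := (integrableOn_exp_div_sqrt hr).ofReal
  have hpt : ∀ s ∈ Set.Ioi (0 : ℝ), ‖K s - K₀ s‖ ≤ √s * Real.exp (-(r * s)) / 4 := fun s hs => by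
    have hs : 0 < s := hs
    have : K s - K₀ s = K₀ s * ((1 + Complex.I * (s : ℂ) / 2) ^ (-(1 / 2) : ℂ) - 1) := by
      simp only [hK, hK₀]; ring
    rw [this, norm_mul, hK₀, Complex.norm_real, Real.norm_of_nonneg (by positivity)]
    refine (mul_le_mul_of_nonneg_left (norm_cpow_sub_one_le hs.le) (by positivity)).trans_eq ?_
    have h1 : √s * √s = s := Real.mul_self_sqrt hs.le
    have h2 : √s ≠ 0 := (Real.sqrt_pos.2 hs).ne'
    field_simp
    nlinarith
  have hd : IntegrableOn (fun s => K s - K₀ s) (Set.Ioi 0) := by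
    refine Integrable.mono' ((integrableOn_exp_mul_sqrt hr).div_const 4) ?_
      ((ae_restrict_iff' measurableSet_Ioi).2 (ae_of_all _ hpt))
    refine Measurable.aestronglyMeasurable ?_
    simp only [hK, hK₀]
    fun_prop
  have hi : IntegrableOn K (Set.Ioi 0) := by
    refine (hd.add hi₀).congr (ae_of_all _ fun s => ?_)
    simp
  have hdiff : ‖(∫ s in Set.Ioi (0 : ℝ), K s) - ((√Real.pi / √r : ℝ) : ℂ)‖ ≤ (r * √r)⁻¹ := by
    rw [← integral_exp_div_sqrt hr, ← integral_complex_ofReal, ← integral_sub hi hi₀]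
    refine (norm_integral_le_of_norm_le ((integrableOn_exp_mul_sqrt hr).div_const 4)
      ((ae_restrict_iff' measurableSet_Ioi).2 (ae_of_all _ hpt))).trans ?_
    rw [integral_div, integral_exp_mul_sqrt hr]
    have : 0 < (r * √r)⁻¹ := by positivity
    nlinarith
  have hlead : hankelLead r = ((√2 / Real.pi : ℝ) : ℂ) *
      Complex.exp (Complex.I * ((r - Real.pi / 4 : ℝ) : ℂ)) * ((√Real.pi / √r : ℝ) : ℂ) := by
    have h1 : √2 / √Real.pi * (√r)⁻¹ = √2 / Real.pi * (√Real.pi / √r) := by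
      have h2 : √Real.pi * √Real.pi = Real.pi := Real.mul_self_sqrt Real.pi_pos.le
      have h3 : √Real.pi ≠ 0 := (Real.sqrt_pos.2 Real.pi_pos).ne'
      have h4 : Real.pi ≠ 0 := Real.pi_ne_zero
      field_simp
      nlinarith
    have h5 : ((√2 / √Real.pi : ℝ) : ℂ) * (((√r)⁻¹ : ℝ) : ℂ)
        = ((√2 / Real.pi : ℝ) : ℂ) * ((√Real.pi / √r : ℝ) : ℂ) := by exact_mod_cast h1
    rw [hankelLead]
    linear_combination Complex.exp (Complex.I * ((r - Real.pi / 4 : ℝ) : ℂ)) * h5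
  rw [hlead, hankelH10, ← mul_sub, norm_mul, norm_mul, norm_exp_I_mul, mul_one, Complex.norm_real,
    Real.norm_of_nonneg (by have := Real.pi_pos; positivity)]
  exact (mul_le_mul sqrt_two_div_pi_le_one hdiff (norm_nonneg _) zero_le_one).trans_eq (one_mul _)

theorem norm_hankelLead_le {r : ℝ} : ‖hankelLead r‖ ≤ (√r)⁻¹ := by
  rw [hankelLead, norm_mul, norm_mul, norm_exp_I_mul, mul_one, Complex.norm_real,
    Complex.norm_real, Real.norm_of_nonneg (by positivity), Real.norm_of_nonneg (by positivity)]
  refine mul_le_of_le_one_left (by positivity) ?_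
  rw [div_le_one (Real.sqrt_pos.2 Real.pi_pos)]
  exact Real.sqrt_le_sqrt (by linarith [Real.pi_gt_three])

theorem measurable_hankelH10 : Measurable hankelH10 := by
  unfold hankelH10
  refine Measurable.mul (by fun_prop) ?_
  refine StronglyMeasurable.measurable ?_
  refine StronglyMeasurable.integral_prod_right (f := fun r s : ℝ =>
    ((Real.exp (-(r * s)) / √s : ℝ) : ℂ) * (1 + Complex.I * (s : ℂ) / 2) ^ (-(1 / 2) : ℂ)) ?_
  refine Measurable.stronglyMeasurable ?_
  unfold Function.uncurry
  fun_prop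

/-! ### Slices of smooth compactly supported functions -/

section Slices

variable {E V : Type*} [NormedAddCommGroup E] [InnerProductSpace ℝ E]
  [NormedAddCommGroup V] [NormedSpace ℝ V]

theorem exists_bound_fderiv {f : E → V} (hs : ContDiff ℝ ∞ f) (hc : HasCompactSupport f) :
    (ContDiff ℝ ∞ (fderiv ℝ f) ∧ HasCompactSupport (fderiv ℝ f)) ∧ ∃ C, ∀ x, ‖f x‖ ≤ C :=
  ⟨⟨hs.fderiv_right (by simp), hc.fderiv ℝ⟩, hs.continuous.bounded_above_of_compact_support hc⟩

theorem hasDerivAt_comp_line {f : E → V} (hs : ContDiff ℝ ∞ f) (p e : E) (ρ : ℝ) :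
    HasDerivAt (fun ρ : ℝ => f (p + ρ • e)) (fderiv ℝ f (p + ρ • e) e) ρ := by
  have h1 : HasDerivAt (fun ρ : ℝ => p + ρ • e) e ρ := by
    simpa using ((hasDerivAt_id ρ).smul_const e).const_add p
  exact ((hs.differentiable (by simp)).differentiableAt.hasFDerivAt).comp_hasDerivAt ρ h1

theorem hasDerivAt_comp_neg {g : ℝ → V} {g' : V} {ρ : ℝ} (h : HasDerivAt g g' (-ρ)) :
    HasDerivAt (fun ρ => g (-ρ)) (-g') ρ := by
  exact (h.scomp ρ (hasDerivAt_neg ρ)).congr_deriv (by simp)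

theorem norm_apply_le {D : E →L[ℝ] V} {e : E} {C : ℝ} (he : ‖e‖ = 1) (hD : ‖D‖ ≤ C) :
    ‖D e‖ ≤ C := by
  have := D.le_opNorm e
  rw [he, mul_one] at this
  exact this.trans hD

/-- Bounds for a smooth compactly supported function which are uniform over all its slices. -/
structure SliceControl (M R : ℝ) (f : E → ℂ) : Prop where
  one_le : 1 ≤ R
  smooth : ContDiff ℝ ∞ f
  bound : ∀ x, ‖f x‖ ≤ M
  bound' : ∀ x, ‖fderiv ℝ f x‖ ≤ M
  supp : ∀ x, R ≤ ‖x‖ → f x = 0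
  slice : ∀ p e : E, ‖e‖ = 1 → inner ℝ p e = 0 → ∃ g₁ g₂ g₃,
    EvenSlice M R (fun ρ => f (p + ρ • e) + f (p - ρ • e)) g₁ g₂ g₃

/-- By Pythagoras the transversal coordinate is bounded by the norm, so a slice leaves the support
by |t| = R whatever its base point p. -/
theorem le_norm_add_smul {p e : E} (he : ‖e‖ = 1) (hpe : inner ℝ p e = 0) (t : ℝ) :
    |t| ≤ ‖p + t • e‖ := by
  have h := norm_add_sq_real p (t • e)
  rw [inner_smul_right, hpe, norm_smul, he, Real.norm_eq_abs] at h
  exact abs_le_of_sq_le_sq (by nlinarith [sq_nonneg ‖p‖, sq_abs t]) (norm_nonneg _)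

/-- The first three derivatives of f are bounded on the whole space, and this bounds every slice
along a unit vector. Symmetrising in ρ makes the first derivative odd, which is the condition
`zero₁`, and costs the factor 2 in M. -/
theorem exists_sliceControl {f : E → ℂ} (hs : ContDiff ℝ ∞ f) (hc : HasCompactSupport f) :
    ∃ M R, SliceControl M R f := by
  obtain ⟨⟨hs1, hc1⟩, C0, h0⟩ := exists_bound_fderiv hs hc
  obtain ⟨⟨hs2, hc2⟩, C1, h1⟩ := exists_bound_fderiv hs1 hc1
  obtain ⟨⟨hs3, hc3⟩, C2, h2⟩ := exists_bound_fderiv hs2 hc2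
  obtain ⟨-, C3, h3⟩ := exists_bound_fderiv hs3 hc3
  obtain ⟨r, hr⟩ := hc.isCompact.isBounded.subset_closedBall (0 : E)
  have hC0 : 0 ≤ C0 := (norm_nonneg _).trans (h0 0)
  have hC1 : 0 ≤ C1 := (norm_nonneg _).trans (h1 0)
  have hC2 : 0 ≤ C2 := (norm_nonneg _).trans (h2 0)
  have hC3 : 0 ≤ C3 := (norm_nonneg _).trans (h3 0)
  -- The margin r + 1 puts even the sphere of radius R off the closed support, so the derivative
  -- vanishes there as well.
  have hsupp : ∀ x, max 1 (r + 1) ≤ ‖x‖ → x ∉ tsupport f := fun x hx hmem => by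
    have := hr hmem
    rw [Metric.mem_closedBall, dist_zero_right] at this
    have := (le_max_right 1 (r + 1)).trans hx
    linarith
  have hsupp0 : ∀ x, max 1 (r + 1) ≤ ‖x‖ → f x = 0 := fun x hx =>
    image_eq_zero_of_notMem_tsupport (hsupp x hx)
  have hsupp1 : ∀ x, max 1 (r + 1) ≤ ‖x‖ → fderiv ℝ f x = 0 := fun x hx =>
    image_eq_zero_of_notMem_tsupport fun h => hsupp x hx (tsupport_fderiv_subset ℝ h)
  refine ⟨2 * (C0 + C1 + C2 + C3), max 1 (r + 1), le_max_left _ _, hs,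
    fun x => (h0 x).trans (by linarith), fun x => (h1 x).trans (by linarith), hsupp0,
    fun p e he hpe => ?_⟩
  set u₀ : ℝ → ℂ := fun ρ => f (p + ρ • e) with hu₀
  set u₁ : ℝ → ℂ := fun ρ => fderiv ℝ f (p + ρ • e) e with hu₁
  set u₂ : ℝ → ℂ := fun ρ => fderiv ℝ (fderiv ℝ f) (p + ρ • e) e e with hu₂
  set u₃ : ℝ → ℂ := fun ρ => fderiv ℝ (fderiv ℝ (fderiv ℝ f)) (p + ρ • e) e e e with hu₃
  have d0 : ∀ ρ, HasDerivAt u₀ (u₁ ρ) ρ := hasDerivAt_comp_line hs p e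
  have d1 : ∀ ρ, HasDerivAt u₁ (u₂ ρ) ρ := fun ρ => by
    have := (hasDerivAt_comp_line hs1 p e ρ).clm_apply (hasDerivAt_const ρ e)
    simpa using this
  have d2 : ∀ ρ, HasDerivAt u₂ (u₃ ρ) ρ := fun ρ => by
    have := ((hasDerivAt_comp_line hs2 p e ρ).clm_apply (hasDerivAt_const ρ e)).clm_apply
      (hasDerivAt_const ρ e)
    simpa using this
  have b1 : ∀ ρ, ‖u₁ ρ‖ ≤ C1 := fun ρ =>
    norm_apply_le he (h1 _)
  have b2 : ∀ ρ, ‖u₂ ρ‖ ≤ C2 := fun ρ =>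
    norm_apply_le he (norm_apply_le he (h2 _))
  have b3 : ∀ ρ, ‖u₃ ρ‖ ≤ C3 := fun ρ =>
    norm_apply_le he (norm_apply_le he (norm_apply_le he (h3 _)))
  have hsym : (fun ρ : ℝ => f (p + ρ • e) + f (p - ρ • e)) = fun ρ => u₀ ρ + u₀ (-ρ) := by
    funext ρ
    simp only [hu₀, neg_smul, sub_eq_add_neg]
  rw [hsym]
  have hR1 : 0 ≤ max 1 (r + 1) := zero_le_one.trans (le_max_left _ _)
  have n1 := le_norm_add_smul he hpe (max 1 (r + 1))
  have n2 := le_norm_add_smul he hpe (-max 1 (r + 1))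
  rw [abs_of_nonneg hR1] at n1
  rw [abs_neg, abs_of_nonneg hR1] at n2
  refine ⟨fun ρ => u₁ ρ - u₁ (-ρ), fun ρ => u₂ ρ + u₂ (-ρ), fun ρ => u₃ ρ - u₃ (-ρ), ?_⟩
  constructor
  · intro ρ
    rw [sub_eq_add_neg]
    exact (d0 ρ).add (hasDerivAt_comp_neg (d0 (-ρ)))
  · intro ρ
    rw [← sub_neg_eq_add]
    exact (d1 ρ).sub (hasDerivAt_comp_neg (d1 (-ρ)))
  · intro ρ
    rw [sub_eq_add_neg]
    exact (d2 ρ).add (hasDerivAt_comp_neg (d2 (-ρ)))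
  · intro ρ
    exact (norm_add_le _ _).trans (by linarith [h0 (p + ρ • e), h0 (p + (-ρ) • e)])
  · intro ρ
    exact (norm_sub_le _ _).trans (by linarith [b1 ρ, b1 (-ρ)])
  · intro ρ
    exact (norm_add_le _ _).trans (by linarith [b2 ρ, b2 (-ρ)])
  · intro ρ
    exact (norm_sub_le _ _).trans (by linarith [b3 ρ, b3 (-ρ)])
  · simp
  · simp only [hu₀, hsupp0 _ n1, hsupp0 _ n2, add_zero]
  · simp only [hu₁, hsupp1 _ n1, hsupp1 _ n2, _root_.zero_apply, sub_zero]

theorem SliceControl.nonneg {M R : ℝ} {f : E → ℂ} (h : SliceControl M R f) : 0 ≤ M :=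
  (norm_nonneg _).trans (h.bound 0)

theorem SliceControl.norm_beam_sub_le {M R : ℝ} {f : E → ℂ} (h : SliceControl M R f) {θ : E}
    (hθ : ‖θ‖ = 1) {κ : ℝ} (hκ : 0 < κ) :
    ‖(∫ s : ℝ, Complex.exp (Complex.I * ((κ * (|s| - s) : ℝ) : ℂ)) * f (s • θ)) -
      ∫ s in Set.Ioi (0 : ℝ), f (s • θ)‖ ≤ M * (1 + R) * κ⁻¹ := by
  refine norm_integral_beam_sub_le (F' := fun s => fderiv ℝ f (s • θ) θ) (fun s => ?_) ?_
    (fun s => h.bound _) (fun s => ?_) (zero_le_one.trans h.one_le) (fun s hs => h.supp _ ?_) hκ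
  · simpa using hasDerivAt_comp_line h.smooth 0 θ s
  · have : Continuous (fderiv ℝ f) := (h.smooth.fderiv_right (m := ∞) (by simp)).continuous
    fun_prop
  · exact norm_apply_le hθ (h.bound' _)
  · rwa [norm_smul, hθ, mul_one]

theorem SliceControl.integrable_beam {M R : ℝ} {f : E → ℂ} (h : SliceControl M R f) {θ : E}
    (hθ : ‖θ‖ = 1) : Integrable fun s : ℝ => f (s • θ) := by
  have := h.smooth.continuous
  refine Continuous.integrable_of_hasCompactSupport (by fun_prop) ?_
  refine HasCompactSupport.intro (isCompact_Icc (a := -R) (b := R)) fun s hs => h.supp _ ?_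
  rw [norm_smul, hθ, mul_one, Real.norm_eq_abs]
  by_contra! hlt
  exact hs ⟨(abs_lt.1 hlt).1.le, (abs_lt.1 hlt).2.le⟩

theorem SliceControl.norm_integral_beam_le {M R : ℝ} {f : E → ℂ} (h : SliceControl M R f) {θ : E}
    (hθ : ‖θ‖ = 1) : ‖∫ s in Set.Ioi (0 : ℝ), f (s • θ)‖ ≤ M * R := by
  have hR : 0 ≤ R := zero_le_one.trans h.one_le
  have : ∫ s in Set.Ioi (0 : ℝ), f (s • θ) = ∫ s in (0 : ℝ)..R, f (s • θ) := by
    rw [intervalIntegral.integral_of_le hR]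
    refine setIntegral_eq_of_subset_of_forall_sdiff_eq_zero measurableSet_Ioi
      Set.Ioc_subset_Ioi_self fun s hs => h.supp _ ?_
    have hs0 : 0 < s := hs.1
    rw [norm_smul, hθ, mul_one, Real.norm_of_nonneg hs0.le]
    by_contra! hlt
    exact hs.2 ⟨hs0, hlt.le⟩
  rw [this]
  refine (intervalIntegral.norm_integral_le_of_norm_le_const fun s _ => h.bound _).trans_eq ?_
  rw [sub_zero, abs_of_nonneg hR]

end Slices

/-! ### Integrals in adapted coordinates -/

/-- In polar coordinates the radial weight is y^{n-1-a} with n the dimension, integrable at 0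
exactly because a < n. -/
theorem integrable_indicator_rpow_norm {E : Type*} [NormedAddCommGroup E] [NormedSpace ℝ E]
    [MeasurableSpace E] [Nontrivial E] [FiniteDimensional ℝ E] [BorelSpace E] (μ : Measure E)
    [μ.IsAddHaarMeasure] (R : ℝ) {a : ℝ} (ha : a < Module.finrank ℝ E) :
    Integrable (fun x : E => (Set.Ioo 0 R).indicator (fun y : ℝ => y ^ (-a)) ‖x‖) μ := by
  rw [integrable_fun_norm_addHaar]
  have h1 : IntervalIntegrable (fun y : ℝ => y ^ ((Module.finrank ℝ E : ℝ) - 1 - a)) volume 0 R :=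
    intervalIntegral.intervalIntegrable_rpow' (by linarith)
  have h2 : IntegrableOn (fun y : ℝ => y ^ ((Module.finrank ℝ E : ℝ) - 1 - a)) (Set.Ioo 0 R) :=
    h1.1.mono_set Set.Ioo_subset_Ioc_self
  have h3 := (integrable_indicator_iff measurableSet_Ioo).2 h2
  refine h3.integrableOn.congr_fun (fun y hy => ?_) measurableSet_Ioi
  have hy : 0 < y := hy
  by_cases hyR : y < R
  · have hmem : y ∈ Set.Ioo 0 R := ⟨hy, hyR⟩
    have hn : 1 ≤ Module.finrank ℝ E := Module.finrank_pos
    rw [Set.indicator_of_mem hmem, Set.indicator_of_mem hmem, smul_eq_mul,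
      ← Real.rpow_natCast, ← Real.rpow_add hy, Nat.cast_sub hn]
    congr 1
    push_cast
    ring
  · rw [Set.indicator_of_notMem (fun h => hyR h.2), Set.indicator_of_notMem (fun h => hyR h.2),
      smul_zero]

/-- Fubini turns a transversal estimate on almost every slice into one for the full integral. The
slice error W may blow up, provided that it is integrable. -/
theorem norm_integral_prod_sub_le {X : Type*} [MeasurableSpace X] {μ : Measure X} [SFinite μ]
    {h : ℝ × X → ℂ} (hh : Integrable h (volume.prod μ)) {F : ℝ → ℂ} (hF : Integrable F)
    {W : ℝ → ℝ} (hW : Integrable W) (hle : ∀ᵐ s, ‖(∫ w, h (s, w) ∂μ) - F s‖ ≤ W s) :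
    ‖(∫ z, h z ∂(volume.prod μ)) - ∫ s, F s‖ ≤ ∫ s, W s := by
  rw [integral_prod _ hh, ← integral_sub hh.integral_prod_left hF]
  exact norm_integral_le_of_norm_le hW hle

/-- A direct consequence of polar coordinates in the plane, for the even part of `H`. -/
theorem norm_integral_polar_sub_le {H : ℝ × ℝ → ℂ} (hH : Continuous H) {R : ℝ} (hR : 0 ≤ R)
    (hsupp : ∀ w : ℝ × ℝ, R ^ 2 ≤ w.1 ^ 2 + w.2 ^ 2 → H w = 0) {c : ℂ} {ε : ℝ}
    (hle : ∀ φ : ℝ, ‖(∫ ρ in (0 : ℝ)..R, (ρ : ℂ) * (H (ρ * Real.cos φ, ρ * Real.sin φ) +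
      H (-(ρ * Real.cos φ), -(ρ * Real.sin φ)))) - c‖ ≤ ε) :
    ‖(∫ w, H w) - Real.pi * c‖ ≤ Real.pi * ε := by
  have hHc : HasCompactSupport H := by
    refine HasCompactSupport.intro ((isCompact_Icc (a := -R) (b := R)).prod
      (isCompact_Icc (a := -R) (b := R))) fun w hw => hsupp w ?_
    by_contra! hlt
    exact hw ⟨abs_le.1 (abs_le_of_sq_le_sq (by nlinarith [sq_nonneg w.2]) hR),
      abs_le.1 (abs_le_of_sq_le_sq (by nlinarith [sq_nonneg w.1]) hR)⟩
  have hHi : Integrable H := hH.integrable_of_hasCompactSupport hHc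
  have hneg : ∫ w, H (-w) = ∫ w, H w := integral_neg_eq_self H volume
  have hHn : Integrable fun w => H (-w) := hHi.comp_neg
  set Q : ℝ × ℝ → ℂ := fun p => (p.1 : ℂ) * (H (p.1 * Real.cos p.2, p.1 * Real.sin p.2) +
      H (-(p.1 * Real.cos p.2), -(p.1 * Real.sin p.2))) with hQ
  have hQc : Continuous Q := by fun_prop
  -- Pairing w with -w makes each radial profile even, as `EvenSlice` requires, and counts the plane
  -- twice. With angular measure 2π this leaves the factor π in front of c.
  have hpolar : ∫ p in polarCoord.target, Q p = 2 * ∫ w, H w := by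
    have h1 := integral_comp_polarCoord_symm fun w => H w + H (-w)
    rw [integral_add hHi hHn, hneg, ← two_mul] at h1
    rw [← h1]
    refine integral_congr_ae (ae_of_all _ fun p => ?_)
    simp [hQ, polarCoord_symm_apply]
    ring
  have htarget : ∫ p in polarCoord.target, Q p
      = ∫ p in Set.Ioc 0 R ×ˢ Set.Ioo (-Real.pi) Real.pi, Q p := by
    rw [polarCoord_target]
    refine setIntegral_eq_of_subset_of_forall_sdiff_eq_zero
      (measurableSet_Ioi.prod measurableSet_Ioo)
      (Set.prod_mono Set.Ioc_subset_Ioi_self le_rfl) fun p hp => ?_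
    have hp1 : 0 < p.1 := hp.1.1
    have hpR : R ≤ p.1 := by
      by_contra! hlt
      exact hp.2 ⟨⟨hp1, hlt.le⟩, hp.1.2⟩
    have hsq : R ^ 2 ≤ p.1 ^ 2 := by gcongr
    have hcs := Real.cos_sq_add_sin_sq p.2
    have e : (p.1 * Real.cos p.2) ^ 2 + (p.1 * Real.sin p.2) ^ 2 = p.1 ^ 2 := by
      linear_combination p.1 ^ 2 * hcs
    simp only [hQ]
    rw [hsupp _ (by rw [e]; exact hsq), hsupp _ (by simp only [neg_sq]; rw [e]; exact hsq)]
    simp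
  have hQi : Integrable Q ((volume.restrict (Set.Ioc 0 R)).prod
      (volume.restrict (Set.Ioo (-Real.pi) Real.pi))) := by
    rw [Measure.prod_restrict]
    refine IntegrableOn.mono_set (hQc.continuousOn.integrableOn_compact
      ((isCompact_Icc (a := 0) (b := R)).prod (isCompact_Icc (a := -Real.pi) (b := Real.pi)))) ?_
    exact Set.prod_mono Set.Ioc_subset_Icc_self Set.Ioo_subset_Icc_self
  have hfub : 2 * ∫ w, H w = ∫ φ in Set.Ioo (-Real.pi) Real.pi, ∫ ρ in (0 : ℝ)..R, Q (ρ, φ) := by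
    rw [← hpolar, htarget, Measure.volume_eq_prod, ← Measure.prod_restrict, integral_prod_symm _ hQi]
    simp only [intervalIntegral.integral_of_le hR]
  have hinner : IntegrableOn (fun φ => ∫ ρ in (0 : ℝ)..R, Q (ρ, φ))
      (Set.Ioo (-Real.pi) Real.pi) := by
    simp only [intervalIntegral.integral_of_le hR]
    exact hQi.integral_prod_right
  have hpi := Real.pi_pos
  have hvol : volume.real (Set.Ioo (-Real.pi) Real.pi) = 2 * Real.pi := by
    rw [Real.volume_real_Ioo_of_le (by linarith)]
    ring
  have hconst : ∫ _ in Set.Ioo (-Real.pi) Real.pi, c = 2 * (Real.pi * c) := by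
    rw [setIntegral_const, hvol, Complex.real_smul]
    push_cast
    ring
  have hfin : ‖2 * ((∫ w, H w) - Real.pi * c)‖ ≤ ε * (2 * Real.pi) := by
    rw [mul_sub, hfub, ← hconst, ← integral_sub hinner (integrable_const c), ← hvol]
    exact norm_setIntegral_le_of_norm_le_const (by simp) fun φ _ => hle φ
  rw [norm_mul, Complex.norm_two] at hfin
  linarith

/-! ### Orthonormal frames -/

/-- A Householder reflection exchanges two vectors of equal length. -/
theorem exists_isometry_single {d : ℕ} (θ : Space (d + 1)) (hθ : ‖θ‖ = 1) :
    ∃ L : Space (d + 1) ≃ₗᵢ[ℝ] Space (d + 1), L (EuclideanSpace.single 0 1) = θ :=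
  ⟨(ℝ ∙ (EuclideanSpace.single (0 : Fin (d + 1)) (1 : ℝ) - θ))ᗮ.reflection,
    Submodule.reflection_sub (by simp [hθ])⟩

theorem exists_frame_one (θ : Space 1) (hθ : ‖θ‖ = 1) :
    ∃ T : ℝ ≃ᵐ Space 1, MeasurePreserving T ∧ ∀ s, T s = s • θ := by
  obtain ⟨L, hL⟩ := exists_isometry_single θ hθ
  refine ⟨(MeasurableEquiv.funUnique (Fin 1) ℝ).symm.trans
    ((MeasurableEquiv.toLp 2 (Fin 1 → ℝ)).trans L.toHomeomorph.toMeasurableEquiv), ?_, fun s => ?_⟩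
  · exact L.measurePreserving.comp ((PiLp.volume_preserving_toLp (Fin 1)).comp
      (volume_preserving_funUnique (Fin 1) ℝ).symm)
  · have : WithLp.toLp 2 (fun _ : Fin 1 => s) = s • EuclideanSpace.single (0 : Fin 1) (1 : ℝ) := by
      ext i
      fin_cases i
      simp
    calc _ = L (WithLp.toLp 2 (fun _ : Fin 1 => s)) := rfl
      _ = _ := by rw [this, map_smul, hL]

theorem exists_frame_two (θ : Space 2) (hθ : ‖θ‖ = 1) :
    ∃ (e : Space 2) (T : ℝ × ℝ ≃ᵐ Space 2), ‖e‖ = 1 ∧ inner ℝ θ e = 0 ∧ MeasurePreserving T ∧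
      ∀ p, T p = p.1 • θ + p.2 • e := by
  obtain ⟨L, hL⟩ := exists_isometry_single θ hθ
  refine ⟨L (EuclideanSpace.single 1 1), MeasurableEquiv.finTwoArrow.symm.trans
    ((MeasurableEquiv.toLp 2 (Fin 2 → ℝ)).trans L.toHomeomorph.toMeasurableEquiv),
    by simp, ?_, ?_, fun p => ?_⟩
  · rw [← hL, LinearIsometryEquiv.inner_map_map]
    simp [PiLp.inner_apply]
  · exact L.measurePreserving.comp ((PiLp.volume_preserving_toLp (Fin 2)).comp
      (volume_preserving_finTwoArrow ℝ).symm)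
  · have : WithLp.toLp 2 ![p.1, p.2] = p.1 • EuclideanSpace.single (0 : Fin 2) (1 : ℝ) +
        p.2 • EuclideanSpace.single (1 : Fin 2) (1 : ℝ) := by
      ext i
      fin_cases i <;> simp
    calc _ = L (WithLp.toLp 2 ![p.1, p.2]) := rfl
      _ = _ := by rw [this, map_add, map_smul, map_smul, hL]

/-- The coordinates are grouped as ℝ × (ℝ × ℝ) so that Fubini separates the beam variable from the
transversal plane. -/
theorem exists_frame_three (θ : Space 3) (hθ : ‖θ‖ = 1) :
    ∃ (e₁ e₂ : Space 3) (T : ℝ × (ℝ × ℝ) ≃ᵐ Space 3), ‖e₁‖ = 1 ∧ ‖e₂‖ = 1 ∧ inner ℝ θ e₁ = 0 ∧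
      inner ℝ θ e₂ = 0 ∧ inner ℝ e₁ e₂ = 0 ∧ MeasurePreserving T ∧
      ∀ p, T p = p.1 • θ + p.2.1 • e₁ + p.2.2 • e₂ := by
  obtain ⟨L, hL⟩ := exists_isometry_single θ hθ
  refine ⟨L (EuclideanSpace.single 1 1), L (EuclideanSpace.single 2 1),
    ((MeasurableEquiv.refl ℝ).prodCongr MeasurableEquiv.finTwoArrow.symm).trans
      ((MeasurableEquiv.piFinSuccAbove (fun _ : Fin 3 => ℝ) 0).symm.trans
    ((MeasurableEquiv.toLp 2 (Fin 3 → ℝ)).trans L.toHomeomorph.toMeasurableEquiv)),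
    by simp, by simp, ?_, ?_, ?_, ?_, fun p => ?_⟩
  · rw [← hL, LinearIsometryEquiv.inner_map_map]
    simp [PiLp.inner_apply]
  · rw [← hL, LinearIsometryEquiv.inner_map_map]
    simp [PiLp.inner_apply]
  · rw [LinearIsometryEquiv.inner_map_map]
    simp [PiLp.inner_apply]
  · exact L.measurePreserving.comp ((PiLp.volume_preserving_toLp (Fin 3)).comp
      ((volume_preserving_piFinSuccAbove (fun _ : Fin 3 => ℝ) 0).symm.comp
        ((MeasurePreserving.id volume).prod (volume_preserving_finTwoArrow ℝ).symm)))
  · have : WithLp.toLp 2 (Fin.insertNth (α := fun _ : Fin 3 => ℝ) 0 p.1 ![p.2.1, p.2.2])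
        = p.1 • EuclideanSpace.single (0 : Fin 3) (1 : ℝ) +
        p.2.1 • EuclideanSpace.single (1 : Fin 3) (1 : ℝ) +
        p.2.2 • EuclideanSpace.single (2 : Fin 3) (1 : ℝ) := by
      ext i
      fin_cases i <;> simp
    calc _ = L (WithLp.toLp 2 (Fin.insertNth (α := fun _ : Fin 3 => ℝ) 0 p.1 ![p.2.1, p.2.2])) := rfl
      _ = _ := by rw [this, map_add, map_add, map_smul, map_smul, map_smul, hL]

theorem norm_direction {d : ℕ} {k : Space d} (hk : k ≠ 0) : ‖direction k‖ = 1 := by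
  rw [direction, norm_smul, norm_inv, norm_norm, inv_mul_cancel₀ (norm_ne_zero_iff.2 hk)]

theorem inner_eq_norm_mul_direction {d : ℕ} {k : Space d} (hk : k ≠ 0) (x : Space d) :
    inner ℝ k x = ‖k‖ * inner ℝ (direction k) x := by
  rw [direction, inner_smul_left, ← mul_assoc]
  simp [norm_ne_zero_iff.2 hk]

/-! ### Integrability and the trivial bound -/

/-- The singularity of the radial factor at the scatterer is dominated by a power below the
dimension. The exponents used are 0 for d = 1, 1 for d = 3, and for d = 2 the values 1/2 (leading
term) and 3/2 (Hankel remainder). -/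
theorem SliceControl.integrable_weighted {E : Type*} [NormedAddCommGroup E] [InnerProductSpace ℝ E]
    [MeasurableSpace E] [BorelSpace E] [FiniteDimensional ℝ E] [Nontrivial E]
    {M R : ℝ} {f : E → ℂ} (h : SliceControl M R f)
    {u : E → ℂ} (hu : Measurable u) (hu1 : ∀ x, ‖u x‖ ≤ 1) {g : ℝ → ℂ} (hg : Measurable g)
    {a C : ℝ} (ha : a < Module.finrank ℝ E) (hgC : ∀ r, 0 < r → ‖g r‖ ≤ C * r ^ (-a)) :
    Integrable (fun x => u x * g ‖x‖ * f x) ∧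
      ‖∫ x, u x * g ‖x‖ * f x‖ ≤
        C * M * ∫ x : E, (Set.Ioo 0 R).indicator (fun y : ℝ => y ^ (-a)) ‖x‖ := by
  have hint := (integrable_indicator_rpow_norm (E := E) volume R ha).const_mul (C * M)
  have hle : ∀ᵐ x : E, ‖u x * g ‖x‖ * f x‖ ≤
      C * M * (Set.Ioo 0 R).indicator (fun y : ℝ => y ^ (-a)) ‖x‖ := by
    -- The origin is discarded because the dominating indicator of the open interval is 0 there.
    filter_upwards [compl_mem_ae_iff.2 (measure_singleton (0 : E))] with x hx
    have hx0 : 0 < ‖x‖ := norm_pos_iff.2 hx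
    by_cases hxR : ‖x‖ < R
    · have hmem : ‖x‖ ∈ Set.Ioo 0 R := ⟨hx0, hxR⟩
      rw [Set.indicator_of_mem hmem, norm_mul, norm_mul]
      have h1 : ‖u x‖ * ‖g ‖x‖‖ ≤ 1 * (C * ‖x‖ ^ (-a)) :=
        mul_le_mul (hu1 x) (hgC _ hx0) (norm_nonneg _) zero_le_one
      have h2 := mul_le_mul h1 (h.bound x) (norm_nonneg _) ((by positivity : (0 : ℝ) ≤ _).trans h1)
      linarith
    · rw [h.supp x (not_lt.1 hxR), Set.indicator_of_notMem fun h => hxR h.2]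
      simp
  have hm : AEStronglyMeasurable (fun x => u x * g ‖x‖ * f x) volume := by
    have := h.smooth.continuous.measurable
    exact Measurable.aestronglyMeasurable (by fun_prop)
  refine ⟨hint.mono' hm hle, ?_⟩
  rw [← integral_const_mul]
  exact norm_integral_le_of_norm_le hint hle

/-- The factor `e^{-i k · x}`. -/
def conjWave {d : ℕ} (k x : Space d) : ℂ := Complex.exp (-(Complex.I * ((inner ℝ k x : ℝ) : ℂ)))

theorem norm_conjWave {d : ℕ} (k x : Space d) : ‖conjWave k x‖ ≤ 1 := by
  rw [conjWave, ← mul_neg, ← Complex.ofReal_neg, norm_exp_I_mul]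

@[fun_prop]
theorem measurable_conjWave {d : ℕ} (k : Space d) : Measurable (conjWave k) := by
  have : Continuous (conjWave k) := by unfold conjWave; fun_prop
  exact this.measurable

/-- The phase along the beam. -/
def beamPhase (κ s : ℝ) : ℂ := Complex.exp (Complex.I * ((κ * (|s| - s) : ℝ) : ℂ))

theorem norm_beamPhase (κ s : ℝ) : ‖beamPhase κ s‖ = 1 := norm_exp_I_mul _

/-- The splitting r - s = (|s| - s) + (r - |s|) separates the phase along the beam from the
transversal phase. -/
theorem exp_mul_exp_eq (κ s r : ℝ) :
    Complex.exp (-(Complex.I * ((κ * s : ℝ) : ℂ))) * Complex.exp (Complex.I * (κ : ℂ) * (r : ℂ))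
      = beamPhase κ s * Complex.exp (Complex.I * ((κ * (r - |s|) : ℝ) : ℂ)) := by
  rw [beamPhase, ← Complex.exp_add, ← Complex.exp_add]
  congr 1
  push_cast
  ring

theorem SliceControl.norm_beamPhase_sub_le {M R : ℝ} {d : ℕ} {f : Space d → ℂ}
    (h : SliceControl M R f) {θ : Space d} (hθ : ‖θ‖ = 1) {κ : ℝ} (hκ : 0 < κ) :
    ‖(2 * Complex.I * (κ : ℂ))⁻¹ * (∫ s : ℝ, beamPhase κ s * f (s • θ)) -
      (2 * Complex.I * (κ : ℂ))⁻¹ * ∫ t in Set.Ioi (0 : ℝ), f (t • θ)‖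
      ≤ M * (1 + R) * (κ ^ 2)⁻¹ := by
  rw [← mul_sub, norm_mul, norm_inv, norm_mul, norm_mul, Complex.norm_two, Complex.norm_I,
    Complex.norm_real, Real.norm_of_nonneg hκ.le, mul_one]
  have h2 : (2 * κ)⁻¹ ≤ κ⁻¹ := inv_anti₀ hκ (by linarith)
  calc _ ≤ κ⁻¹ * (M * (1 + R) * κ⁻¹) :=
        mul_le_mul h2 (h.norm_beam_sub_le hθ hκ) (norm_nonneg _) (by positivity)
    _ = _ := by ring

theorem SliceControl.integrable_beamPhase_mul {M R : ℝ} {d : ℕ} {f : Space d → ℂ}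
    (h : SliceControl M R f) {θ : Space d} (hθ : ‖θ‖ = 1) (κ : ℝ) :
    Integrable fun s : ℝ => beamPhase κ s * f (s • θ) := by
  refine (h.integrable_beam hθ).bdd_mul (c := 1) ?_ (ae_of_all _ fun s => (norm_beamPhase κ s).le)
  have : Continuous (beamPhase κ) := by unfold beamPhase; fun_prop
  exact this.aestronglyMeasurable

theorem norm_sq_frame {d : ℕ} {θ e : Space d} (hθ : ‖θ‖ = 1) (he : ‖e‖ = 1)
    (hθe : inner ℝ θ e = 0) (s ρ : ℝ) : ‖s • θ + ρ • e‖ = radius |s| ρ := by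
  rw [radius, sq_abs, eq_comm, Real.sqrt_eq_iff_mul_self_eq (by positivity) (norm_nonneg _),
    ← sq, norm_add_sq_real, norm_smul, norm_smul, hθ, he, inner_smul_left, inner_smul_right, hθe]
  simp

theorem inner_frame {d : ℕ} {k e : Space d} (hk : k ≠ 0) (hke : inner ℝ (direction k) e = 0)
    (s ρ : ℝ) : inner ℝ k (s • direction k + ρ • e) = ‖k‖ * s := by
  rw [inner_eq_norm_mul_direction hk, inner_add_right, inner_smul_right, inner_smul_right, hke,
    real_inner_self_eq_norm_sq, norm_direction hk]
  ring

/-! ### High-energy asymptotics of the tested Green function -/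

/-- The Green function tested against `f` after removal of the plane wave. -/
def greenPairing {d : ℕ} (f : Space d → ℂ) (k : Space d) : ℂ :=
  ∫ x, conjWave k x * greenRadial d ‖k‖ ‖x‖ * f x

/-! ### Dimension one of the tested Green function -/

theorem integrable_green_one {M R : ℝ} {f : Space 1 → ℂ} (h : SliceControl M R f) (k : Space 1) :
    Integrable fun x => conjWave k x * greenRadial 1 ‖k‖ ‖x‖ * f x := by
  refine (h.integrable_weighted (measurable_conjWave k) (norm_conjWave k)
    (g := greenRadial 1 ‖k‖) ?_ (a := 0) (C := (2 * ‖k‖)⁻¹) (by simp) fun r _ => ?_).1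
  · unfold greenRadial
    fun_prop
  · rw [greenRadial, norm_div, mul_assoc Complex.I, ← Complex.ofReal_mul, norm_exp_I_mul]
    simp

/-- On the line there is no transversal variable: the pairing is exactly (2iκ)⁻¹ times the beam
integral, and the only error comes from the backward half-line. -/
theorem greenPairing_one_sub_le {M R : ℝ} {f : Space 1 → ℂ} (h : SliceControl M R f)
    {k : Space 1} (hk : 1 ≤ ‖k‖) :
    ‖greenPairing f k - (2 * Complex.I * (‖k‖ : ℂ))⁻¹ *
      ∫ t in Set.Ioi (0 : ℝ), f (t • direction k)‖ ≤ M * (1 + R) * (‖k‖ ^ 2)⁻¹ := by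
  have hκ : 0 < ‖k‖ := by linarith
  have hk0 : k ≠ 0 := norm_pos_iff.1 hκ
  have hθ := norm_direction hk0
  obtain ⟨T, hT, hTf⟩ := exists_frame_one (direction k) hθ
  have hI : greenPairing f k = (2 * Complex.I * (‖k‖ : ℂ))⁻¹ *
      ∫ s : ℝ, beamPhase ‖k‖ s * f (s • direction k) := by
    rw [greenPairing, ← hT.integral_comp', ← integral_const_mul]
    refine integral_congr_ae (ae_of_all _ fun s => ?_)
    simp only [hTf]
    have e1 : ‖s • direction k‖ = |s| := by rw [norm_smul, hθ, mul_one, Real.norm_eq_abs]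
    have e2 : inner ℝ k (s • direction k) = ‖k‖ * s := by
      rw [inner_eq_norm_mul_direction hk0, inner_smul_right, real_inner_self_eq_norm_sq, hθ]
      ring
    rw [e1, conjWave, e2, greenRadial]
    have e3 := exp_mul_exp_eq ‖k‖ s |s|
    rw [sub_self, mul_zero, Complex.ofReal_zero, mul_zero, Complex.exp_zero, mul_one] at e3
    rw [← e3]
    ring
  rw [hI]
  exact h.norm_beamPhase_sub_le hθ hκ

/-! #### Dimension three -/

theorem integrable_green_three {M R : ℝ} {f : Space 3 → ℂ} (h : SliceControl M R f) (k : Space 3) :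
    Integrable fun x => conjWave k x * greenRadial 3 ‖k‖ ‖x‖ * f x := by
  refine (h.integrable_weighted (measurable_conjWave k) (norm_conjWave k)
    (g := greenRadial 3 ‖k‖) ?_ (a := 1) (C := (4 * Real.pi)⁻¹) (by simp) fun r hr => ?_).1
  · unfold greenRadial
    fun_prop
  · rw [greenRadial, norm_neg, norm_div, mul_assoc Complex.I, ← Complex.ofReal_mul, norm_exp_I_mul,
      norm_mul, norm_mul, Complex.norm_real, Complex.norm_real, Real.norm_of_nonneg hr.le,
      Real.norm_of_nonneg Real.pi_pos.le, Real.rpow_neg_one]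
    simp [mul_comm]

/-- The transversal integral in dimension three. -/
theorem norm_transversal_three_sub_le {M R : ℝ} {f : Space 3 → ℂ} (h : SliceControl M R f)
    {θ e₁ e₂ : Space 3} (h₁ : ‖e₁‖ = 1) (h₂ : ‖e₂‖ = 1) (hθ₁ : inner ℝ θ e₁ = 0)
    (hθ₂ : inner ℝ θ e₂ = 0) (h₁₂ : inner ℝ e₁ e₂ = 0) {s κ : ℝ} (hs : s ≠ 0) (hsR : |s| ≤ R)
    (hκ : 1 ≤ κ) :
    ‖(∫ w : ℝ × ℝ, osc |s| κ √(w.1 ^ 2 + w.2 ^ 2) *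
      (((radius |s| √(w.1 ^ 2 + w.2 ^ 2))⁻¹ : ℝ) : ℂ) * f (s • θ + w.1 • e₁ + w.2 • e₂)) -
      Real.pi * (-(Complex.I * κ)⁻¹ * (2 * f (s • θ)))‖
      ≤ Real.pi * (M * (1 + 3 * R + 2 * R ^ 2) * (κ ^ 2)⁻¹) := by
  have ha : 0 < |s| := abs_pos.2 hs
  have hfc := h.smooth.continuous
  have hcinv : Continuous fun ρ => (radius |s| ρ)⁻¹ :=
    (continuous_radius |s|).inv₀ fun ρ => (radius_pos ha ρ).ne'
  refine norm_integral_polar_sub_le ?_ (zero_le_one.trans h.one_le) ?_ ?_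
  · have c1 : Continuous fun w : ℝ × ℝ => √(w.1 ^ 2 + w.2 ^ 2) := by fun_prop
    have c2 : Continuous fun w : ℝ × ℝ => (radius |s| √(w.1 ^ 2 + w.2 ^ 2))⁻¹ := hcinv.comp c1
    fun_prop
  · intro w hw
    rw [h.supp, mul_zero]
    have horth : inner ℝ (s • θ + w.1 • e₁) (w.2 • e₂) = 0 := by
      simp [inner_add_left, inner_smul_left, inner_smul_right, hθ₂, h₁₂]
    have horth' : inner ℝ (s • θ) (w.1 • e₁) = 0 := by
      simp [inner_smul_left, inner_smul_right, hθ₁]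
    have e := norm_add_sq_real (s • θ + w.1 • e₁) (w.2 • e₂)
    have e' := norm_add_sq_real (s • θ) (w.1 • e₁)
    rw [horth, norm_smul, h₂, Real.norm_eq_abs, mul_one, sq_abs] at e
    rw [horth', norm_smul w.1, h₁, Real.norm_eq_abs, mul_one, sq_abs] at e'
    exact (sq_le_sq₀ (zero_le_one.trans h.one_le) (norm_nonneg _)).1
      (by nlinarith [sq_nonneg ‖s • θ‖])
  · intro φ
    -- Each angle gives a unit vector orthogonal to θ. The polar Jacobian ρ times 1/r is the weight
    -- ρ/r of `EvenSlice.norm_integral_osc_le`, with bounds independent of the angle.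
    set e : Space 3 := Real.cos φ • e₁ + Real.sin φ • e₂ with he
    have hen : ‖e‖ = 1 := by
      have e1 := norm_add_sq_real (Real.cos φ • e₁) (Real.sin φ • e₂)
      rw [norm_smul, norm_smul, h₁, h₂, inner_smul_left, inner_smul_right, h₁₂, mul_one, mul_one,
        Real.norm_eq_abs, Real.norm_eq_abs, sq_abs, sq_abs] at e1
      have hcs := Real.cos_sq_add_sin_sq φ
      have : ‖e‖ ^ 2 = 1 := by
        rw [he, e1]
        simp [hcs]
      exact (pow_eq_one_iff_of_nonneg (norm_nonneg e) two_ne_zero).1 this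
    have hθe : inner ℝ (s • θ) e = 0 := by
      simp [he, inner_smul_left, inner_add_right, inner_smul_right, hθ₁, hθ₂]
    obtain ⟨g₁, g₂, g₃, hg⟩ := h.slice (s • θ) e hen hθe
    have key := hg.norm_integral_osc_le ha hsR h.one_le hκ
    rw [zero_smul, add_zero, sub_zero, ← two_mul] at key
    convert key using 2
    rw [neg_mul, sub_neg_eq_add]
    congr 1
    refine intervalIntegral.integral_congr fun ρ hρ => ?_
    rw [Set.uIcc_of_le (zero_le_one.trans h.one_le)] at hρ
    have hcs := Real.cos_sq_add_sin_sq φ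
    have r1 : √((ρ * Real.cos φ) ^ 2 + (ρ * Real.sin φ) ^ 2) = ρ := by
      rw [show (ρ * Real.cos φ) ^ 2 + (ρ * Real.sin φ) ^ 2 = ρ ^ 2 by
        linear_combination ρ ^ 2 * hcs, Real.sqrt_sq hρ.1]
    have r2 : √((-(ρ * Real.cos φ)) ^ 2 + (-(ρ * Real.sin φ)) ^ 2) = ρ := by
      rw [neg_sq, neg_sq, r1]
    have p1 : s • θ + (ρ * Real.cos φ) • e₁ + (ρ * Real.sin φ) • e₂ = s • θ + ρ • e := by
      rw [he]; module
    have p2 : s • θ + (-(ρ * Real.cos φ)) • e₁ + (-(ρ * Real.sin φ)) • e₂ = s • θ - ρ • e := by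
      rw [he]; module
    simp only [r1, r2, p1, p2]
    push_cast
    ring

theorem greenPairing_three_sub_le {M R : ℝ} {f : Space 3 → ℂ} (h : SliceControl M R f)
    {k : Space 3} (hk : 1 ≤ ‖k‖) :
    ‖greenPairing f k - (2 * Complex.I * (‖k‖ : ℂ))⁻¹ *
      ∫ t in Set.Ioi (0 : ℝ), f (t • direction k)‖
      ≤ (M * (1 + R) + 2 * R * (M * (1 + 3 * R + 2 * R ^ 2))) * (‖k‖ ^ 2)⁻¹ := by
  have hκ : 0 < ‖k‖ := by linarith
  have hk0 : k ≠ 0 := norm_pos_iff.1 hκ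
  have hθ := norm_direction hk0
  have hR : 0 ≤ R := zero_le_one.trans h.one_le
  have hM := h.nonneg
  obtain ⟨e₁, e₂, T, h₁, h₂, hθ₁, hθ₂, h₁₂, hT, hTf⟩ := exists_frame_three (direction k) hθ
  set ε := M * (1 + 3 * R + 2 * R ^ 2) * (‖k‖ ^ 2)⁻¹ with hε
  have hε0 : 0 ≤ ε := by positivity
  set F : ℝ → ℂ := fun s => (2 * Complex.I * (‖k‖ : ℂ))⁻¹ *
    (beamPhase ‖k‖ s * f (s • direction k)) with hF
  have hFi : Integrable F := (h.integrable_beamPhase_mul hθ ‖k‖).const_mul _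
  have hnorm : ∀ p : ℝ × (ℝ × ℝ), ‖T p‖ = radius |p.1| √(p.2.1 ^ 2 + p.2.2 ^ 2) := fun p => by
    have horth : inner ℝ (p.1 • direction k + p.2.1 • e₁) (p.2.2 • e₂) = 0 := by
      simp [inner_add_left, inner_smul_left, inner_smul_right, hθ₂, h₁₂]
    have e := norm_add_sq_real (p.1 • direction k + p.2.1 • e₁) (p.2.2 • e₂)
    rw [horth, norm_smul, h₂, Real.norm_eq_abs, mul_one, sq_abs,
      norm_sq_frame hθ h₁ hθ₁, sq_radius, sq_abs] at e
    rw [hTf, radius, Real.sq_sqrt (by positivity), sq_abs, eq_comm,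
      Real.sqrt_eq_iff_mul_self_eq (by positivity) (norm_nonneg _), ← sq, e]
    ring
  have hinner : ∀ p, inner ℝ k (T p) = ‖k‖ * p.1 := fun p => by
    rw [hTf, inner_add_right, inner_frame hk0 hθ₁, inner_eq_norm_mul_direction hk0,
      inner_smul_right, hθ₂]
    ring
  have hint : Integrable (fun p : ℝ × (ℝ × ℝ) =>
      conjWave k (T p) * greenRadial 3 ‖k‖ ‖T p‖ * f (T p)) :=
    (hT.integrable_comp_emb T.measurableEmbedding).2 (integrable_green_three h k)
  have hpt : ∀ p : ℝ × (ℝ × ℝ), conjWave k (T p) * greenRadial 3 ‖k‖ ‖T p‖ * f (T p)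
      = -(4 * (Real.pi : ℂ))⁻¹ * beamPhase ‖k‖ p.1 *
        (osc |p.1| ‖k‖ √(p.2.1 ^ 2 + p.2.2 ^ 2) *
          (((radius |p.1| √(p.2.1 ^ 2 + p.2.2 ^ 2))⁻¹ : ℝ) : ℂ) * f (T p)) := fun p => by
    rw [conjWave, hinner, hnorm, greenRadial]
    have e3 := exp_mul_exp_eq ‖k‖ p.1 (radius |p.1| √(p.2.1 ^ 2 + p.2.2 ^ 2))
    rw [osc]
    push_cast at e3 ⊢
    rw [div_eq_mul_inv, mul_inv]
    linear_combination (-(4 * (Real.pi : ℂ))⁻¹ *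
      ((radius |p.1| √(p.2.1 ^ 2 + p.2.2 ^ 2) : ℝ) : ℂ)⁻¹ * f (T p)) * e3
  have hslice : ∀ᵐ s : ℝ, ‖(∫ w : ℝ × ℝ, conjWave k (T (s, w)) *
      greenRadial 3 ‖k‖ ‖T (s, w)‖ * f (T (s, w))) - F s‖
      ≤ (Set.Icc (-R) R).indicator (fun _ => ε) s := by
    filter_upwards [compl_mem_ae_iff.2 (measure_singleton (0 : ℝ))] with s hs
    simp only [hpt]
    by_cases hsR : |s| ≤ R
    · have key := norm_transversal_three_sub_le h h₁ h₂ hθ₁ hθ₂ h₁₂ hs hsR hk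
      have hmem : s ∈ Set.Icc (-R) R := abs_le.1 hsR
      rw [Set.indicator_of_mem hmem, integral_const_mul]
      simp only [hTf]
      set J := ∫ w : ℝ × ℝ, osc |s| ‖k‖ √(w.1 ^ 2 + w.2 ^ 2) *
        (((radius |s| √(w.1 ^ 2 + w.2 ^ 2))⁻¹ : ℝ) : ℂ) *
          f (s • direction k + w.1 • e₁ + w.2 • e₂)
      have hpi := Real.pi_pos
      have hpiC : (Real.pi : ℂ) ≠ 0 := by exact_mod_cast hpi.ne'
      have hkC : (‖k‖ : ℂ) ≠ 0 := by exact_mod_cast hκ.ne'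
      -- The constants combine as -(4π)⁻¹ · π · (-(iκ)⁻¹) · 2 = (2iκ)⁻¹, where the 2 comes from the
      -- symmetrised slice at ρ = 0.
      have e : -(4 * (Real.pi : ℂ))⁻¹ * beamPhase ‖k‖ s * J - F s
          = -(4 * (Real.pi : ℂ))⁻¹ * beamPhase ‖k‖ s *
            (J - Real.pi * (-(Complex.I * ‖k‖)⁻¹ * (2 * f (s • direction k)))) := by
        simp only [hF]
        have hI := Complex.I_ne_zero
        field_simp
        ring
      rw [e, norm_mul, norm_mul, norm_beamPhase, mul_one, norm_neg, norm_inv, norm_mul,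
        Complex.norm_real, Real.norm_of_nonneg hpi.le, Complex.norm_ofNat]
      calc (4 * Real.pi)⁻¹ * _ ≤ (4 * Real.pi)⁻¹ * (Real.pi * ε) := by gcongr
        _ = ε / 4 := by field_simp
        _ ≤ ε := by linarith
    · have hmem : s ∉ Set.Icc (-R) R := fun hm => hsR (abs_le.2 hm)
      rw [Set.indicator_of_notMem hmem]
      have hsR := (not_le.1 hsR).le
      have z1 : ∀ w : ℝ × ℝ, f (T (s, w)) = 0 := fun w => h.supp _ <| by
        rw [hnorm]
        exact hsR.trans (le_radius _ _)
      have z2 : f (s • direction k) = 0 := h.supp _ <| by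
        rw [norm_smul, hθ, mul_one]
        exact hsR
      simp [z1, hF, z2]
  have hfub := norm_integral_prod_sub_le (μ := (volume : Measure (ℝ × ℝ))) hint hFi
    ((integrable_indicator_iff measurableSet_Icc).2 (integrableOn_const (by simp)))
    hslice
  rw [integral_indicator measurableSet_Icc, setIntegral_const, Real.volume_real_Icc_of_le
    (by linarith), smul_eq_mul] at hfub
  have hI : greenPairing f k = ∫ p : ℝ × (ℝ × ℝ),
      conjWave k (T p) * greenRadial 3 ‖k‖ ‖T p‖ * f (T p) ∂(volume.prod volume) := by
    rw [greenPairing, ← hT.integral_comp', Measure.volume_eq_prod]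
  rw [← hI, integral_const_mul] at hfub
  refine (norm_sub_le_norm_sub_add_norm_sub _ _ _).trans
    ((add_le_add hfub (h.norm_beamPhase_sub_le hθ hκ)).trans_eq ?_)
  rw [hε]
  ring

/-! #### Dimension two -/

theorem radius_neg (a ρ : ℝ) : radius a (-ρ) = radius a ρ := by
  simp [radius]

theorem osc_neg (a κ ρ : ℝ) : osc a κ (-ρ) = osc a κ ρ := by
  simp [osc, radius_neg]

theorem inv_sqrt_eq_rpow {r : ℝ} (hr : 0 ≤ r) : (√r)⁻¹ = r ^ (-(1 / 2) : ℝ) := by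
  rw [Real.rpow_neg hr, Real.sqrt_eq_rpow]

theorem inv_mul_sqrt_eq_rpow {r : ℝ} (hr : 0 < r) : (r * √r)⁻¹ = r ^ (-(3 / 2) : ℝ) := by
  rw [Real.rpow_neg hr.le, Real.sqrt_eq_rpow, ← Real.rpow_one_add' hr.le (by norm_num)]
  norm_num

/-- Folding the transversal line at 0 plays the role that polar coordinates play for d = 3: it
produces an even profile. -/
theorem integral_eq_integral_add_neg {H : ℝ → ℂ} (hH : Continuous H) {R : ℝ} (hR : 0 ≤ R)
    (hsupp : ∀ w, R ≤ |w| → H w = 0) : ∫ w, H w = ∫ w in (0 : ℝ)..R, (H w + H (-w)) := by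
  have hHc : HasCompactSupport H := by
    refine HasCompactSupport.intro (isCompact_Icc (a := -R) (b := R)) fun s hs => hsupp s ?_
    by_contra! hlt
    exact hs ⟨(abs_lt.1 hlt).1.le, (abs_lt.1 hlt).2.le⟩
  have hi : Integrable H := hH.integrable_of_hasCompactSupport hHc
  rw [← intervalIntegral.integral_Iic_add_Ioi (b := 0) hi.integrableOn hi.integrableOn]
  have h1 : ∫ w in Set.Iic (0 : ℝ), H w = ∫ w in Set.Ioi (0 : ℝ), H (-w) := by
    rw [integral_comp_neg_Ioi, neg_zero]
  rw [h1, add_comm, ← integral_add hi.integrableOn hi.comp_neg.integrableOn,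
    intervalIntegral.integral_of_le hR]
  refine setIntegral_eq_of_subset_of_forall_sdiff_eq_zero measurableSet_Ioi
    Set.Ioc_subset_Ioi_self fun s hs => ?_
  have hs0 : 0 < s := hs.1
  have hsR : R ≤ |s| := by
    rw [abs_of_pos hs0]
    by_contra! hlt
    exact hs.2 ⟨hs0, hlt.le⟩
  rw [hsupp s hsR, hsupp (-s) (by rwa [abs_neg]), add_zero]

theorem norm_transversal_two_sub_le {M R : ℝ} {f : Space 2 → ℂ} (h : SliceControl M R f)
    {θ e : Space 2} (he : ‖e‖ = 1) (hθe : inner ℝ θ e = 0) {s κ : ℝ} (hs : s ≠ 0) (hsR : |s| ≤ R)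
    (hκ : 1 ≤ κ) :
    ‖(∫ w : ℝ, osc |s| κ w * (((√(radius |s| w))⁻¹ : ℝ) : ℂ) * f (s • θ + w • e)) -
      fresnelConst * (((√κ)⁻¹ : ℝ) : ℂ) * (2 * f (s • θ))‖
      ≤ M * (4 * R ^ 2 + 4 * R * |s| ^ (-(3 / 4) : ℝ)) * κ⁻¹ := by
  have ha : 0 < |s| := abs_pos.2 hs
  have hR : 0 ≤ R := zero_le_one.trans h.one_le
  have hfc := h.smooth.continuous
  have horth : inner ℝ (s • θ) e = 0 := by simp [inner_smul_left, hθe]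
  have hcinv : Continuous fun ρ => (√(radius |s| ρ))⁻¹ :=
    (continuous_radius |s|).sqrt.inv₀ fun ρ => (Real.sqrt_pos.2 (radius_pos ha ρ)).ne'
  rw [integral_eq_integral_add_neg (by fun_prop) hR fun w hw => by
    rw [h.supp _ (hw.trans (le_norm_add_smul he horth w)), mul_zero]]
  obtain ⟨g₁, g₂, g₃, hg⟩ := h.slice (s • θ) e he horth
  have key := hg.norm_integral_osc_sqrt_sub_le ha hsR h.one_le hκ
  rw [zero_smul, add_zero, sub_zero, ← two_mul] at key
  convert key using 3
  refine intervalIntegral.integral_congr fun ρ _ => ?_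
  simp only [radius_neg, osc_neg, neg_smul, ← sub_eq_add_neg]
  ring

/-- The constant in front of the leading term of the planar Green function. -/
def planarConst (κ : ℝ) : ℂ :=
  -(Complex.I / 4) * ((√2 / √Real.pi : ℝ) : ℂ) * rootI⁻¹ * (((√κ)⁻¹ : ℝ) : ℂ)

theorem rootI_ne_zero : rootI ≠ 0 := Complex.exp_ne_zero _

/-- The eighth roots of unity from the Hankel asymptotics and from the Fresnel integral cancel, as
do the factors √2 and √π. This is why the planar leading term has the same constant as in the other
dimensions. -/
theorem planarConst_mul {κ : ℝ} (hκ : 0 < κ) :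
    planarConst κ * (fresnelConst * (((√κ)⁻¹ : ℝ) : ℂ) * 2) = (2 * Complex.I * (κ : ℂ))⁻¹ := by
  have h1 : ((√κ : ℝ) : ℂ) * ((√κ : ℝ) : ℂ) = κ := by
    rw [← Complex.ofReal_mul, Real.mul_self_sqrt hκ.le]
  have h2 : ((√2 : ℝ) : ℂ) ≠ 0 := by
    exact_mod_cast (Real.sqrt_pos.2 (by norm_num : (0 : ℝ) < 2)).ne'
  have h3 : ((√Real.pi : ℝ) : ℂ) ≠ 0 := by exact_mod_cast (Real.sqrt_pos.2 Real.pi_pos).ne'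
  have h4 : ((√κ : ℝ) : ℂ) ≠ 0 := by exact_mod_cast (Real.sqrt_pos.2 hκ).ne'
  have h5 := rootI_ne_zero
  have h6 := Complex.I_mul_I
  rw [planarConst, fresnelConst, ← h1]
  push_cast
  have h7 := Complex.I_ne_zero
  field_simp
  linear_combination (-4) * h6

theorem norm_planarConst_le {κ : ℝ} : ‖planarConst κ‖ ≤ (√κ)⁻¹ := by
  rw [planarConst, norm_mul, norm_mul, norm_mul, norm_inv, norm_rootI, Complex.norm_real,
    Complex.norm_real, Real.norm_of_nonneg (by positivity), Real.norm_of_nonneg (by positivity)]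
  have h1 : √2 / √Real.pi ≤ 1 := by
    rw [div_le_one (Real.sqrt_pos.2 Real.pi_pos)]
    exact Real.sqrt_le_sqrt (by linarith [Real.pi_gt_three])
  have h2 : ‖-(Complex.I / 4)‖ = 1 / 4 := by simp
  rw [h2, inv_one, mul_one]
  refine mul_le_of_le_one_left (by positivity) ?_
  have : 0 ≤ √2 / √Real.pi := by positivity
  linarith

theorem measurable_hankelLead : Measurable hankelLead := by
  unfold hankelLead
  fun_prop

theorem integrable_lead_two {M R : ℝ} {f : Space 2 → ℂ} (h : SliceControl M R f) (k : Space 2) :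
    Integrable fun x => conjWave k x * (-(Complex.I / 4) * hankelLead (‖x‖ * ‖k‖)) * f x := by
  have := measurable_hankelLead
  refine (h.integrable_weighted (measurable_conjWave k) (norm_conjWave k)
    (g := fun r => -(Complex.I / 4) * hankelLead (r * ‖k‖)) (by fun_prop) (a := 1 / 2)
    (C := (√‖k‖)⁻¹) (by simp; norm_num) fun r hr => ?_).1
  rw [norm_mul, ← inv_sqrt_eq_rpow hr.le]
  have h2 : ‖-(Complex.I / 4)‖ = 1 / 4 := by simp
  have h3 := norm_hankelLead_le (r := r * ‖k‖)
  rw [Real.sqrt_mul hr.le, mul_inv, mul_comm (√r)⁻¹] at h3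
  rw [h2]
  have := norm_nonneg (hankelLead (r * ‖k‖))
  linarith

theorem integrable_remainder_two {M R : ℝ} {f : Space 2 → ℂ} (h : SliceControl M R f) {k : Space 2}
    (hk : 0 < ‖k‖) :
    Integrable (fun x => conjWave k x *
      (-(Complex.I / 4) * (hankelH10 (‖x‖ * ‖k‖) - hankelLead (‖x‖ * ‖k‖))) * f x) ∧
    ‖∫ x, conjWave k x *
      (-(Complex.I / 4) * (hankelH10 (‖x‖ * ‖k‖) - hankelLead (‖x‖ * ‖k‖))) * f x‖ ≤
      (‖k‖ * √‖k‖)⁻¹ * M *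
        ∫ x : Space 2, (Set.Ioo 0 R).indicator (fun y : ℝ => y ^ (-(3 / 2) : ℝ)) ‖x‖ := by
  have := measurable_hankelLead
  have := measurable_hankelH10
  refine h.integrable_weighted (measurable_conjWave k) (norm_conjWave k)
    (g := fun r => -(Complex.I / 4) * (hankelH10 (r * ‖k‖) - hankelLead (r * ‖k‖))) (by fun_prop)
    (a := 3 / 2) (C := (‖k‖ * √‖k‖)⁻¹) (by simp; norm_num) fun r hr => ?_
  rw [norm_mul, ← inv_mul_sqrt_eq_rpow hr]
  have h2 : ‖-(Complex.I / 4)‖ = 1 / 4 := by simp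
  have h3 := norm_hankelH10_sub_lead_le (mul_pos hr hk)
  have h4 : (r * ‖k‖ * √(r * ‖k‖))⁻¹ = (‖k‖ * √‖k‖)⁻¹ * (r * √r)⁻¹ := by
    rw [Real.sqrt_mul hr.le, ← mul_inv]
    congr 1
    ring
  rw [h4] at h3
  rw [h2]
  have := norm_nonneg (hankelH10 (r * ‖k‖) - hankelLead (r * ‖k‖))
  linarith

theorem green_two_eq (k x : Space 2) (f : Space 2 → ℂ) :
    conjWave k x * greenRadial 2 ‖k‖ ‖x‖ * f x =
      conjWave k x * (-(Complex.I / 4) * (hankelH10 (‖x‖ * ‖k‖) - hankelLead (‖x‖ * ‖k‖))) * f x +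
      conjWave k x * (-(Complex.I / 4) * hankelLead (‖x‖ * ‖k‖)) * f x := by
  rw [greenRadial]
  ring

theorem integrable_green_two {M R : ℝ} {f : Space 2 → ℂ} (h : SliceControl M R f) {k : Space 2}
    (hk : 0 < ‖k‖) : Integrable fun x => conjWave k x * greenRadial 2 ‖k‖ ‖x‖ * f x := by
  simp only [green_two_eq]
  exact (integrable_remainder_two h hk).1.add (integrable_lead_two h k)

/-- The slice error grows like |s|^{-3/4} at the origin but is integrable along the beam. The
exponent `-0` makes the first summand a plain indicator in the form covered by
`integrable_indicator_rpow_norm`. -/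
theorem integral_lead_two_sub_le {M R : ℝ} {f : Space 2 → ℂ} (h : SliceControl M R f)
    {k : Space 2} (hk : 1 ≤ ‖k‖) :
    ‖(∫ x, conjWave k x * (-(Complex.I / 4) * hankelLead (‖x‖ * ‖k‖)) * f x) -
      (2 * Complex.I * (‖k‖ : ℂ))⁻¹ * ∫ s : ℝ, beamPhase ‖k‖ s * f (s • direction k)‖
      ≤ (‖k‖ * √‖k‖)⁻¹ * ∫ s : ℝ, M * (4 * R ^ 2 *
          (Set.Ioo 0 R).indicator (fun y : ℝ => y ^ (-0 : ℝ)) ‖s‖ +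
        4 * R * (Set.Ioo 0 R).indicator (fun y : ℝ => y ^ (-(3 / 4) : ℝ)) ‖s‖) := by
  have hκ : 0 < ‖k‖ := by linarith
  have hk0 : k ≠ 0 := norm_pos_iff.1 hκ
  have hθ := norm_direction hk0
  obtain ⟨e, T, he, hθe, hT, hTf⟩ := exists_frame_two (direction k) hθ
  set F : ℝ → ℂ := fun s => (2 * Complex.I * (‖k‖ : ℂ))⁻¹ *
    (beamPhase ‖k‖ s * f (s • direction k)) with hF
  have hFi : Integrable F := (h.integrable_beamPhase_mul hθ ‖k‖).const_mul _
  set W : ℝ → ℝ := fun s => M * (4 * R ^ 2 *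
          (Set.Ioo 0 R).indicator (fun y : ℝ => y ^ (-0 : ℝ)) ‖s‖ +
        4 * R * (Set.Ioo 0 R).indicator (fun y : ℝ => y ^ (-(3 / 4) : ℝ)) ‖s‖) with hW
  have hWi : Integrable W :=
    (((integrable_indicator_rpow_norm (E := ℝ) volume R (by simp)).const_mul _).add
      ((integrable_indicator_rpow_norm (E := ℝ) volume R (by simp; norm_num)).const_mul _)).const_mul _
  have hnorm : ∀ p : ℝ × ℝ, ‖T p‖ = radius |p.1| p.2 := fun p => by
    rw [hTf, norm_sq_frame hθ he hθe]
  have hpt : ∀ p : ℝ × ℝ,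
      conjWave k (T p) * (-(Complex.I / 4) * hankelLead (‖T p‖ * ‖k‖)) * f (T p)
      = planarConst ‖k‖ * beamPhase ‖k‖ p.1 * (osc |p.1| ‖k‖ p.2 *
          (((√(radius |p.1| p.2))⁻¹ : ℝ) : ℂ) * f (T p)) := fun p => by
    have hr : 0 ≤ radius |p.1| p.2 := Real.sqrt_nonneg _
    have e3 := exp_mul_exp_eq ‖k‖ p.1 (radius |p.1| p.2)
    have e4 : Complex.exp (Complex.I * ((radius |p.1| p.2 * ‖k‖ - Real.pi / 4 : ℝ) : ℂ))
        = Complex.exp (Complex.I * (‖k‖ : ℂ) * (radius |p.1| p.2 : ℂ)) * rootI⁻¹ := by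
      rw [rootI, ← Complex.exp_neg, ← Complex.exp_add]
      congr 1
      push_cast
      ring
    rw [conjWave, hnorm, hTf, inner_frame hk0 hθe, hankelLead, e4, osc, planarConst,
      Real.sqrt_mul hr, mul_inv, Complex.ofReal_mul (√(radius |p.1| p.2))⁻¹]
    linear_combination (-(Complex.I / 4) * ((√2 / √Real.pi : ℝ) : ℂ) * rootI⁻¹ *
      (((√‖k‖)⁻¹ : ℝ) : ℂ) * (((√(radius |p.1| p.2))⁻¹ : ℝ) : ℂ) *
      f (p.1 • direction k + p.2 • e)) * e3
  have hint : Integrable (fun p : ℝ × ℝ =>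
      conjWave k (T p) * (-(Complex.I / 4) * hankelLead (‖T p‖ * ‖k‖)) * f (T p)) :=
    (hT.integrable_comp_emb T.measurableEmbedding).2 (integrable_lead_two h k)
  have hslice : ∀ᵐ s : ℝ, ‖(∫ w : ℝ, conjWave k (T (s, w)) *
      (-(Complex.I / 4) * hankelLead (‖T (s, w)‖ * ‖k‖)) * f (T (s, w))) - F s‖
      ≤ (‖k‖ * √‖k‖)⁻¹ * W s := by
    filter_upwards [compl_mem_ae_iff.2 (measure_singleton (0 : ℝ))] with s hs
    have hs0 : s ≠ 0 := hs
    simp only [hpt]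
    by_cases hsR : |s| < R
    · have key := norm_transversal_two_sub_le h he hθe hs0 hsR.le hk
      have hmem : ‖s‖ ∈ Set.Ioo 0 R := ⟨norm_pos_iff.2 hs0, hsR⟩
      have hWs : W s = M * (4 * R ^ 2 + 4 * R * |s| ^ (-(3 / 4) : ℝ)) := by
        simp only [hW]
        rw [Set.indicator_of_mem hmem, Set.indicator_of_mem hmem, neg_zero, Real.rpow_zero, mul_one,
          Real.norm_eq_abs]
      rw [hWs, integral_const_mul]
      simp only [hTf]
      set J := ∫ w : ℝ, osc |s| ‖k‖ w * (((√(radius |s| w))⁻¹ : ℝ) : ℂ) *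
          f (s • direction k + w • e)
      have e : planarConst ‖k‖ * beamPhase ‖k‖ s * J - F s
          = planarConst ‖k‖ * beamPhase ‖k‖ s *
            (J - fresnelConst * (((√‖k‖)⁻¹ : ℝ) : ℂ) * (2 * f (s • direction k))) := by
        simp only [hF]
        rw [← planarConst_mul hκ]
        ring
      rw [e, norm_mul, norm_mul, norm_beamPhase, mul_one]
      refine (mul_le_mul norm_planarConst_le key (norm_nonneg _) (by positivity)).trans_eq ?_
      rw [mul_inv]
      ring
    · have hmem : ‖s‖ ∉ Set.Ioo 0 R := fun hm => hsR hm.2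
      have hsR := not_lt.1 hsR
      have z1 : ∀ w : ℝ, f (T (s, w)) = 0 := fun w => h.supp _ <| by
        rw [hnorm]
        exact hsR.trans (le_radius _ _)
      have z2 : f (s • direction k) = 0 := h.supp _ <| by
        rw [norm_smul, hθ, mul_one]
        exact hsR
      simp only [hW, Set.indicator_of_notMem hmem]
      simp [z1, hF, z2]
  have hfub := norm_integral_prod_sub_le (μ := (volume : Measure ℝ)) hint hFi
    (hWi.const_mul _) hslice
  rwa [← Measure.volume_eq_prod, hT.integral_comp' (g := fun x =>
    conjWave k x * (-(Complex.I / 4) * hankelLead (‖x‖ * ‖k‖)) * f x),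
    integral_const_mul, integral_const_mul] at hfub

/-- The Hankel remainder and the transversal error are both of order κ^{-3/2}, and the backward
half-line contributes only κ⁻². The weaker rate is enough, since the coefficient errors are merely
logarithmic. -/
theorem exists_greenPairing_two_sub_le {M R : ℝ} {f : Space 2 → ℂ} (h : SliceControl M R f) :
    ∃ C, ∀ k : Space 2, 1 ≤ ‖k‖ → ‖greenPairing f k - (2 * Complex.I * (‖k‖ : ℂ))⁻¹ *
      ∫ t in Set.Ioi (0 : ℝ), f (t • direction k)‖ ≤ C * (‖k‖ * √‖k‖)⁻¹ := by
  refine ⟨M * (∫ x : Space 2, (Set.Ioo 0 R).indicator (fun y : ℝ => y ^ (-(3 / 2) : ℝ)) ‖x‖) +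
    (∫ s : ℝ, M * (4 * R ^ 2 *
          (Set.Ioo 0 R).indicator (fun y : ℝ => y ^ (-0 : ℝ)) ‖s‖ +
        4 * R * (Set.Ioo 0 R).indicator (fun y : ℝ => y ^ (-(3 / 4) : ℝ)) ‖s‖)) + M * (1 + R),
    fun k hk => ?_⟩
  have hκ : 0 < ‖k‖ := by linarith
  have hθ := norm_direction (norm_pos_iff.1 hκ)
  have hR : 0 ≤ R := zero_le_one.trans h.one_le
  have hM := h.nonneg
  have h1 := integral_lead_two_sub_le h hk
  have h2 := (integrable_remainder_two h hκ).2
  have h3 := h.norm_beamPhase_sub_le hθ hκ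
  have hsq : (‖k‖ ^ 2)⁻¹ ≤ (‖k‖ * √‖k‖)⁻¹ := by
    have : √‖k‖ ≤ ‖k‖ := Real.sqrt_le_iff.2 ⟨hκ.le, by nlinarith⟩
    refine inv_anti₀ (by positivity) ?_
    rw [sq]
    gcongr
  have h4 := h3.trans (mul_le_mul_of_nonneg_left hsq (by positivity : 0 ≤ M * (1 + R)))
  rw [greenPairing]
  simp only [green_two_eq]
  rw [integral_add (integrable_remainder_two h hκ).1 (integrable_lead_two h k)]
  refine le_trans (le_of_eq ?_) ((norm_add₃_le (a := _) (b := _) (c := _)).trans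
    ((add_le_add (add_le_add h2 h1) h4).trans_eq ?_))
  · congr 1
    ring
  · ring

/-! ### The linear system -/

/-- A strongly diagonally dominant system is uniquely solvable, and its solution is close to that
of the diagonal system. -/
theorem mulVec_eq_of_diagonally_dominant {n : ℕ} {A : Matrix (Fin n) (Fin n) ℂ} {m ε : ℝ}
    (hm : 0 < m) (hdiag : ∀ j, m ≤ ‖A j j‖) (hoff : ∀ j l, j ≠ l → ‖A j l‖ ≤ ε) (hε : 0 ≤ ε)
    (hsmall : n * ε ≤ m / 2) {b : Fin n → ℂ} (hb : ∀ j, ‖b j‖ ≤ 1) :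
    A.det ≠ 0 ∧ ∀ q, A.mulVec q = b → ∀ j, ‖q j - b j / A j j‖ ≤ 2 * n * ε / m ^ 2 := by
  have hcard : ∀ j : Fin n, ((Finset.univ.erase j).card : ℝ) ≤ n := fun j => by
    exact_mod_cast (Finset.card_erase_le).trans (by simp)
  refine ⟨det_ne_zero_of_sum_row_lt_diag fun j => ?_, fun q hq j => ?_⟩
  · calc ∑ l ∈ Finset.univ.erase j, ‖A j l‖ ≤ ∑ _l ∈ Finset.univ.erase j, ε :=
          Finset.sum_le_sum fun l hl => hoff j l (Finset.ne_of_mem_erase hl).symm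
      _ = (Finset.univ.erase j).card * ε := by rw [Finset.sum_const, nsmul_eq_mul]
      _ ≤ n * ε := by exact mul_le_mul_of_nonneg_right (hcard j) (by positivity)
      _ < ‖A j j‖ := by linarith [hdiag j]
  · have hne : ∀ j, A j j ≠ 0 := fun j => norm_pos_iff.1 (hm.trans_le (hdiag j))
    have hrow : ∀ j, q j - b j / A j j = -(∑ l ∈ Finset.univ.erase j, A j l * q l) / A j j :=
        fun j => by
      have h1 := congrFun hq j
      rw [Matrix.mulVec, dotProduct, ← Finset.add_sum_erase _ _ (Finset.mem_univ j)] at h1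
      have := hne j
      field_simp
      linear_combination h1
    have hsum : ∀ j, ‖∑ l ∈ Finset.univ.erase j, A j l * q l‖ ≤ n * ε * ‖q‖ := fun j => by
      calc _ ≤ ∑ l ∈ Finset.univ.erase j, ‖A j l * q l‖ := norm_sum_le _ _
        _ ≤ ∑ _l ∈ Finset.univ.erase j, ε * ‖q‖ := Finset.sum_le_sum fun l hl => by
            rw [norm_mul]
            exact mul_le_mul (hoff j l (Finset.ne_of_mem_erase hl).symm) (norm_le_pi_norm q l)
              (norm_nonneg _) hε
        _ = (Finset.univ.erase j).card * (ε * ‖q‖) := by rw [Finset.sum_const, nsmul_eq_mul]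
        _ ≤ n * (ε * ‖q‖) := by exact mul_le_mul_of_nonneg_right (hcard j) (by positivity)
        _ = n * ε * ‖q‖ := by ring
    have hdev : ∀ j, ‖q j - b j / A j j‖ ≤ n * ε * ‖q‖ / m := fun j => by
      rw [hrow, norm_div, norm_neg]
      exact div_le_div₀ (by positivity) (hsum j) hm (hdiag j)
    -- A bootstrap: `hdev` bounds the deviation by ‖q‖/2, which is absorbed on the left. The
    -- resulting bound on ‖q‖ is then fed back into `hdev`.
    have hq2 : ‖q‖ ≤ 2 / m := by
      have h1 : ‖q‖ ≤ 1 / m + n * ε * ‖q‖ / m := by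
        refine (pi_norm_le_iff_of_nonneg (by positivity)).2 fun j => ?_
        have h2 : ‖b j / A j j‖ ≤ 1 / m := by
          rw [norm_div]
          exact div_le_div₀ zero_le_one (hb j) hm (hdiag j)
        calc ‖q j‖ = ‖b j / A j j + (q j - b j / A j j)‖ := by congr 1; ring
          _ ≤ _ := (norm_add_le _ _).trans (add_le_add h2 (hdev j))
      have h3 : n * ε * ‖q‖ / m ≤ ‖q‖ / 2 := by
        rw [div_le_iff₀ hm]
        nlinarith [norm_nonneg q]
      have h4 : 2 / m = 2 * (1 / m) := by ring
      linarith
    calc _ ≤ n * ε * ‖q‖ / m := hdev j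
      _ ≤ n * ε * (2 / m) / m := by gcongr
      _ = 2 * n * ε / m ^ 2 := by field_simp

theorem planeWave_mul_conjWave {d : ℕ} (k x : Space d) : planeWave k x * conjWave k x = 1 := by
  rw [planeWave, conjWave, ← Complex.exp_add, add_neg_cancel, Complex.exp_zero]

theorem norm_planeWave {d : ℕ} (k x : Space d) : ‖planeWave k x‖ = 1 := norm_exp_I_mul _

theorem conjWave_add {d : ℕ} (k x y : Space d) :
    conjWave k (x + y) = conjWave k x * conjWave k y := by
  rw [conjWave, conjWave, conjWave, ← Complex.exp_add, inner_add_right]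
  congr 1
  push_cast
  ring

/-- The solution of the linear system, by the inverse matrix. -/
def coeff {d n : ℕ} (α : Fin n → ℂ) (y : Fin n → Space d) (k : Space d) : Fin n → ℂ :=
  (matA α y ‖k‖)⁻¹.mulVec (vecB y k)

/-- Multiplying by e^{-ik·y_j}, of modulus 1, removes the plane wave from b_j/A_jj, so that the main
term -1/A_jj depends on κ only and not on the direction. -/
theorem coeff_estimate {d n : ℕ} {α : Fin n → ℂ} {y : Fin n → Space d} {k : Space d} {m ε : ℝ}
    (hm : 0 < m) (hdiag : ∀ j, m ≤ ‖diagEntry d ‖k‖ (α j)‖)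
    (hoff : ∀ j l, j ≠ l → ‖greenRadial d ‖k‖ ‖y j - y l‖‖ ≤ ε) (hε : 0 ≤ ε)
    (hsmall : n * ε ≤ m / 2) :
    (∃! q, IsCoeff α y k q) ∧ IsCoeff α y k (coeff α y k) ∧
      ∀ j, ‖coeff α y k j * conjWave k (y j) + (diagEntry d ‖k‖ (α j))⁻¹‖ ≤ 2 * n * ε / m ^ 2 := by
  have hAd : ∀ j, matA α y ‖k‖ j j = diagEntry d ‖k‖ (α j) := fun j => by simp [matA]
  have hAo : ∀ j l, j ≠ l → matA α y ‖k‖ j l = greenRadial d ‖k‖ ‖y j - y l‖ := fun j l hjl => by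
    simp [matA, hjl, green]
  obtain ⟨hdet, hest⟩ := mulVec_eq_of_diagonally_dominant (A := matA α y ‖k‖) (b := vecB y k) hm
    (fun j => by rw [hAd]; exact hdiag j) (fun j l hjl => by rw [hAo j l hjl]; exact hoff j l hjl)
    hε hsmall (fun j => by rw [vecB, norm_neg, norm_planeWave])
  have hu : IsUnit (matA α y ‖k‖).det := isUnit_iff_ne_zero.2 hdet
  have hsol : IsCoeff α y k (coeff α y k) := by
    rw [IsCoeff, coeff, Matrix.mulVec_mulVec, Matrix.mul_nonsing_inv _ hu, Matrix.one_mulVec]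
  have hex : ∃! q, IsCoeff α y k q := ⟨coeff α y k, hsol, fun q hq => by
    rw [coeff, ← show _ = _ from hq, Matrix.mulVec_mulVec, Matrix.nonsing_inv_mul _ hu,
      Matrix.one_mulVec]⟩
  refine ⟨hex, hsol, fun j => ?_⟩
  have h1 := hest _ hsol j
  have h2 : coeff α y k j * conjWave k (y j) + (diagEntry d ‖k‖ (α j))⁻¹
      = (coeff α y k j - vecB y k j / matA α y ‖k‖ j j) * conjWave k (y j) := by
    rw [hAd, vecB, div_eq_mul_inv]
    linear_combination (-(diagEntry d ‖k‖ (α j))⁻¹) * planeWave_mul_conjWave k (y j)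
  rw [h2, norm_mul]
  exact (mul_le_of_le_one_right (norm_nonneg _) (norm_conjWave k _)).trans h1

/-! ### The tested scattered wave -/

/-- The translate `φ(· + y)`. -/
def translate {d : ℕ} (φ : Space d → ℂ) (y : Space d) : Space d → ℂ := fun z => φ (z + y)

theorem exists_sliceControl_translate {d : ℕ} {φ : Space d → ℂ} (hs : ContDiff ℝ ∞ φ)
    (hc : HasCompactSupport φ) (y : Space d) : ∃ M R, SliceControl M R (translate φ y) :=
  exists_sliceControl (hs.comp (contDiff_id.add contDiff_const))
    (hc.comp_homeomorph (Homeomorph.addRight y))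

/-- The wave is prescribed only off the scatterers, a null set in positive dimension. Translating by
y_j factors e^{-ik·y_j} out of each summand. -/
theorem testedWave_integral {d n : ℕ} [NeZero d] {y : Fin n → Space d}
    {ψ : Space d → Space d → ℂ} {φ : Space d → ℂ} {k : Space d} {q : Fin n → ℂ}
    (hψ : ∀ x : Space d, (∀ j, x ≠ y j) →
      ψ k x = planeWave k x + ∑ j, q j * green (x - y j) ‖k‖)
    (hi : ∀ j, Integrable fun z =>
      conjWave k z * greenRadial d ‖k‖ ‖z‖ * translate φ (y j) z) :
    Integrable (testedWave ψ φ k) ∧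
      ∫ x, testedWave ψ φ k x =
        ∑ j, q j * conjWave k (y j) * greenPairing (translate φ (y j)) k := by
  set G : Fin n → Space d → ℂ := fun j z =>
    conjWave k z * greenRadial d ‖k‖ ‖z‖ * translate φ (y j) z with hG
  have hae : ∀ᵐ x, testedWave ψ φ k x = ∑ j, q j * conjWave k (y j) * G j (x - y j) := by
    have hpts : ∀ᵐ x : Space d, ∀ j, x ≠ y j :=
      ae_all_iff.2 fun j => compl_mem_ae_iff.2 (measure_singleton (y j))
    filter_upwards [hpts] with x hx
    rw [testedWave, scatteredWave, hψ x hx, add_sub_cancel_left, Finset.mul_sum, Finset.sum_mul]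
    refine Finset.sum_congr rfl fun j _ => ?_
    have h1 := conjWave_add k (x - y j) (y j)
    rw [sub_add_cancel] at h1
    simp only [hG, translate, sub_add_cancel, green]
    rw [← conjWave, h1]
    ring
  have hGi : ∀ j ∈ Finset.univ, Integrable fun x => q j * conjWave k (y j) * G j (x - y j) :=
    fun j _ => ((hi j).comp_sub_right (y j)).const_mul _
  refine ⟨(integrable_finsetSum _ hGi).congr (hae.mono fun x hx => hx.symm), ?_⟩
  rw [integral_congr_ae hae, integral_finsetSum _ hGi]
  refine Finset.sum_congr rfl fun j _ => ?_
  rw [integral_const_mul, integral_sub_right_eq_self (G j)]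
  rfl

/-- The integral of `φ` along the beam issuing from `y` in direction `θ`. -/
def beam {d : ℕ} (φ : Space d → ℂ) (y θ : Space d) : ℂ :=
  ∫ t in Set.Ioi (0 : ℝ), translate φ y (t • θ)

/-- The minus sign of -θ cancels the one in the shift φ(· - tθ), so the delta function at y_j
samples φ along the ray y_j + tθ. -/
theorem beamPairing_deltaComb {d n : ℕ} (c : Fin n → ℂ) (y : Fin n → Space d) {φ : Space d → ℂ}
    (hs : ContDiff ℝ ∞ φ) (hc : HasCompactSupport φ) {θ : Space d} (hθ : ‖θ‖ = 1) :
    beamPairing (deltaComb c y) (-θ) (hc.toSchwartzMap hs) = ∑ j, c j * beam φ (y j) θ := by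
  have h1 : ∀ t : ℝ, deltaComb c y ((hc.toSchwartzMap hs).compSubConstCLM ℂ (t • -θ))
      = ∑ j, c j * translate φ (y j) (t • θ) := fun t => by
    simp [deltaComb, translate, add_comm]
  rw [beamPairing]
  simp only [h1]
  rw [integral_finsetSum]
  · simp only [integral_const_mul, beam]
  · intro j _
    obtain ⟨M, R, h⟩ := exists_sliceControl_translate hs hc (y j)
    exact ((h.integrable_beam hθ).const_mul _).integrableOn

/-- Combination of the asymptotics of the coefficients and of the tested Green function. -/
theorem testedWave_asymptotics {d n : ℕ} [NeZero d] {α : Fin n → ℂ} {y : Fin n → Space d}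
    {p : Fin n → ℝ → ℂ} {P e₁ e₂ E : ℝ → ℝ}
    (hsol : ∀ᶠ k in cobounded (Space d),
      (∃! q : Fin n → ℂ, IsCoeff α y k q) ∧ IsCoeff α y k (coeff α y k))
    (hcoeff : ∀ j, (fun k : Space d => coeff α y k j * conjWave k (y j) - p j ‖k‖)
      =O[cobounded (Space d)] fun k => e₁ ‖k‖)
    (hp : ∀ j, (fun k : Space d => p j ‖k‖) =O[cobounded (Space d)] fun k => P ‖k‖)
    (he : (fun k : Space d => e₁ ‖k‖) =O[cobounded (Space d)] fun k => P ‖k‖)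
    (hE₁ : (fun k : Space d => e₁ ‖k‖ * ‖k‖⁻¹) =O[cobounded (Space d)] fun k => E ‖k‖)
    (hE₂ : (fun k : Space d => P ‖k‖ * e₂ ‖k‖) =O[cobounded (Space d)] fun k => E ‖k‖)
    (hgreen : ∀ (f : Space d → ℂ) (M R : ℝ), SliceControl M R f →
      (∀ᶠ k in cobounded (Space d),
        Integrable fun z => conjWave k z * greenRadial d ‖k‖ ‖z‖ * f z) ∧
      (fun k : Space d => greenPairing f k - (2 * Complex.I * (‖k‖ : ℂ))⁻¹ *
        ∫ t in Set.Ioi (0 : ℝ), f (t • direction k)) =O[cobounded (Space d)] fun k => e₂ ‖k‖)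
    {ψ : Space d → Space d → ℂ} (hψ : IsScatteringSolution α y ψ) {φ : Space d → ℂ}
    (hs : ContDiff ℝ ∞ φ) (hc : HasCompactSupport φ) :
    (∀ᶠ k in cobounded (Space d), Integrable (testedWave ψ φ k)) ∧
      (fun k : Space d => (∫ x, testedWave ψ φ k x) -
        ∑ j, p j ‖k‖ * ((2 * Complex.I * (‖k‖ : ℂ))⁻¹ * beam φ (y j) (direction k)))
        =O[cobounded (Space d)] fun k => E ‖k‖ := by
  choose M R hMR using fun j => exists_sliceControl_translate hs hc (y j)
  have hg := fun j => hgreen _ _ _ (hMR j)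
  have hall : ∀ᶠ k in cobounded (Space d), Integrable (testedWave ψ φ k) ∧
      ∫ x, testedWave ψ φ k x = ∑ j, coeff α y k j * conjWave k (y j) *
        greenPairing (translate φ (y j)) k := by
    filter_upwards [hsol, hψ, eventually_all.2 fun j => (hg j).1] with k h1 ⟨q, hq, hψk⟩ h3
    -- The definition of ψ supplies some solution q at each k. Uniqueness identifies it with
    -- `coeff`, for which the estimates hold.
    rw [h1.1.unique h1.2 hq]
    exact testedWave_integral hψk h3
  refine ⟨hall.mono fun k hk => hk.1, ?_⟩
  have hbeam : ∀ j, (fun k : Space d => (2 * Complex.I * (‖k‖ : ℂ))⁻¹ *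
      beam φ (y j) (direction k)) =O[cobounded (Space d)] fun k => ‖k‖⁻¹ := fun j => by
    refine IsBigO.of_bound (M j * R j) ?_
    filter_upwards [eventually_cobounded_le_norm 1] with k hk
    have hκ : 0 < ‖k‖ := by linarith
    have h1 := (hMR j).norm_integral_beam_le (norm_direction (norm_pos_iff.1 hκ))
    have hMR0 : 0 ≤ M j * R j := (norm_nonneg _).trans h1
    rw [norm_mul, norm_inv, norm_mul, norm_mul, Complex.norm_two, Complex.norm_I,
      Complex.norm_real, norm_norm, norm_inv, norm_norm, mul_one, mul_comm]
    exact mul_le_mul h1 (inv_anti₀ hκ (by linarith)) (by positivity) hMR0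
  have hterm : ∀ j, (fun k : Space d => coeff α y k j * conjWave k (y j) *
      greenPairing (translate φ (y j)) k -
        p j ‖k‖ * ((2 * Complex.I * (‖k‖ : ℂ))⁻¹ * beam φ (y j) (direction k)))
        =O[cobounded (Space d)] fun k => E ‖k‖ := fun j => by
    have hcP : (fun k : Space d => coeff α y k j * conjWave k (y j))
        =O[cobounded (Space d)] fun k => P ‖k‖ :=
      (((hcoeff j).trans he).add (hp j)).congr_left fun k => by ring
    -- With c the coefficient, p its main term, g the pairing and b the beam term: cg - pb = (c -
    -- p)b + c(g - b).
    have t1 := ((hcoeff j).mul (hbeam j)).trans hE₁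
    have t2 := (hcP.mul (hg j).2).trans hE₂
    refine (t1.add t2).congr_left fun k => ?_
    simp only [beam]
    ring
  refine (IsBigO.sum (s := Finset.univ) fun j _ => hterm j).congr' ?_ EventuallyEq.rfl
  filter_upwards [hall] with k hk
  rw [hk.2, Finset.sum_apply, Finset.sum_sub_distrib]

/-! ### Coefficients at high energy -/

/-- The lower bound 1 keeps the constant positive even when there are no scatterers. -/
theorem exists_one_le_bound {ι : Type*} [Finite ι] (v : ι → ℝ) : ∃ B, 1 ≤ B ∧ ∀ i, v i ≤ B := by
  obtain ⟨B, hB⟩ := (Set.finite_range v).bddAbove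
  exact ⟨max 1 B, le_max_left _ _, fun i => (hB ⟨i, rfl⟩).trans (le_max_right _ _)⟩

theorem exists_coeff_one_sub_le {n : ℕ} (α : Fin n → ℂ) (y : Fin n → Space 1)
    (hα : ∀ j, α j ≠ 0) :
    ∃ K C : ℝ, ∀ k : Space 1, K ≤ ‖k‖ →
      (∃! q, IsCoeff α y k q) ∧ IsCoeff α y k (coeff α y k) ∧
      ∀ j, ‖coeff α y k j * conjWave k (y j) - -1 / α j‖ ≤ C * ‖k‖⁻¹ := by
  obtain ⟨B, hB, hαB⟩ := exists_one_le_bound fun j => ‖α j‖⁻¹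
  have hB0 : 0 < B := by linarith
  have hαm : ∀ j, B⁻¹ ≤ ‖α j‖ := fun j => by
    rw [inv_le_comm₀ hB0 (norm_pos_iff.2 (hα j))]
    exact hαB j
  -- The threshold makes (n + 1)/κ ≤ 1/(4B). This yields both |A_jj| ≥ 1/(2B) = m and nε ≤ m/2 with
  -- ε = 1/κ. The first summand of the constant is 2n/m², the second comes from replacing A_jj by
  -- α_j.
  refine ⟨4 * (n + 1) * B, 8 * n * B ^ 2 + 2 * B ^ 2, fun k hk => ?_⟩
  have hn : (0 : ℝ) ≤ n := Nat.cast_nonneg n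
  have hκ : 0 < ‖k‖ := by nlinarith
  have hκi : ‖k‖⁻¹ ≤ B⁻¹ / (4 * (n + 1)) := by
    rw [div_eq_mul_inv, ← mul_inv]
    exact inv_anti₀ (by positivity) (by linarith)
  have hnκ : (n + 1) * ‖k‖⁻¹ ≤ B⁻¹ / 4 := by
    calc (n + 1) * ‖k‖⁻¹ ≤ (n + 1) * (B⁻¹ / (4 * (n + 1))) := by gcongr
      _ = B⁻¹ / 4 := by field_simp
  have hκ0 : 0 < ‖k‖⁻¹ := inv_pos.2 hκ
  have h2κ : ‖(2 * Complex.I * (‖k‖ : ℂ))⁻¹‖ ≤ ‖k‖⁻¹ := by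
    rw [norm_inv, norm_mul, norm_mul, Complex.norm_two, Complex.norm_I, Complex.norm_real,
      norm_norm, mul_one]
    exact inv_anti₀ hκ (by linarith)
  have hD : ∀ j, B⁻¹ / 2 ≤ ‖diagEntry 1 ‖k‖ (α j)‖ := fun j => by
    rw [diagEntry]
    have h1 := norm_sub_le_norm_add (α j) (2 * Complex.I * (‖k‖ : ℂ))⁻¹
    have := hαm j
    have : 0 ≤ n * ‖k‖⁻¹ := by positivity
    linarith
  have hBi : 0 < B⁻¹ := inv_pos.2 hB0
  obtain ⟨h1, h2, h3⟩ := coeff_estimate (α := α) (y := y) (k := k) (m := B⁻¹ / 2) (ε := ‖k‖⁻¹)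
    (by positivity) hD (fun j l _ => by
      rw [greenRadial, norm_div, mul_assoc Complex.I, ← Complex.ofReal_mul, norm_exp_I_mul, one_div,
        ← norm_inv]
      exact h2κ) hκ0.le (by linarith)
  refine ⟨h1, h2, fun j => ?_⟩
  have hDj := hD j
  have hne : diagEntry 1 ‖k‖ (α j) ≠ 0 := norm_pos_iff.1 (by linarith)
  have hαj := hα j
  have h4 : coeff α y k j * conjWave k (y j) - -1 / α j
      = (coeff α y k j * conjWave k (y j) + (diagEntry 1 ‖k‖ (α j))⁻¹) +
        (2 * Complex.I * (‖k‖ : ℂ))⁻¹ * ((diagEntry 1 ‖k‖ (α j))⁻¹ * (α j)⁻¹) := by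
    have h5 : (2 * Complex.I * (‖k‖ : ℂ))⁻¹ = diagEntry 1 ‖k‖ (α j) - α j := by
      rw [diagEntry]; ring
    rw [h5]
    field_simp
    ring
  have h6 : ‖(diagEntry 1 ‖k‖ (α j))⁻¹‖ ≤ 2 * B := by
    rw [norm_inv]
    calc _ ≤ (B⁻¹ / 2)⁻¹ := inv_anti₀ (by positivity) hDj
      _ = 2 * B := by field_simp
  have h7 : ‖(α j)⁻¹‖ ≤ B := by rw [norm_inv]; exact hαB j
  rw [h4]
  refine (norm_add_le _ _).trans ((add_le_add (h3 j) (?_ : _ ≤ ‖k‖⁻¹ * (2 * B * B))).trans_eq ?_)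
  · rw [norm_mul, norm_mul]
    gcongr
  · field_simp
    ring

theorem exists_coeff_three_sub_le {n : ℕ} (α : Fin n → ℂ) (y : Fin n → Space 3) :
    ∃ K C : ℝ, ∀ k : Space 3, K ≤ ‖k‖ →
      (∃! q, IsCoeff α y k q) ∧ IsCoeff α y k (coeff α y k) ∧
      ∀ j, ‖coeff α y k j * conjWave k (y j) - -4 * (Real.pi : ℂ) * Complex.I * (‖k‖ : ℂ)⁻¹‖
        ≤ C * (‖k‖ ^ 2)⁻¹ := by
  obtain ⟨A, hA, hαA⟩ := exists_one_le_bound fun j => ‖α j‖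
  obtain ⟨B, hB, hyB⟩ := exists_one_le_bound fun p : Fin n × Fin n => ‖y p.1 - y p.2‖⁻¹
  have hn : (0 : ℝ) ≤ n := Nat.cast_nonneg n
  have hpi := Real.pi_pos
  have hpi3 := Real.pi_gt_three
  -- Half the modulus of iκ/(4π) is m = κ/(8π). The threshold gives m ≥ 2(A + nB), hence |A_jj| ≥ 2m
  -- - A ≥ m and nB ≤ m/2. The constants come from 2nB/m² and from A · m⁻¹ · 4π/κ.
  refine ⟨16 * Real.pi * (A + n * B), 128 * Real.pi ^ 2 * n * B + 32 * Real.pi ^ 2 * A,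
    fun k hk => ?_⟩
  have hnB : 0 ≤ n * B := by positivity
  have hκ : 0 < ‖k‖ := lt_of_lt_of_le (by positivity) hk
  set m := ‖k‖ / (8 * Real.pi) with hm
  have hm2 : 2 * (A + n * B) ≤ m := by
    rw [hm, le_div_iff₀ (by positivity)]
    linarith
  have hDeq : ‖Complex.I * (4 * (Real.pi : ℂ))⁻¹ * (‖k‖ : ℂ)‖ = 2 * m := by
    rw [norm_mul, norm_mul, norm_inv, norm_mul, Complex.norm_I, Complex.norm_real,
      Complex.norm_real, norm_norm, Real.norm_of_nonneg hpi.le, Complex.norm_ofNat, hm]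
    field_simp
    norm_num
  have hD : ∀ j, m ≤ ‖diagEntry 3 ‖k‖ (α j)‖ := fun j => by
    rw [diagEntry, norm_sub_rev]
    have h1 := norm_sub_norm_le (Complex.I * (4 * (Real.pi : ℂ))⁻¹ * (‖k‖ : ℂ)) (α j)
    rw [hDeq] at h1
    have := hαA j
    linarith
  have hm0 : 0 < m := by positivity
  obtain ⟨h1, h2, h3⟩ := coeff_estimate (α := α) (y := y) (k := k) (m := m) (ε := B)
    hm0 hD (fun j l _ => by
      rw [greenRadial, norm_neg, norm_div, mul_assoc Complex.I, ← Complex.ofReal_mul,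
        norm_exp_I_mul, norm_mul, norm_mul, Complex.norm_real, Complex.norm_real,
        Real.norm_of_nonneg hpi.le, norm_norm, Complex.norm_ofNat, one_div, mul_inv]
      have := hyB (j, l)
      have h4 : (4 * Real.pi)⁻¹ ≤ 1 := inv_le_one_of_one_le₀ (by linarith)
      exact (mul_le_of_le_one_left (by positivity) h4).trans this) (by linarith) (by linarith)
  refine ⟨h1, h2, fun j => ?_⟩
  have hDj := hD j
  have hne : diagEntry 3 ‖k‖ (α j) ≠ 0 := norm_pos_iff.1 (by linarith)
  have hkC : (‖k‖ : ℂ) ≠ 0 := by exact_mod_cast hκ.ne'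
  have hpiC : (Real.pi : ℂ) ≠ 0 := by exact_mod_cast hpi.ne'
  have h4 : coeff α y k j * conjWave k (y j) - -4 * (Real.pi : ℂ) * Complex.I * (‖k‖ : ℂ)⁻¹
      = (coeff α y k j * conjWave k (y j) + (diagEntry 3 ‖k‖ (α j))⁻¹) +
        α j * ((diagEntry 3 ‖k‖ (α j))⁻¹ * (4 * (Real.pi : ℂ) * Complex.I * (‖k‖ : ℂ)⁻¹)) := by
    have h5 : α j = diagEntry 3 ‖k‖ (α j) + Complex.I * (4 * (Real.pi : ℂ))⁻¹ * (‖k‖ : ℂ) := by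
      rw [diagEntry]; ring
    generalize diagEntry 3 ‖k‖ (α j) = D at *
    rw [h5]
    have hI := Complex.I_mul_I
    field_simp
    linear_combination (-(‖k‖ : ℂ)) * hI
  have h6 : ‖(diagEntry 3 ‖k‖ (α j))⁻¹‖ ≤ m⁻¹ := by
    rw [norm_inv]
    exact inv_anti₀ hm0 hDj
  have h7 : ‖4 * (Real.pi : ℂ) * Complex.I * (‖k‖ : ℂ)⁻¹‖ = 4 * Real.pi * ‖k‖⁻¹ := by
    rw [norm_mul, norm_mul, norm_mul, norm_inv, Complex.norm_I, Complex.norm_real,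
      Complex.norm_real, norm_norm, Real.norm_of_nonneg hpi.le, Complex.norm_ofNat, mul_one]
  rw [h4]
  refine (norm_add_le _ _).trans ((add_le_add (h3 j)
    (?_ : _ ≤ A * (m⁻¹ * (4 * Real.pi * ‖k‖⁻¹)))).trans_eq ?_)
  · rw [norm_mul, norm_mul, h7]
    have := hαA j
    gcongr
  · rw [hm]
    field_simp
    ring

/-- At a fixed positive distance the off-diagonal entries decay like κ^{-1/2}, faster than any power
of 1/ln κ. -/
theorem norm_green_two_le {κ r : ℝ} (hκ : 1 ≤ κ) (hr : 0 < r) :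
    ‖greenRadial 2 κ r‖ ≤ ((√r)⁻¹ + (r * √r)⁻¹) * (√κ)⁻¹ := by
  have hκ0 : 0 < κ := by linarith
  have h1 := norm_hankelH10_sub_lead_le (mul_pos hr hκ0)
  have h2 := norm_hankelLead_le (r := r * κ)
  have h3 : ‖hankelH10 (r * κ)‖ ≤ (r * κ * √(r * κ))⁻¹ + (√(r * κ))⁻¹ := by
    calc _ = ‖(hankelH10 (r * κ) - hankelLead (r * κ)) + hankelLead (r * κ)‖ := by
          rw [sub_add_cancel]
      _ ≤ _ := (norm_add_le _ _).trans (add_le_add h1 h2)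
  have h4 : (r * κ * √(r * κ))⁻¹ ≤ (r * √r)⁻¹ * (√κ)⁻¹ := by
    rw [Real.sqrt_mul hr.le, ← mul_inv]
    refine inv_anti₀ (by positivity) ?_
    calc r * √r * √κ = 1 * (r * √r * √κ) := by ring
      _ ≤ κ * (r * √r * √κ) := by gcongr
      _ = _ := by ring
  have h5 : (√(r * κ))⁻¹ = (√r)⁻¹ * (√κ)⁻¹ := by rw [Real.sqrt_mul hr.le, mul_inv]
  have h6 : ‖-(Complex.I / 4)‖ = 1 / 4 := by simp
  rw [greenRadial, norm_mul, h6]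
  rw [h5] at h3
  have := norm_nonneg (hankelH10 (r * κ))
  linarith

theorem log_le_two_mul_sqrt {κ : ℝ} (hκ : 0 < κ) : Real.log κ ≤ 2 * √κ := by
  have h1 := Real.log_le_sub_one_of_pos (Real.sqrt_pos.2 hκ)
  rw [Real.log_sqrt hκ.le] at h1
  linarith

/-- The two leading terms of the coefficients in dimension two. -/
def planarCoeff (a : ℂ) (κ : ℝ) : ℂ :=
  -2 * (Real.pi : ℂ) * ((Real.log κ : ℝ) : ℂ)⁻¹ +
    4 * (Real.pi : ℂ) ^ 2 * (a - Complex.I / 4) * (((Real.log κ : ℝ) : ℂ) ^ 2)⁻¹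

theorem exists_coeff_two_sub_le {n : ℕ} (α : Fin n → ℂ) (y : Fin n → Space 2)
    (hy : Function.Injective y) :
    ∃ K C : ℝ, ∀ k : Space 2, K ≤ ‖k‖ →
      (∃! q, IsCoeff α y k q) ∧ IsCoeff α y k (coeff α y k) ∧
      ∀ j, ‖coeff α y k j * conjWave k (y j) - planarCoeff (α j) ‖k‖‖
        ≤ C * (Real.log ‖k‖ ^ 3)⁻¹ := by
  obtain ⟨A, hA, hαA⟩ := exists_one_le_bound fun j => ‖α j - Complex.I / 4‖
  obtain ⟨B, hB, hyB⟩ := exists_one_le_bound fun p : Fin n × Fin n =>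
    (√‖y p.1 - y p.2‖)⁻¹ + (‖y p.1 - y p.2‖ * √‖y p.1 - y p.2‖)⁻¹
  have hn : (0 : ℝ) ≤ n := Nat.cast_nonneg n
  have hpi := Real.pi_pos
  have hpi3 := Real.pi_gt_three
  have hnB : 0 ≤ n * B := by positivity
  -- The threshold says that ℓ = ln κ/(2π) is at least 2A + 4nB, so |A_jj| ≥ ℓ - A ≥ ℓ/2 = m and nB
  -- ≤ m/2. The factor 8π³ converts ℓ⁻³ into (ln κ)⁻³.
  refine ⟨Real.exp (2 * Real.pi * (2 * A + 4 * (n * B))),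
    8 * Real.pi ^ 3 * (8 * (n * B) + 2 * A ^ 2), fun k hk => ?_⟩
  have hκ1 : 1 ≤ ‖k‖ := (Real.one_le_exp (by positivity)).trans hk
  have hκ : 0 < ‖k‖ := by linarith
  set ℓ := Real.log ‖k‖ / (2 * Real.pi) with hℓ
  have hℓ2 : 2 * A + 4 * (n * B) ≤ ℓ := by
    rw [hℓ, le_div_iff₀ (by positivity), mul_comm]
    exact (Real.le_log_iff_exp_le hκ).2 hk
  have hℓ0 : 0 < ℓ := by linarith
  have hlog : Real.log ‖k‖ = 2 * Real.pi * ℓ := by rw [hℓ]; field_simp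
  have hsκ : 1 ≤ √‖k‖ := Real.one_le_sqrt.2 hκ1
  have hℓκ : ℓ ≤ √‖k‖ := by
    have := log_le_two_mul_sqrt hκ
    rw [hlog] at this
    nlinarith
  have hpiC : (Real.pi : ℂ) ≠ 0 := by exact_mod_cast hpi.ne'
  have hDeq : ∀ j, diagEntry 2 ‖k‖ (α j) = (α j - Complex.I / 4) + (ℓ : ℂ) := fun j => by
    rw [diagEntry, hlog]
    push_cast
    field_simp
    ring
  have hD : ∀ j, ℓ / 2 ≤ ‖diagEntry 2 ‖k‖ (α j)‖ := fun j => by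
    rw [hDeq, add_comm]
    have h1 := norm_sub_le_norm_add (ℓ : ℂ) (α j - Complex.I / 4)
    rw [Complex.norm_real, Real.norm_of_nonneg hℓ0.le] at h1
    have := hαA j
    linarith
  obtain ⟨h1, h2, h3⟩ := coeff_estimate (α := α) (y := y) (k := k) (m := ℓ / 2)
    (ε := B * (√‖k‖)⁻¹) (by positivity) hD (fun j l hjl => by
      have hr : 0 < ‖y j - y l‖ := norm_pos_iff.2 (sub_ne_zero.2 (hy.ne hjl))
      refine (norm_green_two_le hκ1 hr).trans ?_
      have := hyB (j, l)
      gcongr) (by positivity) (by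
      have h4 : (√‖k‖)⁻¹ ≤ 1 := inv_le_one_of_one_le₀ hsκ
      have h5 : n * (B * (√‖k‖)⁻¹) ≤ n * B := by
        rw [← mul_assoc]
        exact mul_le_of_le_one_right hnB h4
      linarith)
  refine ⟨h1, h2, fun j => ?_⟩
  have hDj := hD j
  have hℓC : (ℓ : ℂ) ≠ 0 := by exact_mod_cast hℓ0.ne'
  have hne : diagEntry 2 ‖k‖ (α j) ≠ 0 := norm_pos_iff.1 (by linarith)
  -- With β = α_j - i/4 and A_jj = β + ℓ, the geometric expansion is -1/(β + ℓ) = -1/ℓ + β/ℓ² -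
  -- β²/(ℓ²(β + ℓ)). Its first two terms are `planarCoeff`.
  have h4 : coeff α y k j * conjWave k (y j) - planarCoeff (α j) ‖k‖
      = (coeff α y k j * conjWave k (y j) + (diagEntry 2 ‖k‖ (α j))⁻¹) -
        (α j - Complex.I / 4) ^ 2 * (((ℓ : ℂ) ^ 2)⁻¹ * (diagEntry 2 ‖k‖ (α j))⁻¹) := by
    rw [planarCoeff, hlog]
    rw [hDeq] at hne ⊢
    generalize α j - Complex.I / 4 = β at *
    push_cast
    field_simp
    ring
  have h6 : ‖(diagEntry 2 ‖k‖ (α j))⁻¹‖ ≤ (ℓ / 2)⁻¹ := by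
    rw [norm_inv]
    exact inv_anti₀ (by positivity) hDj
  have h7 : ‖((ℓ : ℂ) ^ 2)⁻¹‖ = (ℓ ^ 2)⁻¹ := by
    rw [norm_inv, norm_pow, Complex.norm_real, Real.norm_of_nonneg hℓ0.le]
  -- The coupling between scatterers is of order κ^{-1/2} ℓ⁻², and ℓ ≤ √κ brings it down to the
  -- order ℓ⁻³ of the truncation error.
  have h8 : 2 * n * (B * (√‖k‖)⁻¹) / (ℓ / 2) ^ 2 ≤ 8 * (n * B) * (ℓ ^ 3)⁻¹ := by
    calc _ ≤ 2 * n * (B * ℓ⁻¹) / (ℓ / 2) ^ 2 := by gcongr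
      _ = _ := by field_simp; ring
  have h9 : ‖(α j - Complex.I / 4) ^ 2 * (((ℓ : ℂ) ^ 2)⁻¹ * (diagEntry 2 ‖k‖ (α j))⁻¹)‖
      ≤ 2 * A ^ 2 * (ℓ ^ 3)⁻¹ := by
    rw [norm_mul, norm_mul, h7, norm_pow]
    have := hαA j
    calc _ ≤ A ^ 2 * ((ℓ ^ 2)⁻¹ * (ℓ / 2)⁻¹) := by gcongr
      _ = _ := by field_simp
  rw [h4]
  refine (norm_sub_le _ _).trans ((add_le_add ((h3 j).trans h8) h9).trans_eq ?_)
  rw [hlog]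
  field_simp
  ring

/-! ### High-energy asymptotics, dimension by dimension -/

theorem asymptotics_one {n : ℕ} (α : Fin n → ℂ) (y : Fin n → Space 1) (hα : ∀ j, α j ≠ 0) :
    (∀ᶠ k in cobounded (Space 1), ∃! q : Fin n → ℂ, IsCoeff α y k q) ∧
    ∀ ψ : Space 1 → Space 1 → ℂ, IsScatteringSolution α y ψ →
    ∀ (φ : Space 1 → ℂ) (hs : ContDiff ℝ ∞ φ) (hc : HasCompactSupport φ),
      (∀ᶠ k in cobounded (Space 1), Integrable (testedWave ψ φ k)) ∧
      (fun k : Space 1 => (∫ x, testedWave ψ φ k x) -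
          (2 * Complex.I * (‖k‖ : ℂ))⁻¹ *
            beamPairing (v11 α y) (-direction k) (hc.toSchwartzMap hs))
        =O[cobounded (Space 1)] fun k => (‖k‖ ^ 2)⁻¹ := by
  obtain ⟨K, C, hKC⟩ := exists_coeff_one_sub_le α y hα
  have hK := eventually_cobounded_le_norm (E := Space 1) K
  refine ⟨hK.mono fun k hk => (hKC k hk).1, fun ψ hψ φ hs hc => ?_⟩
  have h := testedWave_asymptotics (α := α) (y := y) (p := fun j _ => -1 / α j) (P := fun _ => 1)
    (e₁ := fun κ => κ⁻¹) (e₂ := fun κ => (κ ^ 2)⁻¹) (E := fun κ => (κ ^ 2)⁻¹)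
    (hK.mono fun k hk => ⟨(hKC k hk).1, (hKC k hk).2.1⟩)
    (fun j => IsBigO.of_bound C <| hK.mono fun k hk => by
      rw [norm_inv, norm_norm]
      exact (hKC k hk).2.2 j)
    (fun j => isBigO_const_const _ one_ne_zero _)
    (IsBigO.of_bound 1 <| (eventually_cobounded_le_norm 1).mono fun k hk => by
      rw [norm_inv, norm_norm, norm_one, mul_one]
      exact inv_le_one_of_one_le₀ hk)
    ((isBigO_refl _ _).congr_left fun k => by ring)
    ((isBigO_refl _ _).congr_left fun k => by ring)
    (fun f M R hf => ⟨Eventually.of_forall fun k => integrable_green_one hf k,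
      IsBigO.of_bound (M * (1 + R)) <| (eventually_cobounded_le_norm 1).mono fun k hk => by
        rw [Real.norm_of_nonneg (by positivity)]
        exact greenPairing_one_sub_le hf hk⟩) hψ hs hc
  refine ⟨h.1, h.2.congr' ?_ EventuallyEq.rfl⟩
  filter_upwards [eventually_cobounded_le_norm 1] with k hk
  have hθ := norm_direction (norm_pos_iff.1 (by linarith : 0 < ‖k‖))
  rw [v11, beamPairing_deltaComb _ _ hs hc hθ, Finset.mul_sum]
  congr 1
  exact Finset.sum_congr rfl fun j _ => by ring

theorem asymptotics_three {n : ℕ} (α : Fin n → ℂ) (y : Fin n → Space 3) :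
    (∀ᶠ k in cobounded (Space 3), ∃! q : Fin n → ℂ, IsCoeff α y k q) ∧
    ∀ ψ : Space 3 → Space 3 → ℂ, IsScatteringSolution α y ψ →
    ∀ (φ : Space 3 → ℂ) (hs : ContDiff ℝ ∞ φ) (hc : HasCompactSupport φ),
      (∀ᶠ k in cobounded (Space 3), Integrable (testedWave ψ φ k)) ∧
      (fun k : Space 3 => (∫ x, testedWave ψ φ k x) -
          (2 * Complex.I)⁻¹ * ((‖k‖ : ℂ) ^ 2)⁻¹ *
            beamPairing (v31 y) (-direction k) (hc.toSchwartzMap hs))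
        =O[cobounded (Space 3)] fun k => (‖k‖ ^ 3)⁻¹ := by
  obtain ⟨K, C, hKC⟩ := exists_coeff_three_sub_le α y
  have hK := eventually_cobounded_le_norm (E := Space 3) K
  refine ⟨hK.mono fun k hk => (hKC k hk).1, fun ψ hψ φ hs hc => ?_⟩
  have h := testedWave_asymptotics (α := α) (y := y)
    (p := fun _ κ => -4 * (Real.pi : ℂ) * Complex.I * (κ : ℂ)⁻¹) (P := fun κ => κ⁻¹)
    (e₁ := fun κ => (κ ^ 2)⁻¹) (e₂ := fun κ => (κ ^ 2)⁻¹) (E := fun κ => (κ ^ 3)⁻¹)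
    (hK.mono fun k hk => ⟨(hKC k hk).1, (hKC k hk).2.1⟩)
    (fun j => IsBigO.of_bound C <| hK.mono fun k hk => by
      rw [Real.norm_of_nonneg (by positivity)]
      exact (hKC k hk).2.2 j)
    (fun j => IsBigO.of_bound ‖-4 * (Real.pi : ℂ) * Complex.I‖ <| Eventually.of_forall fun k => by
      rw [norm_mul _ (‖k‖ : ℂ)⁻¹, norm_inv, norm_inv, norm_norm, Complex.norm_real, norm_norm])
    (IsBigO.of_bound 1 <| (eventually_cobounded_le_norm 1).mono fun k hk => by
      have hκ : 0 < ‖k‖ := by linarith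
      rw [Real.norm_of_nonneg (by positivity), Real.norm_of_nonneg (by positivity), one_mul]
      exact inv_anti₀ hκ (by nlinarith))
    ((isBigO_refl _ _).congr_left fun k => by ring)
    ((isBigO_refl _ _).congr_left fun k => by ring)
    (fun f M R hf => ⟨Eventually.of_forall fun k => integrable_green_three hf k,
      IsBigO.of_bound _ <| (eventually_cobounded_le_norm 1).mono fun k hk => by
        rw [Real.norm_of_nonneg (by positivity : 0 ≤ (‖k‖ ^ 2)⁻¹)]
        exact greenPairing_three_sub_le hf hk⟩) hψ hs hc
  refine ⟨h.1, h.2.congr' ?_ EventuallyEq.rfl⟩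
  filter_upwards [eventually_cobounded_le_norm 1] with k hk
  have hθ := norm_direction (norm_pos_iff.1 (by linarith : 0 < ‖k‖))
  rw [v31, beamPairing_deltaComb _ _ hs hc hθ, Finset.mul_sum]
  congr 1
  refine Finset.sum_congr rfl fun j _ => ?_
  rw [mul_inv _ (‖k‖ : ℂ)]
  ring

/-- This places the error κ^{-3/2} of the planar pairing below κ⁻¹(ln κ)⁻³. The constant is 6³, from
ln κ ≤ 6 κ^{1/6}. -/
theorem log_pow_three_le {κ : ℝ} (hκ : 1 ≤ κ) : Real.log κ ^ 3 ≤ 216 * √κ := by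
  have hκ0 : 0 ≤ κ := by linarith
  have h1 := Real.log_le_rpow_div hκ0 (ε := 1 / 6) (by norm_num)
  have h2 : (κ ^ (1 / 6 : ℝ)) ^ 3 = √κ := by
    rw [← Real.rpow_natCast, ← Real.rpow_mul hκ0, Real.sqrt_eq_rpow]
    norm_num
  calc Real.log κ ^ 3 ≤ (κ ^ (1 / 6 : ℝ) / (1 / 6)) ^ 3 := by
        have := Real.log_nonneg hκ
        gcongr
    _ = 216 * (κ ^ (1 / 6 : ℝ)) ^ 3 := by ring
    _ = 216 * √κ := by rw [h2]

theorem one_le_log_of_exp_le {κ : ℝ} (hκ : Real.exp 1 ≤ κ) : 1 ≤ Real.log κ :=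
  (Real.le_log_iff_exp_le ((Real.exp_pos 1).trans_le hκ)).2 hκ

theorem norm_planarCoeff_le (a : ℂ) {κ : ℝ} (hκ : Real.exp 1 ≤ κ) :
    ‖planarCoeff a κ‖ ≤ ‖-2 * (Real.pi : ℂ)‖ + ‖4 * (Real.pi : ℂ) ^ 2 * (a - Complex.I / 4)‖ := by
  have h1 := one_le_log_of_exp_le hκ
  have h2 : ‖((Real.log κ : ℝ) : ℂ)⁻¹‖ ≤ 1 := by
    rw [norm_inv, Complex.norm_real, Real.norm_of_nonneg (by linarith)]
    exact inv_le_one_of_one_le₀ h1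
  have h3 : ‖(((Real.log κ : ℝ) : ℂ) ^ 2)⁻¹‖ ≤ 1 := by
    rw [norm_inv, norm_pow, Complex.norm_real, Real.norm_of_nonneg (by linarith)]
    exact inv_le_one_of_one_le₀ (by nlinarith)
  rw [planarCoeff]
  refine (norm_add_le _ _).trans (add_le_add ?_ ?_)
  · rw [norm_mul _ (_)⁻¹]
    exact mul_le_of_le_one_right (norm_nonneg _) h2
  · rw [norm_mul _ (_)⁻¹]
    exact mul_le_of_le_one_right (norm_nonneg _) h3

theorem asymptotics_two {n : ℕ} (α : Fin n → ℂ) (y : Fin n → Space 2)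
    (hy : Function.Injective y) :
    (∀ᶠ k in cobounded (Space 2), ∃! q : Fin n → ℂ, IsCoeff α y k q) ∧
    ∀ ψ : Space 2 → Space 2 → ℂ, IsScatteringSolution α y ψ →
    ∀ (φ : Space 2 → ℂ) (hs : ContDiff ℝ ∞ φ) (hc : HasCompactSupport φ),
      (∀ᶠ k in cobounded (Space 2), Integrable (testedWave ψ φ k)) ∧
      (fun k : Space 2 => (∫ x, testedWave ψ φ k x) -
          ((2 * Complex.I * (‖k‖ : ℂ))⁻¹ * ((Real.log ‖k‖ : ℝ) : ℂ)⁻¹ *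
              beamPairing (v21 y) (-direction k) (hc.toSchwartzMap hs) +
            (2 * Complex.I * (‖k‖ : ℂ))⁻¹ * (((Real.log ‖k‖ : ℝ) : ℂ) ^ 2)⁻¹ *
              beamPairing (v22 α y) (-direction k) (hc.toSchwartzMap hs)))
        =O[cobounded (Space 2)] fun k => ‖k‖⁻¹ * ((Real.log ‖k‖) ^ 3)⁻¹ := by
  obtain ⟨K, C, hKC⟩ := exists_coeff_two_sub_le α y hy
  have hK := eventually_cobounded_le_norm (E := Space 2) K
  have hexp := eventually_cobounded_le_norm (E := Space 2) (Real.exp 1)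
  have hexp1 : (1 : ℝ) ≤ Real.exp 1 := Real.one_le_exp zero_le_one
  refine ⟨hK.mono fun k hk => (hKC k hk).1, fun ψ hψ φ hs hc => ?_⟩
  have h := testedWave_asymptotics (α := α) (y := y)
    -- The crude size P = 1 ignores the decay 1/ln κ of the coefficients. It suffices because the
    -- pairing error κ^{-3/2} has a power of κ to spare.
    (p := fun j κ => planarCoeff (α j) κ) (P := fun _ => 1)
    (e₁ := fun κ => (Real.log κ ^ 3)⁻¹) (e₂ := fun κ => (κ * √κ)⁻¹)
    (E := fun κ => κ⁻¹ * (Real.log κ ^ 3)⁻¹)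
    (hK.mono fun k hk => ⟨(hKC k hk).1, (hKC k hk).2.1⟩)
    (fun j => IsBigO.of_bound C <| (hK.and hexp).mono fun k hk => by
      have := one_le_log_of_exp_le hk.2
      rw [Real.norm_of_nonneg (by positivity)]
      exact (hKC k hk.1).2.2 j)
    (fun j => IsBigO.of_bound _ <| hexp.mono fun k hk => by
      rw [norm_one, mul_one]
      exact norm_planarCoeff_le (α j) hk)
    (IsBigO.of_bound 1 <| hexp.mono fun k hk => by
      have := one_le_log_of_exp_le hk
      rw [Real.norm_of_nonneg (by positivity), norm_one, mul_one]
      exact inv_le_one_of_one_le₀ (one_le_pow₀ this))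
    ((isBigO_refl _ _).congr_left fun k => by ring)
    (IsBigO.of_bound 216 <| hexp.mono fun k hk => by
      have hlog := one_le_log_of_exp_le hk
      have hκ1 : 1 ≤ ‖k‖ := hexp1.trans hk
      have hκ : 0 < ‖k‖ := by linarith
      have hl3 : 0 < Real.log ‖k‖ ^ 3 := by positivity
      rw [one_mul, Real.norm_of_nonneg (by positivity), Real.norm_of_nonneg (by positivity),
        mul_inv, mul_left_comm]
      refine mul_le_mul_of_nonneg_left ?_ (by positivity)
      rw [← div_eq_mul_inv, le_div_iff₀ hl3, inv_mul_le_iff₀ (Real.sqrt_pos.2 hκ), mul_comm]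
      exact log_pow_three_le hκ1)
    (fun f M R hf => by
      obtain ⟨C', hC'⟩ := exists_greenPairing_two_sub_le hf
      have h1 := eventually_cobounded_le_norm (E := Space 2) 1
      exact ⟨h1.mono fun k hk => integrable_green_two hf (by linarith),
        IsBigO.of_bound C' <| h1.mono fun k hk => by
          rw [Real.norm_of_nonneg (by positivity)]
          exact hC' k hk⟩) hψ hs hc
  refine ⟨h.1, h.2.congr' ?_ EventuallyEq.rfl⟩
  filter_upwards [eventually_cobounded_le_norm 1] with k hk
  have hθ := norm_direction (norm_pos_iff.1 (by linarith : 0 < ‖k‖))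
  rw [v21, v22, beamPairing_deltaComb _ _ hs hc hθ, beamPairing_deltaComb _ _ hs hc hθ,
    Finset.mul_sum, Finset.mul_sum, ← Finset.sum_add_distrib]
  congr 1
  refine Finset.sum_congr rfl fun j _ => ?_
  rw [planarCoeff]
  ring

end PointScatterers

end

/-- High-energy asymptotics of the scattered wave of a multipoint potential, tested against smooth
compactly supported functions, in terms of divergent beam transforms. The filter
`cobounded (Space d)` is `|k| → ∞`, so the estimates are uniform in the direction of `k`. -/
theorem theorem3p5 {n : ℕ} :
    -- dimension one
    (∀ (α : Fin n → ℂ) (y : Fin n → Space 1), Function.Injective y → (∀ j, α j ≠ 0) →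
      (∀ᶠ k in cobounded (Space 1), ∃! q : Fin n → ℂ, IsCoeff α y k q) ∧
      ∀ ψ : Space 1 → Space 1 → ℂ, IsScatteringSolution α y ψ →
      ∀ (φ : Space 1 → ℂ) (hs : ContDiff ℝ ∞ φ) (hc : HasCompactSupport φ),
        (∀ᶠ k in cobounded (Space 1), Integrable (testedWave ψ φ k)) ∧
        (fun k : Space 1 => (∫ x, testedWave ψ φ k x) -
            (2 * Complex.I * (‖k‖ : ℂ))⁻¹ *
              beamPairing (v11 α y) (-direction k) (hc.toSchwartzMap hs))
          =O[cobounded (Space 1)] fun k => (‖k‖ ^ 2)⁻¹) ∧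
    -- dimension two
    (∀ (α : Fin n → ℂ) (y : Fin n → Space 2), Function.Injective y →
      (∀ᶠ k in cobounded (Space 2), ∃! q : Fin n → ℂ, IsCoeff α y k q) ∧
      ∀ ψ : Space 2 → Space 2 → ℂ, IsScatteringSolution α y ψ →
      ∀ (φ : Space 2 → ℂ) (hs : ContDiff ℝ ∞ φ) (hc : HasCompactSupport φ),
        (∀ᶠ k in cobounded (Space 2), Integrable (testedWave ψ φ k)) ∧
        (fun k : Space 2 => (∫ x, testedWave ψ φ k x) -
            ((2 * Complex.I * (‖k‖ : ℂ))⁻¹ * ((Real.log ‖k‖ : ℝ) : ℂ)⁻¹ *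
                beamPairing (v21 y) (-direction k) (hc.toSchwartzMap hs) +
              (2 * Complex.I * (‖k‖ : ℂ))⁻¹ * (((Real.log ‖k‖ : ℝ) : ℂ) ^ 2)⁻¹ *
                beamPairing (v22 α y) (-direction k) (hc.toSchwartzMap hs)))
          =O[cobounded (Space 2)] fun k => ‖k‖⁻¹ * ((Real.log ‖k‖) ^ 3)⁻¹) ∧
    -- dimension three
    (∀ (α : Fin n → ℂ) (y : Fin n → Space 3), Function.Injective y →
      (∀ᶠ k in cobounded (Space 3), ∃! q : Fin n → ℂ, IsCoeff α y k q) ∧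
      ∀ ψ : Space 3 → Space 3 → ℂ, IsScatteringSolution α y ψ →
      ∀ (φ : Space 3 → ℂ) (hs : ContDiff ℝ ∞ φ) (hc : HasCompactSupport φ),
        (∀ᶠ k in cobounded (Space 3), Integrable (testedWave ψ φ k)) ∧
        (fun k : Space 3 => (∫ x, testedWave ψ φ k x) -
            (2 * Complex.I)⁻¹ * ((‖k‖ : ℂ) ^ 2)⁻¹ *
              beamPairing (v31 y) (-direction k) (hc.toSchwartzMap hs))
          =O[cobounded (Space 3)] fun k => (‖k‖ ^ 3)⁻¹) := by
  exact ⟨fun α y _ hα => asymptotics_one α y hα, fun α y hy => asymptotics_two α y hy,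
    fun α y _ => asymptotics_three α y⟩
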